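/- **Setting.** Let $S,T\subseteq\mathbb Z$ be intervals of integers (finite or infinite) with at least two points each, and let $V=S\times T\subseteq\mathbb Z^2$ be the corresponding quad-graph. For a face with corners $\mathfrak p=(j,k)$, $\mathfrak q=(j+1,k)$, $\mathfrak r=(j+1,k+1)$, $\mathfrak s=(j,k+1)$ the positively oriented edges are $\mathfrak{qp},\mathfrak{rs}$ (first kind, $E_1$) and $\mathfrak{sp},\mathfrak{rq}$ (second kind, $E_2$). Quaternions are the matrices in $\mathbb H=\mathrm{span}_{\mathbb R}(1,-i\sigma_1,-i\sigma_2,-i\sigma_3)$ with the Pauli matrices $\sigma_m$, and $\mathbb R^3=\mathrm{Im}\,\mathbb H=\mathrm{span}_{\mathbb R}(-i\sigma_1,-i\sigma_2,-i\sigma_3)$. A connection $\eta$ assigns to each edge an element of $\mathbb H^\times$ (inverse on the reversed edge); it is flat if $\eta_{\mathfrak{rq}}\eta_{\mathfrak{qp}}=\eta_{\mathfrak{rs}}\eta_{\mathfrak{sp}}$ on all faces, and a frame $\Phi:V\to\mathbb H^\times$ is parallel if $\Phi(\mathfrak i)=\eta_{\mathfrak{ip}}\Phi(\mathfrak p)$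 on all edges. An edge object is $j$- (resp. $k$-) invariant if it is unchanged under $j\mapsto j+1$ (resp. $k\mapsto k+1$), for all $t$. *CMC-type connection*, $t\in\mathbb R$: $$\eta_{e_1}=\frac1\alpha\begin{pmatrix}\mathfrak v&-e^{it}u-e^{-it}u^{-1}\\ e^{-it}u+e^{it}u^{-1}&\bar{\mathfrak v}\end{pmatrix},\qquad \eta_{e_2}=\frac1\beta\begin{pmatrix}\mathfrak h&-ie^{it}v+ie^{-it}v^{-1}\\ ie^{it}v^{-1}-ie^{-it}v&\bar{\mathfrak h}\end{pmatrix},$$ with $u,v$ real and nonzero, $\mathfrak v,\mathfrak h$ complex (all independent of $t$), $\alpha^2=|\mathfrak v|^2+u^2+u^{-2}+e^{2it}+e^{-2it}$, $\beta^2=|\mathfrak h|^2+v^2+v^{-2}-e^{2it}-e^{-2it}$. *cK-type connection*, $t\in\mathbb R$: $$\eta_{e_1}=\frac1\alpha\begin{pmatrix}\mathfrak v&e^{-t}u-e^{t}u^{-1}\\ e^{t}u-e^{-t}u^{-1}&\bar{\mathfrak v}\end{pmatrix},\qquad \eta_{e_2}=\frac1\beta\begin{pmatrix}\mathfrak h&e^{-t}v-e^{t}v^{-1}\\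 e^{t}v-e^{-t}v^{-1}&\bar{\mathfrak h}\end{pmatrix},$$ with $|u|=|v|=1$, $\mathfrak v,\mathfrak h$ complex, $\alpha^2=|\mathfrak v|^2-u^2-u^{-2}+e^{2t}+e^{-2t}$, $\beta^2=|\mathfrak h|^2-v^2-v^{-2}+e^{2t}+e^{-2t}$. In both types $\alpha,\beta$ are real, differentiable in $t$, nowhere zero, and coincide on opposite edges: $\alpha_{\mathfrak{qp}}=\alpha_{\mathfrak{rs}}$, $\beta_{\mathfrak{sp}}=\beta_{\mathfrak{rq}}$. *Sym formula.* A family $\Phi_t$ of frames differentiable in $t$ gives, for each $t$, the pair $\mathbf n=\Phi^{-1}(-i\sigma_3)\Phi$, $\mathbf x=\xi[\Phi^{-1}\partial_t\Phi]^{\mathrm{tr}=0}+\tau\mathbf n$, where $A^{\mathrm{tr}=0}=A-\tfrac12\mathrm{tr}(A)\,1$. A rigid motion is $(\mathbf x,\mathbf n)\mapsto(R^{-1}\mathbf xR+\mathbf w,\;R^{-1}\mathbf nR)$ with constants $R\in\mathbb H^\times$, $\mathbf w\in\mathbb R^3$. *Nets.* A c-net (circular net) is a pair $(\mathbf x,\mathbf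 n):V\to\mathbb R^3\times\mathbb S^2$ such that for each edge, with $\delta$ the difference and $\sigma$ the sum of its end values, $\delta\mathbf x\perp\sigma\mathbf n$, $\delta\mathbf x\ne0$, $\sigma\mathbf n\ne0$, $\delta\mathbf n\parallel\delta\mathbf x$; and for each face the four points $\mathbf x$ lie on a circle and there is a unit vector $N$ orthogonal to $\mathbf n(\mathfrak r)-\mathbf n(\mathfrak p)$ and $\mathbf n(\mathfrak q)-\mathbf n(\mathfrak s)$ with $\det(\mathbf x(\mathfrak r)-\mathbf x(\mathfrak p),\mathbf x(\mathfrak q)-\mathbf x(\mathfrak s),N)\neq0$. Its Gaussian curvature on the face is $$K=\frac{\det(\mathbf n(\mathfrak r)-\mathbf n(\mathfrak p),\mathbf n(\mathfrak q)-\mathbf n(\mathfrak s),N)}{\det(\mathbf x(\mathfrak r)-\mathbf x(\mathfrak p),\mathbf x(\mathfrak q)-\mathbf x(\mathfrak s),N)}.$$ An rc-net (in the $k$ direction) with angle $\theta\in(-\pi,0)\cup(0,\pi)$ is a c-net that up to a rigid motion has the form $$\mathbf x=(f(j)\cos\theta k,f(j)\sin\theta k,h(j)),\qquad \mathbf n=(a(j)\cos\theta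 k,a(j)\sin\theta k,b(j)),$$ where $f\ne0$, $\mathrm{sign} f(j+1)=\mathrm{sign} f(j)$, $(\delta f,\delta h)\neq0$, $a^2+b^2=1$, $(\sigma a,\sigma b)\ne0$, $(\delta f,\delta h)\perp(\sigma a,\sigma b)$, $(\delta f,\delta h)\parallel(\delta a,\delta b)$. An rc-net in the $j$ direction is the same with the roles of $j$ and $k$ exchanged. If $K\equiv1$, its parameter $\kappa>0$ is given by $f^2-a^2=f^2+b^2-1=\kappa^2-1$; if $K\equiv-1$, by $f^2+a^2=f^2-b^2+1=\kappa^{-2}$. **Theorem.** **(1)** Let $\eta$ be a CMC-type connection such that on every face $u_{\mathfrak{qp}}\ne-u_{\mathfrak{rs}}$, $v_{\mathfrak{sp}}=v_{\mathfrak{rq}}$, $v_{\mathfrak{sp}}^2=u_{\mathfrak{qp}}u_{\mathfrak{rs}}$, $\mathfrak h_{\mathfrak{sp}}=\mathfrak h_{\mathfrak{rq}}\in\mathbb R$, and $$\mathfrak h_{\mathfrak{sp}}=\frac{v_{\mathfrak{sp}}(\overline{\mathfrak v_{\mathfrak{qp}}}-\mathfrak v_{\mathfrak{rs}})}{i(u_{\mathfrak{qp}}-u_{\mathfrak{rs}})}\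 \text{ if } u_{\mathfrak{qp}}\ne u_{\mathfrak{rs}};\qquad \mathfrak h_{\mathfrak{sp}}=\frac{2i(u_{\mathfrak{qp}}v_{\mathfrak{sp}}-u_{\mathfrak{qp}}^{-1}v_{\mathfrak{sp}}^{-1})}{\mathfrak v_{\mathfrak{qp}}-\mathfrak v_{\mathfrak{rs}}},\ \overline{\mathfrak v_{\mathfrak{qp}}}=\mathfrak v_{\mathfrak{rs}}\neq\mathfrak v_{\mathfrak{qp}}\ \text{ if } u_{\mathfrak{qp}}=u_{\mathfrak{rs}},$$ and such that $\alpha|_{t=0}$ and $\Re\mathfrak v$ are constant on the positively oriented edges $E_1$. Then the compatibility equations $$u_{\mathfrak{qp}}u_{\mathfrak{rs}}=v_{\mathfrak{sp}}v_{\mathfrak{rq}},\quad \mathfrak h_{\mathfrak{rq}}\mathfrak v_{\mathfrak{qp}}-\mathfrak v_{\mathfrak{rs}}\mathfrak h_{\mathfrak{sp}}=i\big(u_{\mathfrak{rs}}v_{\mathfrak{sp}}-(u_{\mathfrak{rs}}v_{\mathfrak{sp}})^{-1}+v_{\mathfrak{rq}}u_{\mathfrak{qp}}-(v_{\mathfrak{rq}}u_{\mathfrak{qp}})^{-1}\big),$$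 $$iv_{\mathfrak{rq}}\overline{\mathfrak v_{\mathfrak{qp}}}-u_{\mathfrak{rs}}\overline{\mathfrak h_{\mathfrak{sp}}}+\mathfrak h_{\mathfrak{rq}}u_{\mathfrak{qp}}-i\mathfrak v_{\mathfrak{rs}}v_{\mathfrak{sp}}=0,\quad iv_{\mathfrak{sp}}\overline{\mathfrak v_{\mathfrak{qp}}}+u_{\mathfrak{qp}}\overline{\mathfrak h_{\mathfrak{sp}}}-\mathfrak h_{\mathfrak{rq}}u_{\mathfrak{rs}}-i\mathfrak v_{\mathfrak{rs}}v_{\mathfrak{rq}}=0$$ hold on all faces, $\eta$ is flat for all $t$, and $\eta_{e_2}$ is $j$-invariant. If moreover $\eta_{e_1}$ is $j$-invariant and, for some $\theta\in(-\pi,0)\cup(0,\pi)$ and $0<\kappa<1$, $$\alpha|_{t=0}=\frac{2}{\sqrt{1-\kappa^2}\sin\frac\theta2},\quad \Re\mathfrak v=\frac{2\cot\frac\theta2}{\sqrt{1-\kappa^2}},\quad (u_{\mathfrak{qp}}-u_{\mathfrak{qp}}^{-1})(u_{\mathfrak{rs}}-u_{\mathfrak{rs}}^{-1})>0,$$ then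 parallel frame families differentiable in $t$ exist, and each of them gives through the Sym formula at $t=0$ with $\xi=-2$, $\tau=0$ an rc-net in the $j$ direction with $K\equiv1$, angle $\theta$ and parameter $\kappa$. Conversely, every rc-net in the $j$ direction with $K\equiv1$, angle $\theta$, parameter $0<\kappa<1$ and $\mathrm{sign}\,a(k+1)=\mathrm{sign}\,a(k)$ for all $k$ arises in this way, with the same $\theta$ and $\kappa$, up to a rigid motion. **(2)** Let $\eta$ be a CMC-type connection such that on every face $v_{\mathfrak{sp}}\ne-v_{\mathfrak{rq}}$, $u_{\mathfrak{qp}}=u_{\mathfrak{rs}}$, $u_{\mathfrak{qp}}^2=v_{\mathfrak{sp}}v_{\mathfrak{rq}}$, $\mathfrak v_{\mathfrak{qp}}=\mathfrak v_{\mathfrak{rs}}\in\mathbb R$, and $$\mathfrak v_{\mathfrak{qp}}=\frac{iu_{\mathfrak{qp}}(\overline{\mathfrak h_{\mathfrak{sp}}}-\mathfrak h_{\mathfrak{rq}})}{v_{\mathfrak{sp}}-v_{\mathfrak{rq}}}\ \text{ if } v_{\mathfrak{sp}}\ne v_{\mathfrak{rq}};\qquad \mathfrak v_{\mathfrak{qp}}=\frac{2i(u_{\mathfrak{qp}}v_{\mathfrak{sp}}-u_{\mathfrak{qp}}^{-1}v_{\mathfrak{sp}}^{-1})}{\mathfrak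 h_{\mathfrak{rq}}-\mathfrak h_{\mathfrak{sp}}},\ \overline{\mathfrak h_{\mathfrak{rq}}}=\mathfrak h_{\mathfrak{sp}}\ne\mathfrak h_{\mathfrak{rq}}\ \text{ if } v_{\mathfrak{sp}}=v_{\mathfrak{rq}},$$ and such that $\beta|_{t=0}$ and $\Re\mathfrak h$ are constant on $E_2$. Then the compatibility equations of (1) hold, $\eta$ is flat for all $t$, and $\eta_{e_1}$ is $k$-invariant. If moreover $\eta_{e_2}$ is $k$-invariant and, for some $\theta\in(-\pi,0)\cup(0,\pi)$ and $\kappa>1$, $$\beta|_{t=0}=\frac{2}{\sqrt{\kappa^2-1}\sin\frac\theta2},\quad \Re\mathfrak h=\frac{2\cot\frac\theta2}{\sqrt{\kappa^2-1}},\quad u\ne\pm1,\quad v_{\mathfrak{sp}}v_{\mathfrak{rq}}\neq0,$$ then parallel frame families differentiable in $t$ exist, and each of them gives at $t=0$ with $\xi=-2$, $\tau=0$ an rc-net in the $k$ direction with $K\equiv1$, angle $\theta$ and parameter $\kappa$. Conversely, every rc-net in the $k$ direction with $K\equiv1$, angle $\theta$ and parameter $\kappa>1$ arises in this way, with the same $\theta$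 and $\kappa$, up to a rigid motion. **(3)** Let $\eta$ be a cK-type connection such that on every face $v_{\mathfrak{sp}}\ne v_{\mathfrak{rq}}$, $u_{\mathfrak{qp}}=u_{\mathfrak{rs}}$, $u_{\mathfrak{qp}}^2=v_{\mathfrak{sp}}v_{\mathfrak{rq}}$, $\mathfrak v_{\mathfrak{qp}}=\mathfrak v_{\mathfrak{rs}}\in i\mathbb R$, and $$\mathfrak v_{\mathfrak{qp}}=\frac{u_{\mathfrak{qp}}(-\overline{\mathfrak h_{\mathfrak{sp}}}+\mathfrak h_{\mathfrak{rq}})}{v_{\mathfrak{sp}}+v_{\mathfrak{rq}}}\ \text{ if } v_{\mathfrak{sp}}\ne-v_{\mathfrak{rq}};\qquad \mathfrak v_{\mathfrak{qp}}=\frac{2(u_{\mathfrak{qp}}v_{\mathfrak{sp}}+u_{\mathfrak{qp}}^{-1}v_{\mathfrak{sp}}^{-1})}{\mathfrak h_{\mathfrak{rq}}-\mathfrak h_{\mathfrak{sp}}},\ \overline{\mathfrak h_{\mathfrak{rq}}}=\mathfrak h_{\mathfrak{sp}}\neq\mathfrak h_{\mathfrak{rq}}\ \text{ if } v_{\mathfrak{sp}}=-v_{\mathfrak{rq}},$$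 and such that $\beta|_{t=0}$ and $\Re\mathfrak h$ are constant on $E_2$. Then $$u_{\mathfrak{qp}}u_{\mathfrak{rs}}=v_{\mathfrak{sp}}v_{\mathfrak{rq}},\quad \mathfrak h_{\mathfrak{rq}}\mathfrak v_{\mathfrak{qp}}-\mathfrak v_{\mathfrak{rs}}\mathfrak h_{\mathfrak{sp}}=u_{\mathfrak{rs}}v_{\mathfrak{sp}}+(u_{\mathfrak{rs}}v_{\mathfrak{sp}})^{-1}-v_{\mathfrak{rq}}u_{\mathfrak{qp}}-(v_{\mathfrak{rq}}u_{\mathfrak{qp}})^{-1},$$ $$v_{\mathfrak{rq}}\overline{\mathfrak v_{\mathfrak{qp}}}-u_{\mathfrak{rs}}\overline{\mathfrak h_{\mathfrak{sp}}}+\mathfrak h_{\mathfrak{rq}}u_{\mathfrak{qp}}-\mathfrak v_{\mathfrak{rs}}v_{\mathfrak{sp}}=0,\quad v_{\mathfrak{sp}}\overline{\mathfrak v_{\mathfrak{qp}}}-u_{\mathfrak{qp}}\overline{\mathfrak h_{\mathfrak{sp}}}+\mathfrak h_{\mathfrak{rq}}u_{\mathfrak{rs}}-\mathfrak v_{\mathfrak{rs}}v_{\mathfrak{rq}}=0$$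 hold on all faces, $\eta$ is flat for all $t$, and $\eta_{e_1}$ is $k$-invariant. If moreover $\eta_{e_2}$ is $k$-invariant and, for some $\theta\in(-\pi,0)\cup(0,\pi)$ and $\kappa>0$, $$\beta|_{t=0}=\frac{2\kappa}{\sin\frac\theta2},\quad \Re\mathfrak h=2\kappa\cot\tfrac\theta2,\quad \Re u\neq0,\quad (\Re v_{\mathfrak{sp}})(\Re v_{\mathfrak{rq}})<0,$$ then parallel frame families differentiable in $t$ exist, and each of them gives at $t=0$ with $\xi=2$, $\tau=0$ an rc-net in the $k$ direction with $K\equiv-1$, angle $\theta$ and parameter $\kappa$. Conversely, every rc-net in the $k$ direction with $K\equiv-1$ and angle $\theta$ has a parameter $\kappa>0$ and arises in this way, with the same $\theta$ and $\kappa$, up to a rigid motion. -/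

import Mathlib

open scoped ComplexConjugate

/-! ### Quaternions as complex matrices, and three-space as the imaginary quaternions -/

abbrev Mat2 := Matrix (Fin 2) (Fin 2) ℂ

abbrev E3 := EuclideanSpace ℝ (Fin 3)

def pauli1 : Mat2 := !![0, 1; 1, 0]

def pauli2 : Mat2 := !![0, -Complex.I; Complex.I, 0]

def pauli3 : Mat2 := !![1, 0; 0, -1]

/-- The identification of `ℝ³` with the imaginary quaternions: `y` is sent to
`y₁ (-i σ₁) + y₂ (-i σ₂) + y₃ (-i σ₃)`. -/
def imH (y : E3) : Mat2 :=
  (y 0 : ℂ) • (-Complex.I • pauli1) + (y 1 : ℂ) • (-Complex.I • pauli2)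
    + (y 2 : ℂ) • (-Complex.I • pauli3)

/-- The inverse identification: the three imaginary coordinates of a quaternion. -/
def imCoord (A : Mat2) : E3 := !₂[-(A 0 1).im, -(A 0 1).re, -(A 0 0).im]

theorem imCoord_imH (y : E3) : imCoord (imH y) = y := by
  ext i
  fin_cases i <;> simp [imCoord, imH, pauli1, pauli2, pauli3]

/-- `A` lies in the real span of `σ₀, -i σ₁, -i σ₂, -i σ₃`. -/
def IsQuat (A : Mat2) : Prop := ∃ (r : ℝ) (y : E3), A = (r : ℂ) • (1 : Mat2) + imH y

/-- The projection `A ↦ A - (tr A / 2) σ₀`. -/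
noncomputable def traceFree (A : Mat2) : Mat2 := A - (A.trace / 2) • (1 : Mat2)

/-! ### The quad-graph `S × T ⊆ ℤ²`

Objects on the graph are functions on all of `ℤ²`; only their values on `S × T` matter.
The edge from `(j,k)` to `(j+1,k)` (first kind), the edge from `(j,k)` to `(j,k+1)` (second kind)
and the face with lowest corner `(j,k)` are all labelled by `(j,k)`. An edge function is recorded
on these positively oriented edges; on reversed edges a connection takes the inverse value. -/

def IsVertex (S T : Set ℤ) (j k : ℤ) : Prop := j ∈ S ∧ k ∈ T

def IsEdge1 (S T : Set ℤ) (j k : ℤ) : Prop := j ∈ S ∧ j + 1 ∈ S ∧ k ∈ T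

def IsEdge2 (S T : Set ℤ) (j k : ℤ) : Prop := j ∈ S ∧ k ∈ T ∧ k + 1 ∈ T

def IsFace (S T : Set ℤ) (j k : ℤ) : Prop := j ∈ S ∧ j + 1 ∈ S ∧ k ∈ T ∧ k + 1 ∈ T

/-- Flatness of the connection with values `L` on the edges of the first kind and `M` on those of
the second kind. -/
def IsFlat (S T : Set ℤ) (L M : ℤ → ℤ → Mat2) : Prop :=
  ∀ j k, IsFace S T j k → M (j + 1) k * L j k = L j (k + 1) * M j k

/-- A family, differentiable in the spectral parameter `t`, of parallel frames
for the family of connections `(L t, M t)`. -/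
structure IsParallelFrameFamily (S T : Set ℤ) (L M : ℝ → ℤ → ℤ → Mat2)
    (Φ : ℝ → ℤ → ℤ → Mat2) : Prop where
  isQuat : ∀ t j k, IsVertex S T j k → IsQuat (Φ t j k)
  ne_zero : ∀ t j k, IsVertex S T j k → Φ t j k ≠ 0
  differentiable : ∀ j k, IsVertex S T j k → ∀ m n, Differentiable ℝ fun t => Φ t j k m n
  parallel1 : ∀ t j k, IsEdge1 S T j k → Φ t (j + 1) k = L t j k * Φ t j k
  parallel2 : ∀ t j k, IsEdge2 S T j k → Φ t j (k + 1) = M t j k * Φ t j k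

def JInvariant1 (S T : Set ℤ) (L : ℝ → ℤ → ℤ → Mat2) : Prop :=
  ∀ t j k, IsEdge1 S T j k → IsEdge1 S T (j + 1) k → L t j k = L t (j + 1) k

def JInvariant2 (S T : Set ℤ) (M : ℝ → ℤ → ℤ → Mat2) : Prop :=
  ∀ t j k, IsEdge2 S T j k → IsEdge2 S T (j + 1) k → M t j k = M t (j + 1) k

def KInvariant1 (S T : Set ℤ) (L : ℝ → ℤ → ℤ → Mat2) : Prop :=
  ∀ t j k, IsEdge1 S T j k → IsEdge1 S T j (k + 1) → L t j k = L t j (k + 1)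

def KInvariant2 (S T : Set ℤ) (M : ℝ → ℤ → ℤ → Mat2) : Prop :=
  ∀ t j k, IsEdge2 S T j k → IsEdge2 S T j (k + 1) → M t j k = M t j (k + 1)

/-! ### The Sym formula -/

/-- The normal `Φ⁻¹ (-i σ₃) Φ`. -/
noncomputable def symNormal (Φ : ℝ → ℤ → ℤ → Mat2) (t : ℝ) (j k : ℤ) : E3 :=
  imCoord ((Φ t j k)⁻¹ * (-Complex.I • pauli3) * Φ t j k)

/-- The entrywise derivative of `Φ` in `t`. -/
noncomputable def derivT (Φ : ℝ → ℤ → ℤ → Mat2) (t : ℝ) (j k : ℤ) : Mat2 :=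
  Matrix.of fun m n => deriv (fun s => Φ s j k m n) t

/-- The position `ξ [Φ⁻¹ ∂ₜΦ]^{tr = 0} + τ n`. -/
noncomputable def symPoint (ξ τ : ℝ) (Φ : ℝ → ℤ → ℤ → Mat2) (t : ℝ) (j k : ℤ) : E3 :=
  ξ • imCoord (traceFree ((Φ t j k)⁻¹ * derivT Φ t j k)) + τ • symNormal Φ t j k

/-! ### Contact element nets -/

noncomputable def det3 (a b c : E3) : ℝ :=
  Matrix.det (Matrix.of fun m n : Fin 3 => (![a, b, c] m) n)

/-- The two diagonals of the face labelled `(j,k)`. -/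
def diag1 (x : ℤ → ℤ → E3) (j k : ℤ) : E3 := x (j + 1) (k + 1) - x j k

def diag2 (x : ℤ → ℤ → E3) (j k : ℤ) : E3 := x (j + 1) k - x j (k + 1)

/-- `N` is a unit vector orthogonal to both diagonals of the face of `n`. -/
def IsFaceNormal (n : ℤ → ℤ → E3) (j k : ℤ) (N : E3) : Prop :=
  ‖N‖ = 1 ∧ inner ℝ (diag1 n j k) N = 0 ∧ inner ℝ (diag2 n j k) N = 0

/-- Edge-constraint nets. -/
structure IsECNet (S T : Set ℤ) (x n : ℤ → ℤ → E3) : Prop where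
  unit : ∀ j k, IsVertex S T j k → ‖n j k‖ = 1
  edge1 : ∀ j k, IsEdge1 S T j k → inner ℝ (x (j + 1) k - x j k) (n (j + 1) k + n j k) = 0
  edge2 : ∀ j k, IsEdge2 S T j k → inner ℝ (x j (k + 1) - x j k) (n j (k + 1) + n j k) = 0
  nondeg1 : ∀ j k, IsEdge1 S T j k → x (j + 1) k - x j k ≠ 0 ∧ n (j + 1) k + n j k ≠ 0
  nondeg2 : ∀ j k, IsEdge2 S T j k → x j (k + 1) - x j k ≠ 0 ∧ n j (k + 1) + n j k ≠ 0
  face : ∀ j k, IsFace S T j k →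
    ∃ N, IsFaceNormal n j k N ∧ det3 (diag1 x j k) (diag2 x j k) N ≠ 0

/-- Circular nets. -/
structure IsCNet (S T : Set ℤ) (x n : ℤ → ℤ → E3) : Prop where
  ecNet : IsECNet S T x n
  circle : ∀ j k, IsFace S T j k → EuclideanGeometry.Concyclic
    ({x j k, x (j + 1) k, x (j + 1) (k + 1), x j (k + 1)} : Set E3)
  parallel1 : ∀ j k, IsEdge1 S T j k → ∃ c : ℝ, n (j + 1) k - n j k = c • (x (j + 1) k - x j k)
  parallel2 : ∀ j k, IsEdge2 S T j k → ∃ c : ℝ, n j (k + 1) - n j k = c • (x j (k + 1) - x j k)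

/-- The Gaussian curvature is defined on every face and equals `c` there. -/
def HasConstGaussCurvature (S T : Set ℤ) (x n : ℤ → ℤ → E3) (c : ℝ) : Prop :=
  ∀ j k, IsFace S T j k → ∃ N, IsFaceNormal n j k N ∧
    det3 (diag1 x j k) (diag2 x j k) N ≠ 0 ∧
    det3 (diag1 n j k) (diag2 n j k) N / det3 (diag1 x j k) (diag2 x j k) N = c

/-- `(x', n')` is the image of `(x, n)` under a rigid motion
`x' = R⁻¹ x R + v`, `n' = R⁻¹ n R`. -/
def RigidlyEquivalent (S T : Set ℤ) (x n x' n' : ℤ → ℤ → E3) : Prop :=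
  ∃ (R : Mat2) (v : E3), IsQuat R ∧ R ≠ 0 ∧ ∀ j k, IsVertex S T j k →
    imH (x' j k) = R⁻¹ * imH (x j k) * R + imH v ∧
    imH (n' j k) = R⁻¹ * imH (n j k) * R

/-- The net with profile `(f, h)` rotated by the angle `θ` per step in the `k` direction. -/
noncomputable def revolve (θ : ℝ) (f h : ℤ → ℝ) (j k : ℤ) : E3 :=
  !₂[f j * Real.cos (θ * k), f j * Real.sin (θ * k), h j]

def IsAngle (θ : ℝ) : Prop := θ ∈ Set.Ioo (-Real.pi) 0 ∪ Set.Ioo 0 Real.pi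

/-- Circular nets of revolution in the `k` direction with angle `θ`, profile `(f, h)` and
profile normal `(a, b)`, up to a rigid motion. -/
structure IsRCNet (S T : Set ℤ) (x n : ℤ → ℤ → E3) (θ : ℝ) (f h a b : ℤ → ℝ) : Prop where
  cNet : IsCNet S T x n
  angle : IsAngle θ
  param : RigidlyEquivalent S T (revolve θ f h) (revolve θ a b) x n
  f_ne_zero : ∀ j ∈ S, f j ≠ 0
  f_sign : ∀ j ∈ S, j + 1 ∈ S → SignType.sign (f (j + 1)) = SignType.sign (f j)
  nondeg : ∀ j ∈ S, j + 1 ∈ S → f (j + 1) - f j ≠ 0 ∨ h (j + 1) - h j ≠ 0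
  unit : ∀ j ∈ S, a j ^ 2 + b j ^ 2 = 1
  nondeg' : ∀ j ∈ S, j + 1 ∈ S → a (j + 1) + a j ≠ 0 ∨ b (j + 1) + b j ≠ 0
  perp : ∀ j ∈ S, j + 1 ∈ S →
    (f (j + 1) - f j) * (a (j + 1) + a j) + (h (j + 1) - h j) * (b (j + 1) + b j) = 0
  parallel : ∀ j ∈ S, j + 1 ∈ S →
    (f (j + 1) - f j) * (b (j + 1) - b j) - (h (j + 1) - h j) * (a (j + 1) - a j) = 0

/-! ### The connection used for positive Gaussian curvature -/

/-- Data of a connection of CMC type: real nonzero `u, v`, complex `𝔳, 𝔥`, and nowhere vanishing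
real functions `α, β` of the spectral parameter that coincide on opposite edges. -/
structure CMCConnection (S T : Set ℤ) where
  u : ℤ → ℤ → ℝ
  v : ℤ → ℤ → ℝ
  𝔳 : ℤ → ℤ → ℂ
  𝔥 : ℤ → ℤ → ℂ
  α : ℤ → ℤ → ℝ → ℝ
  β : ℤ → ℤ → ℝ → ℝ
  u_ne_zero : ∀ j k, IsEdge1 S T j k → u j k ≠ 0
  v_ne_zero : ∀ j k, IsEdge2 S T j k → v j k ≠ 0
  α_ne_zero : ∀ j k, IsEdge1 S T j k → ∀ t, α j k t ≠ 0
  β_ne_zero : ∀ j k, IsEdge2 S T j k → ∀ t, β j k t ≠ 0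
  α_differentiable : ∀ j k, IsEdge1 S T j k → Differentiable ℝ (α j k)
  β_differentiable : ∀ j k, IsEdge2 S T j k → Differentiable ℝ (β j k)
  α_sq : ∀ j k, IsEdge1 S T j k → ∀ t : ℝ, (α j k t : ℂ) ^ 2 =
    (‖𝔳 j k‖ : ℂ) ^ 2 + (u j k : ℂ) ^ 2 + ((u j k : ℂ)⁻¹) ^ 2
      + Complex.exp (2 * Complex.I * t) + Complex.exp (-(2 * Complex.I * t))
  β_sq : ∀ j k, IsEdge2 S T j k → ∀ t : ℝ, (β j k t : ℂ) ^ 2 =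
    (‖𝔥 j k‖ : ℂ) ^ 2 + (v j k : ℂ) ^ 2 + ((v j k : ℂ)⁻¹) ^ 2
      - Complex.exp (2 * Complex.I * t) - Complex.exp (-(2 * Complex.I * t))
  α_opposite : ∀ j k, IsFace S T j k → ∀ t, α j k t = α j (k + 1) t
  β_opposite : ∀ j k, IsFace S T j k → ∀ t, β j k t = β (j + 1) k t

namespace CMCConnection

variable {S T : Set ℤ}

/-- The connection on edges of the first kind. -/
noncomputable def L (C : CMCConnection S T) (t : ℝ) (j k : ℤ) : Mat2 :=
  (1 / (C.α j k t : ℂ)) •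
    !![C.𝔳 j k,
       -Complex.exp (Complex.I * t) * C.u j k - Complex.exp (-(Complex.I * t)) * (C.u j k : ℂ)⁻¹;
       Complex.exp (-(Complex.I * t)) * C.u j k + Complex.exp (Complex.I * t) * (C.u j k : ℂ)⁻¹,
       conj (C.𝔳 j k)]

/-- The connection on edges of the second kind. -/
noncomputable def M (C : CMCConnection S T) (t : ℝ) (j k : ℤ) : Mat2 :=
  (1 / (C.β j k t : ℂ)) •
    !![C.𝔥 j k,
       -Complex.I * Complex.exp (Complex.I * t) * C.v j k
         + Complex.I * Complex.exp (-(Complex.I * t)) * (C.v j k : ℂ)⁻¹;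
       Complex.I * Complex.exp (Complex.I * t) * (C.v j k : ℂ)⁻¹
         - Complex.I * Complex.exp (-(Complex.I * t)) * C.v j k,
       conj (C.𝔥 j k)]

/-- The compatibility equations. On the face labelled `(j,k)` the values of `u` on the two edges of
the first kind are `u j k` and `u j (k + 1)`, the values of `v` on the two edges of the second kind
are `v j k` and `v (j + 1) k`. -/
def Compatible (C : CMCConnection S T) : Prop :=
  ∀ j k, IsFace S T j k →
    C.u j k * C.u j (k + 1) = C.v j k * C.v (j + 1) k ∧
    C.𝔥 (j + 1) k * C.𝔳 j k - C.𝔳 j (k + 1) * C.𝔥 j k =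
      Complex.I * ((C.u j (k + 1) : ℂ) * C.v j k - ((C.u j (k + 1) : ℂ) * C.v j k)⁻¹
        + (C.v (j + 1) k : ℂ) * C.u j k - ((C.v (j + 1) k : ℂ) * C.u j k)⁻¹) ∧
    Complex.I * C.v (j + 1) k * conj (C.𝔳 j k) - C.u j (k + 1) * conj (C.𝔥 j k)
      + C.𝔥 (j + 1) k * C.u j k - Complex.I * C.𝔳 j (k + 1) * C.v j k = 0 ∧
    Complex.I * C.v j k * conj (C.𝔳 j k) + C.u j k * conj (C.𝔥 j k)
      - C.𝔥 (j + 1) k * C.u j (k + 1) - Complex.I * C.𝔳 j (k + 1) * C.v (j + 1) k = 0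

/-- The edge conditions of the first case. -/
def Cond1 (C : CMCConnection S T) : Prop :=
  ∀ j k, IsFace S T j k →
    C.u j k ≠ -C.u j (k + 1) ∧ C.v j k = C.v (j + 1) k ∧
    C.v j k ^ 2 = C.u j k * C.u j (k + 1) ∧
    C.𝔥 j k = C.𝔥 (j + 1) k ∧ (C.𝔥 j k).im = 0 ∧
    (C.u j k ≠ C.u j (k + 1) →
      C.𝔥 j k = C.v j k * (conj (C.𝔳 j k) - C.𝔳 j (k + 1))
        / (Complex.I * ((C.u j k : ℂ) - C.u j (k + 1)))) ∧
    (C.u j k = C.u j (k + 1) →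
      C.𝔥 j k = 2 * Complex.I * ((C.u j k : ℂ) * C.v j k - (C.u j k : ℂ)⁻¹ * (C.v j k : ℂ)⁻¹)
        / (C.𝔳 j k - C.𝔳 j (k + 1)) ∧
      conj (C.𝔳 j k) = C.𝔳 j (k + 1) ∧ C.𝔳 j k ≠ C.𝔳 j (k + 1))

/-- `α|_{t=0}` and `Re 𝔳` are constant. -/
def Const1 (C : CMCConnection S T) : Prop :=
  (∃ c : ℝ, ∀ j k, IsEdge1 S T j k → C.α j k 0 = c) ∧
  (∃ c : ℝ, ∀ j k, IsEdge1 S T j k → (C.𝔳 j k).re = c)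

/-- The normalization of the first case. -/
def Norm1 (C : CMCConnection S T) (θ κ : ℝ) : Prop :=
  (∀ j k, IsEdge1 S T j k →
    C.α j k 0 = 2 / (Real.sqrt (1 - κ ^ 2) * Real.sin (θ / 2)) ∧
    (C.𝔳 j k).re = 2 * Real.cot (θ / 2) / Real.sqrt (1 - κ ^ 2)) ∧
  (∀ j k, IsFace S T j k →
    0 < (C.u j k - (C.u j k)⁻¹) * (C.u j (k + 1) - (C.u j (k + 1))⁻¹))

/-- The edge conditions of the second case. -/
def Cond2 (C : CMCConnection S T) : Prop :=
  ∀ j k, IsFace S T j k →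
    C.v j k ≠ -C.v (j + 1) k ∧ C.u j k = C.u j (k + 1) ∧
    C.u j k ^ 2 = C.v j k * C.v (j + 1) k ∧
    C.𝔳 j k = C.𝔳 j (k + 1) ∧ (C.𝔳 j k).im = 0 ∧
    (C.v j k ≠ C.v (j + 1) k →
      C.𝔳 j k = Complex.I * C.u j k * (conj (C.𝔥 j k) - C.𝔥 (j + 1) k)
        / ((C.v j k : ℂ) - C.v (j + 1) k)) ∧
    (C.v j k = C.v (j + 1) k →
      C.𝔳 j k = 2 * Complex.I * ((C.u j k : ℂ) * C.v j k - (C.u j k : ℂ)⁻¹ * (C.v j k : ℂ)⁻¹)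
        / (C.𝔥 (j + 1) k - C.𝔥 j k) ∧
      conj (C.𝔥 (j + 1) k) = C.𝔥 j k ∧ C.𝔥 (j + 1) k ≠ C.𝔥 j k)

/-- `β|_{t=0}` and `Re 𝔥` are constant. -/
def Const2 (C : CMCConnection S T) : Prop :=
  (∃ c : ℝ, ∀ j k, IsEdge2 S T j k → C.β j k 0 = c) ∧
  (∃ c : ℝ, ∀ j k, IsEdge2 S T j k → (C.𝔥 j k).re = c)

/-- The normalization of the second case. -/
def Norm2 (C : CMCConnection S T) (θ κ : ℝ) : Prop :=
  (∀ j k, IsEdge2 S T j k →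
    C.β j k 0 = 2 / (Real.sqrt (κ ^ 2 - 1) * Real.sin (θ / 2)) ∧
    (C.𝔥 j k).re = 2 * Real.cot (θ / 2) / Real.sqrt (κ ^ 2 - 1)) ∧
  (∀ j k, IsEdge1 S T j k → C.u j k ≠ 1 ∧ C.u j k ≠ -1) ∧
  (∀ j k, IsFace S T j k → C.v j k * C.v (j + 1) k ≠ 0)

end CMCConnection

/-! ### The connection used for negative Gaussian curvature -/

/-- Data of a connection of cK type: `u, v` of modulus one, complex `𝔳, 𝔥`, and nowhere vanishing
real functions `α, β` of the spectral parameter that coincide on opposite edges. -/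
structure CKConnection (S T : Set ℤ) where
  u : ℤ → ℤ → ℂ
  v : ℤ → ℤ → ℂ
  𝔳 : ℤ → ℤ → ℂ
  𝔥 : ℤ → ℤ → ℂ
  α : ℤ → ℤ → ℝ → ℝ
  β : ℤ → ℤ → ℝ → ℝ
  u_unit : ∀ j k, IsEdge1 S T j k → ‖u j k‖ = 1
  v_unit : ∀ j k, IsEdge2 S T j k → ‖v j k‖ = 1
  α_ne_zero : ∀ j k, IsEdge1 S T j k → ∀ t, α j k t ≠ 0
  β_ne_zero : ∀ j k, IsEdge2 S T j k → ∀ t, β j k t ≠ 0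
  α_differentiable : ∀ j k, IsEdge1 S T j k → Differentiable ℝ (α j k)
  β_differentiable : ∀ j k, IsEdge2 S T j k → Differentiable ℝ (β j k)
  α_sq : ∀ j k, IsEdge1 S T j k → ∀ t : ℝ, (α j k t : ℂ) ^ 2 =
    (‖𝔳 j k‖ : ℂ) ^ 2 - u j k ^ 2 - (u j k)⁻¹ ^ 2
      + Complex.exp (2 * t) + Complex.exp (-(2 * t))
  β_sq : ∀ j k, IsEdge2 S T j k → ∀ t : ℝ, (β j k t : ℂ) ^ 2 =
    (‖𝔥 j k‖ : ℂ) ^ 2 - v j k ^ 2 - (v j k)⁻¹ ^ 2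
      + Complex.exp (2 * t) + Complex.exp (-(2 * t))
  α_opposite : ∀ j k, IsFace S T j k → ∀ t, α j k t = α j (k + 1) t
  β_opposite : ∀ j k, IsFace S T j k → ∀ t, β j k t = β (j + 1) k t

namespace CKConnection

variable {S T : Set ℤ}

/-- The connection on edges of the first kind. -/
noncomputable def L (C : CKConnection S T) (t : ℝ) (j k : ℤ) : Mat2 :=
  (1 / (C.α j k t : ℂ)) •
    !![C.𝔳 j k, Complex.exp (-t) * C.u j k - Complex.exp t * (C.u j k)⁻¹;
       Complex.exp t * C.u j k - Complex.exp (-t) * (C.u j k)⁻¹, conj (C.𝔳 j k)]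

/-- The connection on edges of the second kind. -/
noncomputable def M (C : CKConnection S T) (t : ℝ) (j k : ℤ) : Mat2 :=
  (1 / (C.β j k t : ℂ)) •
    !![C.𝔥 j k, Complex.exp (-t) * C.v j k - Complex.exp t * (C.v j k)⁻¹;
       Complex.exp t * C.v j k - Complex.exp (-t) * (C.v j k)⁻¹, conj (C.𝔥 j k)]

/-- The compatibility equations. -/
def Compatible (C : CKConnection S T) : Prop :=
  ∀ j k, IsFace S T j k →
    C.u j k * C.u j (k + 1) = C.v j k * C.v (j + 1) k ∧
    C.𝔥 (j + 1) k * C.𝔳 j k - C.𝔳 j (k + 1) * C.𝔥 j k =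
      C.u j (k + 1) * C.v j k + (C.u j (k + 1) * C.v j k)⁻¹
        - C.v (j + 1) k * C.u j k - (C.v (j + 1) k * C.u j k)⁻¹ ∧
    C.v (j + 1) k * conj (C.𝔳 j k) - C.u j (k + 1) * conj (C.𝔥 j k)
      + C.𝔥 (j + 1) k * C.u j k - C.𝔳 j (k + 1) * C.v j k = 0 ∧
    C.v j k * conj (C.𝔳 j k) - C.u j k * conj (C.𝔥 j k)
      + C.𝔥 (j + 1) k * C.u j (k + 1) - C.𝔳 j (k + 1) * C.v (j + 1) k = 0

/-- The edge conditions of the third case. -/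
def Cond3 (C : CKConnection S T) : Prop :=
  ∀ j k, IsFace S T j k →
    C.v j k ≠ C.v (j + 1) k ∧ C.u j k = C.u j (k + 1) ∧
    C.u j k ^ 2 = C.v j k * C.v (j + 1) k ∧
    C.𝔳 j k = C.𝔳 j (k + 1) ∧ (C.𝔳 j k).re = 0 ∧
    (C.v j k ≠ -C.v (j + 1) k →
      C.𝔳 j k = C.u j k * (-conj (C.𝔥 j k) + C.𝔥 (j + 1) k) / (C.v j k + C.v (j + 1) k)) ∧
    (C.v j k = -C.v (j + 1) k →
      C.𝔳 j k = 2 * (C.u j k * C.v j k + (C.u j k)⁻¹ * (C.v j k)⁻¹)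
        / (C.𝔥 (j + 1) k - C.𝔥 j k) ∧
      conj (C.𝔥 (j + 1) k) = C.𝔥 j k ∧ C.𝔥 (j + 1) k ≠ C.𝔥 j k)

/-- `β|_{t=0}` and `Re 𝔥` are constant. -/
def Const3 (C : CKConnection S T) : Prop :=
  (∃ c : ℝ, ∀ j k, IsEdge2 S T j k → C.β j k 0 = c) ∧
  (∃ c : ℝ, ∀ j k, IsEdge2 S T j k → (C.𝔥 j k).re = c)

/-- The normalization of the third case. -/
def Norm3 (C : CKConnection S T) (θ κ : ℝ) : Prop :=
  (∀ j k, IsEdge2 S T j k →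
    C.β j k 0 = 2 * κ / Real.sin (θ / 2) ∧ (C.𝔥 j k).re = 2 * κ * Real.cot (θ / 2)) ∧
  (∀ j k, IsEdge1 S T j k → (C.u j k).re ≠ 0) ∧
  (∀ j k, IsFace S T j k → (C.v j k).re * (C.v (j + 1) k).re < 0)

end CKConnection

/-- The first integral of nets of revolution with `K ≡ 1`. -/
def PosIntegral (S : Set ℤ) (f a b : ℤ → ℝ) (κ : ℝ) : Prop :=
  ∀ j ∈ S, f j ^ 2 - a j ^ 2 = κ ^ 2 - 1 ∧ f j ^ 2 + b j ^ 2 - 1 = κ ^ 2 - 1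

/-- The first integral of nets of revolution with `K ≡ -1`. -/
def NegIntegral (S : Set ℤ) (f a b : ℤ → ℝ) (κ : ℝ) : Prop :=
  ∀ j ∈ S, f j ^ 2 + a j ^ 2 = 1 / κ ^ 2 ∧ f j ^ 2 - b j ^ 2 + 1 = 1 / κ ^ 2

/-! ### Quaternionic matrices -/

/-! Let δ and σ denote differences and sums of consecutive values along the profile. A face of a net
of revolution is an isosceles trapezoid, and the sum and difference of its diagonals separate the
symmetry plane from the tangential direction. If δ(a,b) = l δ(f,h), its Gaussian curvature is
therefore l σa / σf. Hence K is constant exactly when l σa = K σf on every step of the profile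
(`ProfileStep`; the two directions are `isRCNet_of_profile` and `IsRCNet.profileStep`). Multiplying
by δf gives the first integral a² - K f².

On the side of the connection, the edges that run in the direction of rotation encode the profile.
For κ > 1 and r = 2/√(κ²-1), the dictionary is v + 1/v = r f, v - 1/v = r a, Im 𝔥 = r b. For κ < 1
and r = 2/√(1-κ²), it is u - 1/u = r f, u + 1/u = r a, Im 𝔳 = r b. For K = -1 it is v = (-1)^j κ (f
- i a), Im 𝔥 = 2 κ b. The normalizations at t = 0 and 1/sin² - cot² = 1 turn the formula for α² or
β² into a² + b² = 1. The identity (v + 1/v)² - (v - 1/v)² = 4, respectively |v| = 1, becomes the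
first integral. The edges along the profile encode l: it is (u + 1/u)/(u - 1/u), (v - 1/v)/(v + 1/v)
and -Im u / Re u in the cases κ > 1, κ < 1 and K = -1.

Compatibility on a face reduces to two scalar equations. One is the prescribed formula for the real
(or imaginary) datum. The other then follows from the equality of α² or β² on opposite edges
(`face_equations`, `ck_face_equations`). In the dictionary these equations, together with u² = v v'
or its analogue, are the relations of the profile (`Profile1.face`, `Profile2.face`,
`Profile3.face`), which contain the `ProfileStep`.

That the Sym formula returns this net is shown with explicit frames P_j rotZ(θk/2), where P_j turns
the profile normal into the third axis. At t = 0 the transport in the rotational direction is P_j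
rotZ(θ/2) P_j⁻¹, and the transport along the profile maps P_j to a real multiple of P_{j+1}. The
derivatives of the transports give the chord of the rotation and δn / l respectively, which are the
edges of the net (`rigidlyEquivalent_revolve`). Any parallel frame differs from the explicit one by
real scalars and one constant right factor, which is the rigid motion (`rigidlyEquivalent_sym`).

For the converse the dictionary is solved for the data of the connection (`exists_profile1`,
`exists_profile2`, `exists_profile3`). The signs of f, and of a when κ < 1, make the required square
roots real and the factors α, β nonzero. -/

theorem imH_eq (y : E3) : imH y = !![-Complex.I * y 2, -Complex.I * y 0 - y 1;
    -Complex.I * y 0 + y 1, Complex.I * y 2] := by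
  ext m n
  fin_cases m <;> fin_cases n <;> simp [imH, pauli1, pauli2, pauli3] <;> ring

theorem isQuat_iff (A : Mat2) :
    IsQuat A ↔ A 1 1 = conj (A 0 0) ∧ A 0 1 = -conj (A 1 0) := by
  constructor
  · rintro ⟨r, y, rfl⟩
    simp [imH_eq]
    ring
  · rintro ⟨h1, h2⟩
    refine ⟨(A 0 0).re, !₂[(A 1 0).im * (-1), (A 1 0).re, -(A 0 0).im], ?_⟩
    rw [imH_eq]
    ext m n
    fin_cases m <;> fin_cases n <;> simp [h1, h2, Complex.ext_iff]

/-- The second row is determined by the first through conjugation, so identities such as flatness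
need to be checked on two entries only. -/
theorem IsQuat.ext {A B : Mat2} (hA : IsQuat A) (hB : IsQuat B) (h1 : A 0 0 = B 0 0)
    (h2 : A 0 1 = B 0 1) : A = B := by
  rw [isQuat_iff] at *
  have h3 : A 1 0 = B 1 0 := by
    apply (starRingEnd ℂ).injective
    rw [← neg_inj, ← hA.2, ← hB.2, h2]
  ext m n
  fin_cases m <;> fin_cases n
  · exact h1
  · exact h2
  · exact h3
  · exact hA.1.trans ((congrArg _ h1).trans hB.1.symm)

theorem IsQuat.imH (y : E3) : IsQuat (imH y) := ⟨0, y, by simp⟩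

theorem isQuat_one : IsQuat (1 : Mat2) := by simp [isQuat_iff]

theorem IsQuat.mul {A B : Mat2} (hA : IsQuat A) (hB : IsQuat B) : IsQuat (A * B) := by
  rw [isQuat_iff] at *
  obtain ⟨a1, a2⟩ := hA
  obtain ⟨b1, b2⟩ := hB
  simp only [Matrix.mul_apply, Fin.sum_univ_two, a1, a2, b1, b2]
  constructor
  · simp
    ring
  · simp

theorem IsQuat.add {A B : Mat2} (hA : IsQuat A) (hB : IsQuat B) : IsQuat (A + B) := by
  rw [isQuat_iff] at *
  obtain ⟨a1, a2⟩ := hA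
  obtain ⟨b1, b2⟩ := hB
  simp only [Matrix.add_apply, a1, a2, b1, b2]
  constructor
  · simp
  · simp; ring

theorem IsQuat.smul {A : Mat2} (hA : IsQuat A) (r : ℝ) : IsQuat ((r : ℂ) • A) := by
  rw [isQuat_iff] at *
  obtain ⟨a1, a2⟩ := hA
  simp [a1, a2]

theorem IsQuat.sub {A B : Mat2} (hA : IsQuat A) (hB : IsQuat B) : IsQuat (A - B) := by
  have := hA.add (hB.smul (-1))
  simpa [sub_eq_add_neg] using this

theorem IsQuat.adjugate {A : Mat2} (hA : IsQuat A) : IsQuat A.adjugate := by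
  rw [isQuat_iff] at *
  obtain ⟨a1, a2⟩ := hA
  simp [Matrix.adjugate_fin_two, a1, a2]

theorem IsQuat.det_eq {A : Mat2} (hA : IsQuat A) :
    A.det = ((Complex.normSq (A 0 0) + Complex.normSq (A 1 0) : ℝ) : ℂ) := by
  obtain ⟨a1, a2⟩ := (isQuat_iff A).1 hA
  rw [Matrix.det_fin_two, a1, a2]
  push_cast [← Complex.mul_conj]
  ring

theorem IsQuat.det_ne_zero {A : Mat2} (hA : IsQuat A) (h0 : A ≠ 0) : A.det ≠ 0 := by
  obtain ⟨a1, a2⟩ := (isQuat_iff A).1 hA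
  rw [hA.det_eq]
  intro h
  have h' : Complex.normSq (A 0 0) + Complex.normSq (A 1 0) = 0 := by exact_mod_cast h
  have n1 := Complex.normSq_nonneg (A 0 0)
  have n2 := Complex.normSq_nonneg (A 1 0)
  have e1 : A 0 0 = 0 := Complex.normSq_eq_zero.1 (by linarith)
  have e2 : A 1 0 = 0 := Complex.normSq_eq_zero.1 (by linarith)
  apply h0
  ext m n
  fin_cases m <;> fin_cases n <;> simp [a1, a2, e1, e2]

theorem IsQuat.isUnit_det {A : Mat2} (hA : IsQuat A) (h0 : A ≠ 0) : IsUnit A.det :=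
  isUnit_iff_ne_zero.2 (hA.det_ne_zero h0)

theorem IsQuat.inv {A : Mat2} (hA : IsQuat A) : IsQuat A⁻¹ := by
  rw [Matrix.inv_def, hA.det_eq, Ring.inverse_eq_inv', ← Complex.ofReal_inv]
  exact hA.adjugate.smul _

theorem inv_ne_zero_of_isUnit_det {A : Mat2} (hA : IsUnit A.det) : A⁻¹ ≠ 0 := by
  intro h
  have := Matrix.mul_nonsing_inv A hA
  rw [h, mul_zero] at this
  exact zero_ne_one this

theorem mul_ne_zero_of_isUnit_det {A B : Mat2} (hA : IsUnit A.det) (hB : B ≠ 0) :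
    A * B ≠ 0 := by
  intro h
  apply hB
  rw [← Matrix.nonsing_inv_mul_cancel_left A B hA, h, mul_zero]

theorem imH_imCoord {A : Mat2} (hA : IsQuat A) (ht : A.trace = 0) : imH (imCoord A) = A := by
  obtain ⟨a1, a2⟩ := (isQuat_iff A).1 hA
  have : (A 0 0).re = 0 := by
    have := congrArg Complex.re ht
    simp [Matrix.trace_fin_two, a1] at this
    linarith
  rw [imH_eq]
  ext m n
  fin_cases m <;> fin_cases n <;> simp [imCoord, a1, a2, Complex.ext_iff, this]

theorem imH_add (y z : E3) : imH (y + z) = imH y + imH z := by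
  simp only [imH_eq]
  ext m n
  fin_cases m <;> fin_cases n <;> simp <;> ring

theorem imH_sub (y z : E3) : imH (y - z) = imH y - imH z := by
  simp only [imH_eq]
  ext m n
  fin_cases m <;> fin_cases n <;> simp <;> ring

theorem imH_smul (c : ℝ) (y : E3) : imH (c • y) = (c : ℂ) • imH y := by
  simp only [imH_eq]
  ext m n
  fin_cases m <;> fin_cases n <;> simp <;> ring

theorem imH_injective : Function.Injective imH :=
  Function.LeftInverse.injective imCoord_imH

theorem trace_imH (y : E3) : (imH y).trace = 0 := by
  simp [imH_eq, Matrix.trace_fin_two]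

/-- The product of imaginary quaternions is y z = -⟨y, z⟩ + y × z. Scalar and triple products are
thus traces, and their invariance under conjugation becomes immediate. -/
theorem inner_eq_trace (y z : E3) :
    ((inner ℝ y z : ℝ) : ℂ) = -(1 / 2) * (imH y * imH z).trace := by
  simp only [imH_eq, Matrix.trace_fin_two, Matrix.mul_apply, Fin.sum_univ_two, PiLp.inner_apply,
    Fin.sum_univ_three]
  simp
  linear_combination ((y 0 : ℂ) * z 0 + y 2 * z 2) * Complex.I_sq

theorem det3_eq_trace (x y z : E3) :
    (det3 x y z : ℂ) = -(1 / 2) * (imH x * imH y * imH z).trace := by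
  simp only [imH_eq, Matrix.trace_fin_two, Matrix.mul_apply, Fin.sum_univ_two, det3,
    Matrix.det_fin_three]
  simp
  ring_nf
  simp only [Complex.I_sq]
  ring

/-! ### Rotations -/

/-- The rotation of three-space by a quaternion. -/
noncomputable def rot (R : Mat2) (y : E3) : E3 := imCoord (R⁻¹ * imH y * R)

theorem trace_inv_mul_mul {R : Mat2} (hR : IsUnit R.det) (A : Mat2) :
    (R⁻¹ * A * R).trace = A.trace := by
  rw [Matrix.trace_mul_comm, ← mul_assoc, Matrix.mul_nonsing_inv R hR, one_mul]

theorem inv_mul_mul_mul {R : Mat2} (hR : IsUnit R.det) (A B : Mat2) :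
    R⁻¹ * (A * B) * R = (R⁻¹ * A * R) * (R⁻¹ * B * R) := by
  simp only [mul_assoc]
  rw [Matrix.mul_nonsing_inv_cancel_left R _ hR]

section rot

variable {R : Mat2} (hR : IsQuat R) (h0 : R ≠ 0)
include hR h0

/-- Conjugation preserves quaternions and the trace, so extracting coordinates in `rot` loses
nothing. -/
theorem imH_rot (y : E3) : imH (rot R y) = R⁻¹ * imH y * R := by
  apply imH_imCoord ((hR.inv.mul (IsQuat.imH y)).mul hR)
  rw [trace_inv_mul_mul (hR.isUnit_det h0), trace_imH]

theorem rot_add (y z : E3) : rot R (y + z) = rot R y + rot R z := by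
  apply imH_injective
  simp only [imH_rot hR h0, imH_add, mul_add, add_mul]

theorem rot_sub (y z : E3) : rot R (y - z) = rot R y - rot R z := by
  apply imH_injective
  simp only [imH_rot hR h0, imH_sub, mul_sub, sub_mul]

theorem rot_smul (c : ℝ) (y : E3) : rot R (c • y) = c • rot R y := by
  apply imH_injective
  simp only [imH_rot hR h0, imH_smul, mul_smul_comm, smul_mul_assoc]

theorem inner_rot (y z : E3) : inner ℝ (rot R y) (rot R z) = inner ℝ y z := by
  have : ((inner ℝ (rot R y) (rot R z) : ℝ) : ℂ) = (inner ℝ y z : ℝ) := by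
    rw [inner_eq_trace, inner_eq_trace, imH_rot hR h0, imH_rot hR h0,
      ← inv_mul_mul_mul (hR.isUnit_det h0), trace_inv_mul_mul (hR.isUnit_det h0)]
  exact_mod_cast this

theorem det3_rot (x y z : E3) : det3 (rot R x) (rot R y) (rot R z) = det3 x y z := by
  have : (det3 (rot R x) (rot R y) (rot R z) : ℂ) = (det3 x y z : ℝ) := by
    rw [det3_eq_trace, det3_eq_trace, imH_rot hR h0, imH_rot hR h0, imH_rot hR h0,
      ← inv_mul_mul_mul (hR.isUnit_det h0), ← inv_mul_mul_mul (hR.isUnit_det h0),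
      trace_inv_mul_mul (hR.isUnit_det h0)]
  exact_mod_cast this

theorem norm_rot (y : E3) : ‖rot R y‖ = ‖y‖ := by
  rw [@norm_eq_sqrt_real_inner E3, @norm_eq_sqrt_real_inner E3, inner_rot hR h0]

theorem rot_ne_zero {y : E3} (hy : y ≠ 0) : rot R y ≠ 0 := by
  rw [← norm_ne_zero_iff, norm_rot hR h0]
  exact norm_ne_zero_iff.2 hy

end rot

/-! ### Rigid motions -/

section rigid

variable {S T : Set ℤ} {x n x' n' x'' n'' : ℤ → ℤ → E3}

theorem rigidlyEquivalent_iff : RigidlyEquivalent S T x n x' n' ↔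
    ∃ (R : Mat2) (v : E3), IsQuat R ∧ R ≠ 0 ∧ ∀ j k, IsVertex S T j k →
      x' j k = rot R (x j k) + v ∧ n' j k = rot R (n j k) := by
  constructor
  · rintro ⟨R, v, hR, h0, h⟩
    refine ⟨R, v, hR, h0, fun j k hv => ⟨imH_injective ?_, imH_injective ?_⟩⟩
    · rw [(h j k hv).1, imH_add, imH_rot hR h0]
    · rw [(h j k hv).2, imH_rot hR h0]
  · rintro ⟨R, v, hR, h0, h⟩
    refine ⟨R, v, hR, h0, fun j k hv => ⟨?_, ?_⟩⟩
    · rw [(h j k hv).1, imH_add, imH_rot hR h0]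
    · rw [(h j k hv).2, imH_rot hR h0]

theorem rot_inv_rot {R : Mat2} (hR : IsQuat R) (h0 : R ≠ 0) (y : E3) :
    rot R⁻¹ (rot R y) = y := by
  have hu := hR.isUnit_det h0
  apply imH_injective
  rw [imH_rot hR.inv (inv_ne_zero_of_isUnit_det hu), imH_rot hR h0,
    Matrix.nonsing_inv_nonsing_inv R hu, mul_assoc, mul_assoc, Matrix.mul_nonsing_inv R hu,
    mul_one, Matrix.mul_nonsing_inv_cancel_left R _ hu]

theorem rot_mul {Q R : Mat2} (hQ : IsQuat Q) (hQ0 : Q ≠ 0) (hR : IsQuat R) (h0 : R ≠ 0)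
    (y : E3) : rot R (rot Q y) = rot (Q * R) y := by
  apply imH_injective
  rw [imH_rot (hQ.mul hR) (mul_ne_zero_of_isUnit_det (hQ.isUnit_det hQ0) h0), imH_rot hR h0,
    imH_rot hQ hQ0, Matrix.mul_inv_rev]
  simp only [mul_assoc]

theorem RigidlyEquivalent.symm (h : RigidlyEquivalent S T x n x' n') :
    RigidlyEquivalent S T x' n' x n := by
  rw [rigidlyEquivalent_iff] at *
  obtain ⟨R, v, hR, h0, h⟩ := h
  have hi := inv_ne_zero_of_isUnit_det (hR.isUnit_det h0)
  refine ⟨R⁻¹, -rot R⁻¹ v, hR.inv, hi, fun j k hv => ?_⟩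
  rw [(h j k hv).1, (h j k hv).2, rot_add hR.inv hi, rot_inv_rot hR h0, rot_inv_rot hR h0]
  simp

theorem RigidlyEquivalent.trans (h : RigidlyEquivalent S T x n x' n')
    (h' : RigidlyEquivalent S T x' n' x'' n'') : RigidlyEquivalent S T x n x'' n'' := by
  rw [rigidlyEquivalent_iff] at *
  obtain ⟨R, v, hR, h0, h⟩ := h
  obtain ⟨Q, w, hQ, hQ0, h'⟩ := h'
  refine ⟨R * Q, rot Q v + w, hR.mul hQ, mul_ne_zero_of_isUnit_det (hR.isUnit_det h0) hQ0,
    fun j k hv => ?_⟩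
  rw [(h' j k hv).1, (h' j k hv).2, (h j k hv).1, (h j k hv).2, rot_add hQ hQ0,
    rot_mul hR h0 hQ hQ0, rot_mul hR h0 hQ hQ0, add_assoc]
  simp

theorem RigidlyEquivalent.flip (h : RigidlyEquivalent S T x n x' n') :
    RigidlyEquivalent T S (fun k j => x j k) (fun k j => n j k) (fun k j => x' j k)
      (fun k j => n' j k) := by
  obtain ⟨R, v, hR, h0, h⟩ := h
  exact ⟨R, v, hR, h0, fun k j hv => h j k ⟨hv.2, hv.1⟩⟩

end rigid

/-! ### Invariance of circular nets under rigid motions -/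

section transport

variable {S T : Set ℤ} {x n x' n' : ℤ → ℤ → E3}

theorem concyclic_image_rot {R : Mat2} (hR : IsQuat R) (h0 : R ≠ 0) (v : E3) {s : Set E3}
    (hs : EuclideanGeometry.Concyclic s) :
    EuclideanGeometry.Concyclic ((fun y => rot R y + v) '' s) := by
  obtain ⟨⟨c, r, hc⟩, hcop⟩ := hs
  refine ⟨⟨rot R c + v, r, ?_⟩, ?_⟩
  · rintro _ ⟨y, hy, rfl⟩
    rw [← hc y hy, dist_eq_norm, dist_eq_norm, add_sub_add_right_eq_sub, ← rot_sub hR h0,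
      norm_rot hR h0]
  · let g : E3 →ₗ[ℝ] E3 :=
      { toFun := rot R
        map_add' := rot_add hR h0
        map_smul' := rot_smul hR h0 }
    let A : E3 →ᵃ[ℝ] E3 := g.toAffineMap + AffineMap.const ℝ E3 v
    have hA : (fun y => rot R y + v) '' s = A '' s := rfl
    rw [hA, Coplanar, ← AffineMap.map_vectorSpan]
    exact (rank_map_le _ _).trans hcop

theorem IsCNet.rigid (hc : IsCNet S T x n) (hr : RigidlyEquivalent S T x n x' n') :
    IsCNet S T x' n' := by
  obtain ⟨R, v, hR, h0, h⟩ := rigidlyEquivalent_iff.1 hr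
  have dx : ∀ {j k j' k'}, IsVertex S T j k → IsVertex S T j' k' →
      x' j' k' - x' j k = rot R (x j' k' - x j k) := by
    intro j k j' k' hv hv'
    rw [(h _ _ hv).1, (h _ _ hv').1, add_sub_add_right_eq_sub, rot_sub hR h0]
  have dn : ∀ {j k j' k'}, IsVertex S T j k → IsVertex S T j' k' →
      n' j' k' - n' j k = rot R (n j' k' - n j k) := by
    intro j k j' k' hv hv'
    rw [(h _ _ hv).2, (h _ _ hv').2, rot_sub hR h0]
  have sn : ∀ {j k j' k'}, IsVertex S T j k → IsVertex S T j' k' →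
      n' j' k' + n' j k = rot R (n j' k' + n j k) := by
    intro j k j' k' hv hv'
    rw [(h _ _ hv).2, (h _ _ hv').2, rot_add hR h0]
  have e1 : ∀ {j k}, IsEdge1 S T j k → IsVertex S T j k ∧ IsVertex S T (j + 1) k :=
    fun he => ⟨⟨he.1, he.2.2⟩, ⟨he.2.1, he.2.2⟩⟩
  have e2 : ∀ {j k}, IsEdge2 S T j k → IsVertex S T j k ∧ IsVertex S T j (k + 1) :=
    fun he => ⟨⟨he.1, he.2.1⟩, ⟨he.1, he.2.2⟩⟩
  refine ⟨⟨?_, ?_, ?_, ?_, ?_, ?_⟩, ?_, ?_, ?_⟩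
  · intro j k hv
    rw [(h j k hv).2, norm_rot hR h0, hc.ecNet.unit j k hv]
  · intro j k he
    rw [dx (e1 he).1 (e1 he).2, sn (e1 he).1 (e1 he).2, inner_rot hR h0, hc.ecNet.edge1 j k he]
  · intro j k he
    rw [dx (e2 he).1 (e2 he).2, sn (e2 he).1 (e2 he).2, inner_rot hR h0, hc.ecNet.edge2 j k he]
  · intro j k he
    rw [dx (e1 he).1 (e1 he).2, sn (e1 he).1 (e1 he).2]
    exact ⟨rot_ne_zero hR h0 (hc.ecNet.nondeg1 j k he).1,
      rot_ne_zero hR h0 (hc.ecNet.nondeg1 j k he).2⟩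
  · intro j k he
    rw [dx (e2 he).1 (e2 he).2, sn (e2 he).1 (e2 he).2]
    exact ⟨rot_ne_zero hR h0 (hc.ecNet.nondeg2 j k he).1,
      rot_ne_zero hR h0 (hc.ecNet.nondeg2 j k he).2⟩
  · intro j k hF
    obtain ⟨N, ⟨hN, h1, h2⟩, hd⟩ := hc.ecNet.face j k hF
    obtain ⟨f1, f2, f3, f4⟩ := hF
    refine ⟨rot R N, ⟨by rw [norm_rot hR h0, hN], ?_, ?_⟩, ?_⟩
    · rw [diag1, dn ⟨f1, f3⟩ ⟨f2, f4⟩, inner_rot hR h0]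
      exact h1
    · rw [diag2, dn ⟨f1, f4⟩ ⟨f2, f3⟩, inner_rot hR h0]
      exact h2
    · rw [diag1, diag2, dx ⟨f1, f3⟩ ⟨f2, f4⟩, dx ⟨f1, f4⟩ ⟨f2, f3⟩, det3_rot hR h0]
      exact hd
  · intro j k hF
    have := concyclic_image_rot hR h0 v (hc.circle j k hF)
    obtain ⟨f1, f2, f3, f4⟩ := hF
    rw [(h j k ⟨f1, f3⟩).1, (h (j + 1) k ⟨f2, f3⟩).1, (h (j + 1) (k + 1) ⟨f2, f4⟩).1,
      (h j (k + 1) ⟨f1, f4⟩).1]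
    simpa only [Set.image_insert_eq, Set.image_singleton] using this
  · intro j k he
    obtain ⟨c, h'⟩ := hc.parallel1 j k he
    refine ⟨c, ?_⟩
    rw [dx (e1 he).1 (e1 he).2, dn (e1 he).1 (e1 he).2, h', rot_smul hR h0]
  · intro j k he
    obtain ⟨c, h'⟩ := hc.parallel2 j k he
    refine ⟨c, ?_⟩
    rw [dx (e2 he).1 (e2 he).2, dn (e2 he).1 (e2 he).2, h', rot_smul hR h0]

theorem HasConstGaussCurvature.rigid {c : ℝ} (hc : HasConstGaussCurvature S T x n c)
    (hr : RigidlyEquivalent S T x n x' n') : HasConstGaussCurvature S T x' n' c := by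
  obtain ⟨R, v, hR, h0, h⟩ := rigidlyEquivalent_iff.1 hr
  have dx : ∀ {j k j' k'}, IsVertex S T j k → IsVertex S T j' k' →
      x' j' k' - x' j k = rot R (x j' k' - x j k) := by
    intro j k j' k' hv hv'
    rw [(h _ _ hv).1, (h _ _ hv').1, add_sub_add_right_eq_sub, rot_sub hR h0]
  have dn : ∀ {j k j' k'}, IsVertex S T j k → IsVertex S T j' k' →
      n' j' k' - n' j k = rot R (n j' k' - n j k) := by
    intro j k j' k' hv hv'
    rw [(h _ _ hv).2, (h _ _ hv').2, rot_sub hR h0]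
  intro j k hF
  obtain ⟨N, ⟨hN, h1, h2⟩, hd, hK⟩ := hc j k hF
  obtain ⟨f1, f2, f3, f4⟩ := hF
  have x1 : diag1 x' j k = rot R (diag1 x j k) := dx ⟨f1, f3⟩ ⟨f2, f4⟩
  have x2 : diag2 x' j k = rot R (diag2 x j k) := dx ⟨f1, f4⟩ ⟨f2, f3⟩
  have n1 : diag1 n' j k = rot R (diag1 n j k) := dn ⟨f1, f3⟩ ⟨f2, f4⟩
  have n2 : diag2 n' j k = rot R (diag2 n j k) := dn ⟨f1, f4⟩ ⟨f2, f3⟩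
  refine ⟨rot R N, ⟨by rw [norm_rot hR h0, hN], ?_, ?_⟩, ?_, ?_⟩
  · rw [n1, inner_rot hR h0, h1]
  · rw [n2, inner_rot hR h0, h2]
  · rwa [x1, x2, det3_rot hR h0]
  · rwa [x1, x2, n1, n2, det3_rot hR h0, det3_rot hR h0]

theorem det3_neg_middle (y z w : E3) : det3 y (-z) w = -det3 y z w := by
  simp [det3, Matrix.det_fin_three]
  ring

theorem diag2_flip (y : ℤ → ℤ → E3) (j k : ℤ) :
    diag2 (fun k j => y j k) k j = -diag2 y j k := by
  simp [diag2]

/-- Exchanging the two directions reverses the second diagonal; numerator and denominator of the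
curvature change sign together. -/
theorem HasConstGaussCurvature.flip {c : ℝ} (hc : HasConstGaussCurvature S T x n c) :
    HasConstGaussCurvature T S (fun k j => x j k) (fun k j => n j k) c := by
  rintro k j ⟨f1, f2, f3, f4⟩
  obtain ⟨N, ⟨hN, h1, h2⟩, hd, hK⟩ := hc j k ⟨f3, f4, f1, f2⟩
  refine ⟨N, ⟨hN, h1, ?_⟩, ?_, ?_⟩
  · rw [diag2_flip, inner_neg_left, h2, neg_zero]
  · rw [diag2_flip, det3_neg_middle]
    exact neg_ne_zero.2 hd
  · rw [diag2_flip x j k, diag2_flip n j k, det3_neg_middle, det3_neg_middle, neg_div_neg_eq]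
    exact hK

end transport

/-! ### Nets of revolution -/

/-- The relation between consecutive values of a profile with normals that corresponds to a net
of revolution of Gaussian curvature `K`; `l` is the ratio of the edges of the two curves. -/
structure ProfileStep (K : ℝ) (f h a b : ℤ → ℝ) (j : ℤ) (l : ℝ) : Prop where
  ne_zero : l ≠ 0
  diff_a : a (j + 1) - a j = l * (f (j + 1) - f j)
  diff_b : b (j + 1) - b j = l * (h (j + 1) - h j)
  sum_a : l * (a (j + 1) + a j) = K * (f (j + 1) + f j)
  nondeg : a (j + 1) - a j ≠ 0 ∨ b (j + 1) - b j ≠ 0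

theorem IsAngle.half {θ : ℝ} (hθ : IsAngle θ) :
    Real.sin (θ / 2) ≠ 0 ∧ 0 < Real.cos (θ / 2) := by
  have hpi := Real.pi_pos
  rcases hθ with ⟨h1, h2⟩ | ⟨h1, h2⟩
  · exact ⟨(Real.sin_neg_of_neg_of_neg_pi_lt (by linarith) (by linarith)).ne,
      Real.cos_pos_of_mem_Ioo ⟨by linarith, by linarith⟩⟩
  · exact ⟨(Real.sin_pos_of_pos_of_lt_pi (by linarith) (by linarith)).ne',
      Real.cos_pos_of_mem_Ioo ⟨by linarith, by linarith⟩⟩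

theorem add_ne_zero_of_sign_eq {x y : ℝ} (hx : x ≠ 0)
    (h : SignType.sign y = SignType.sign x) : y + x ≠ 0 := by
  rcases lt_or_gt_of_ne hx with h' | h'
  · rw [sign_neg h', sign_eq_neg_one_iff] at h
    linarith
  · rw [sign_pos h', sign_eq_one_iff] at h
    linarith

theorem mul_pos_of_sign_eq {x y : ℝ} (hx : x ≠ 0)
    (h : SignType.sign y = SignType.sign x) : 0 < y * x := by
  rcases lt_or_gt_of_ne hx with h' | h'
  · rw [sign_neg h', sign_eq_neg_one_iff] at h
    exact mul_pos_of_neg_of_neg h h'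
  · rw [sign_pos h', sign_eq_one_iff] at h
    exact mul_pos h h'

theorem sign_eq_of_mul_pos {x y : ℝ} (h : 0 < y * x) : SignType.sign y = SignType.sign x := by
  rcases mul_pos_iff.1 h with ⟨h1, h2⟩ | ⟨h1, h2⟩
  · rw [sign_pos h1, sign_pos h2]
  · rw [sign_neg h1, sign_neg h2]

section revolve

variable (θ : ℝ) (f h : ℤ → ℝ) (j k : ℤ)

/-- The angle of the symmetry plane between two consecutive positions of the profile. -/
noncomputable def midAngle (θ : ℝ) (k : ℤ) : ℝ := θ * k + θ / 2

/-- The positions k and k + 1 lie at angles -θ/2 and +θ/2 from the symmetry plane of the face.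
Written this way, the diagonals become the sum and difference of a vector in that plane and a
tangential vector. -/
theorem revolve_eq_mid : revolve θ f h j k =
    !₂[f j * (Real.cos (midAngle θ k) * Real.cos (θ / 2)
        + Real.sin (midAngle θ k) * Real.sin (θ / 2)),
      f j * (Real.sin (midAngle θ k) * Real.cos (θ / 2)
        - Real.cos (midAngle θ k) * Real.sin (θ / 2)), h j] := by
  rw [revolve, ← Real.cos_sub, ← Real.sin_sub, midAngle, add_sub_cancel_right]

theorem revolve_succ_eq_mid : revolve θ f h j (k + 1) =
    !₂[f j * (Real.cos (midAngle θ k) * Real.cos (θ / 2)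
        - Real.sin (midAngle θ k) * Real.sin (θ / 2)),
      f j * (Real.sin (midAngle θ k) * Real.cos (θ / 2)
        + Real.cos (midAngle θ k) * Real.sin (θ / 2)), h j] := by
  have : midAngle θ k + θ / 2 = θ * ((k + 1 : ℤ) : ℝ) := by
    rw [midAngle]
    push_cast
    ring
  rw [revolve, ← Real.cos_add, ← Real.sin_add, this]

/-- The diagonals are p + t and p - t with p in the symmetry plane and t tangential of size σf
sin(θ/2), so the determinant is -2 det(p, t, N). The last factor is the planar determinant of p =
(δf cos(θ/2), δh) and the radial and axial parts of N. -/
theorem det3_diag_revolve (N : E3) :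
    det3 (diag1 (revolve θ f h) j k) (diag2 (revolve θ f h) j k) N =
      -2 * (f (j + 1) + f j) * Real.sin (θ / 2) *
        ((f (j + 1) - f j) * Real.cos (θ / 2) * N 2
          - (h (j + 1) - h j) * (N 0 * Real.cos (midAngle θ k) + N 1 * Real.sin (midAngle θ k))) := by
  simp only [diag1, diag2, revolve_succ_eq_mid, det3, Matrix.det_fin_three]
  simp only [revolve_eq_mid]
  simp
  linear_combination (-2 * (f (j + 1) + f j) * Real.sin (θ / 2) *
        ((f (j + 1) - f j) * Real.cos (θ / 2) * N 2)) * (Real.sin_sq_add_cos_sq (midAngle θ k))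

theorem inner_diag1_revolve (N : E3) :
    inner ℝ (diag1 (revolve θ f h) j k) N =
      ((f (j + 1) - f j) * Real.cos (θ / 2)
          * (N 0 * Real.cos (midAngle θ k) + N 1 * Real.sin (midAngle θ k))
        + (h (j + 1) - h j) * N 2)
        + (f (j + 1) + f j) * Real.sin (θ / 2)
          * (N 1 * Real.cos (midAngle θ k) - N 0 * Real.sin (midAngle θ k)) := by
  simp only [diag1, revolve_succ_eq_mid, PiLp.inner_apply, Fin.sum_univ_three]
  simp only [revolve_eq_mid]
  simp
  ring

theorem inner_diag2_revolve (N : E3) :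
    inner ℝ (diag2 (revolve θ f h) j k) N =
      ((f (j + 1) - f j) * Real.cos (θ / 2)
          * (N 0 * Real.cos (midAngle θ k) + N 1 * Real.sin (midAngle θ k))
        + (h (j + 1) - h j) * N 2)
        - (f (j + 1) + f j) * Real.sin (θ / 2)
          * (N 1 * Real.cos (midAngle θ k) - N 0 * Real.sin (midAngle θ k)) := by
  simp only [diag2, revolve_succ_eq_mid, PiLp.inner_apply, Fin.sum_univ_three]
  simp only [revolve_eq_mid]
  simp
  ring

end revolve

section profile

variable {S T : Set ℤ} {x n : ℤ → ℤ → E3} {θ K : ℝ} {f h a b : ℤ → ℝ}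

/-- For one and the same N, the planar factor of `det3_diag_revolve` for n is l times that for x.
The curvature is then l σa / σf, which `sum_a` identifies with K. -/
theorem exists_faceNormal_revolve (hθ : IsAngle θ) {j : ℤ} (k : ℤ)
    (hf : f (j + 1) + f j ≠ 0) {l : ℝ} (hl : ProfileStep K f h a b j l) :
    ∃ N, IsFaceNormal (revolve θ a b) j k N ∧
      det3 (diag1 (revolve θ f h) j k) (diag2 (revolve θ f h) j k) N ≠ 0 ∧
      det3 (diag1 (revolve θ a b) j k) (diag2 (revolve θ a b) j k) N /
        det3 (diag1 (revolve θ f h) j k) (diag2 (revolve θ f h) j k) N = K := by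
  obtain ⟨hs, hc⟩ := hθ.half
  obtain ⟨l0, ha, hb, hsum, hnd⟩ := hl
  set m1 := Real.cos (midAngle θ k)
  set m2 := Real.sin (midAngle θ k)
  set c := Real.cos (θ / 2)
  set s := Real.sin (θ / 2)
  have hm : m1 ^ 2 + m2 ^ 2 = 1 := Real.cos_sq_add_sin_sq _
  set da := a (j + 1) - a j
  set db := b (j + 1) - b j
  set df := f (j + 1) - f j
  set dh := h (j + 1) - h j
  have hpos : 0 < db ^ 2 + (da * c) ^ 2 := by
    rcases hnd with h' | h'
    · have : da * c ≠ 0 := mul_ne_zero h' hc.ne'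
      positivity
    · positivity
  set ρ := Real.sqrt (db ^ 2 + (da * c) ^ 2)
  have hρ : 0 < ρ := Real.sqrt_pos.2 hpos
  have hρ2 : ρ ^ 2 = db ^ 2 + (da * c) ^ 2 := Real.sq_sqrt hpos.le
  -- The planar part (δa cos(θ/2), δb) of the diagonals of n, turned by a right angle inside the
  -- symmetry plane and normalized.
  set N : E3 := !₂[-db * m1 / ρ, -db * m2 / ρ, da * c / ρ] with hN
  have N0 : N 0 = -db * m1 / ρ := by simp [hN]
  have N1 : N 1 = -db * m2 / ρ := by simp [hN]
  have N2 : N 2 = da * c / ρ := by simp [hN]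
  have Nr : N 0 * m1 + N 1 * m2 = -db / ρ := by
    rw [N0, N1]
    linear_combination (-db / ρ) * hm
  have Nt : N 1 * m1 - N 0 * m2 = 0 := by
    rw [N0, N1]
    ring
  have hdet : det3 (diag1 (revolve θ f h) j k) (diag2 (revolve θ f h) j k) N =
      -2 * (f (j + 1) + f j) * s * (ρ / l) := by
    have : df * c * N 2 - dh * (N 0 * m1 + N 1 * m2) = ρ / l := by
      rw [Nr, N2]
      field_simp
      rw [hρ2, ha, hb]
      ring
    rw [det3_diag_revolve, this]
  have hdetn : det3 (diag1 (revolve θ a b) j k) (diag2 (revolve θ a b) j k) N =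
      -2 * (a (j + 1) + a j) * s * ρ := by
    have : da * c * N 2 - db * (N 0 * m1 + N 1 * m2) = ρ := by
      rw [Nr, N2]
      field_simp
      rw [hρ2]
      ring
    rw [det3_diag_revolve, this]
  have hne : det3 (diag1 (revolve θ f h) j k) (diag2 (revolve θ f h) j k) N ≠ 0 := by
    rw [hdet]
    exact mul_ne_zero (mul_ne_zero (mul_ne_zero (by norm_num) hf) hs) (div_ne_zero hρ.ne' l0)
  refine ⟨N, ⟨?_, ?_, ?_⟩, hne, ?_⟩
  · have : ‖N‖ ^ 2 = 1 := by
      rw [EuclideanSpace.real_norm_sq_eq, Fin.sum_univ_three, N0, N1, N2]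
      field_simp
      rw [hρ2]
      linear_combination db ^ 2 * hm
    nlinarith [norm_nonneg N]
  · rw [inner_diag1_revolve, Nr, Nt, N2]
    ring
  · rw [inner_diag2_revolve, Nr, Nt, N2]
    ring
  · rw [div_eq_iff hne, hdetn, hdet]
    field_simp
    linear_combination -hsum

/-- The edge constraint along the profile is the difference of two unit norms divided by l, and
across it the reflection in the symmetry plane gives it for free. The sum of normals along the
profile cannot vanish, since σa = 0 would force K σf = 0. Faces are isosceles trapezoids, hence
cyclic. -/
theorem isCNet_revolve (hθ : IsAngle θ) (hK : K ≠ 0) (hf : ∀ j ∈ S, f j ≠ 0)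
    (hs : ∀ j ∈ S, j + 1 ∈ S → SignType.sign (f (j + 1)) = SignType.sign (f j))
    (hu : ∀ j ∈ S, a j ^ 2 + b j ^ 2 = 1)
    (hp : ∀ j ∈ S, j + 1 ∈ S → ∃ l, ProfileStep K f h a b j l) :
    IsCNet S T (revolve θ f h) (revolve θ a b) := by
  obtain ⟨hs0, hc0⟩ := hθ.half
  have two_vec : ∀ {y μ : ℝ}, y * Real.cos μ = 0 → y * Real.sin μ = 0 → y = 0 := by
    intro y μ h1 h2
    have := Real.cos_sq_add_sin_sq μ
    linear_combination (-y) * this + h1 * Real.cos μ + h2 * Real.sin μ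
  refine ⟨⟨?_, ?_, ?_, ?_, ?_, ?_⟩, ?_, ?_, ?_⟩
  · intro j k hv
    have : ‖revolve θ a b j k‖ ^ 2 = 1 := by
      rw [EuclideanSpace.real_norm_sq_eq, Fin.sum_univ_three]
      simp only [revolve]
      simp
      linear_combination (a j ^ 2) * Real.cos_sq_add_sin_sq (θ * k) + hu j hv.1
    nlinarith [norm_nonneg (revolve θ a b j k)]
  · intro j k he
    obtain ⟨l, l0, ha, hb, -, -⟩ := hp j he.1 he.2.1
    have h1 := hu j he.1
    have h2 := hu (j + 1) he.2.1
    simp only [revolve, PiLp.inner_apply, Fin.sum_univ_three]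
    simp
    apply mul_left_cancel₀ l0
    linear_combination l * (a (j + 1) + a j) * (f (j + 1) - f j)
      * Real.cos_sq_add_sin_sq (θ * k) - (a (j + 1) + a j) * ha - (b (j + 1) + b j) * hb
      + h2 - h1
  · intro j k he
    rw [revolve_succ_eq_mid, revolve_eq_mid, revolve_succ_eq_mid, revolve_eq_mid]
    simp only [PiLp.inner_apply, Fin.sum_univ_three]
    simp
    ring
  · intro j k he
    obtain ⟨l, l0, ha, hb, hsum, hnd⟩ := hp j he.1 he.2.1
    have hσ : f (j + 1) + f j ≠ 0 := add_ne_zero_of_sign_eq (hf j he.1) (hs j he.1 he.2.1)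
    constructor
    · intro h0
      have e0 := congrArg (fun y : E3 => y 0) h0
      have e1 := congrArg (fun y : E3 => y 1) h0
      have e2 := congrArg (fun y : E3 => y 2) h0
      simp only [revolve] at e0 e1 e2
      simp at e0 e1 e2
      have : f (j + 1) - f j = 0 :=
        two_vec (μ := θ * k) (by linarith) (by linarith)
      rw [ha, hb, this, e2] at hnd
      simp at hnd
    · intro h0
      have e0 := congrArg (fun y : E3 => y 0) h0
      have e1 := congrArg (fun y : E3 => y 1) h0
      simp only [revolve] at e0 e1
      simp at e0 e1
      have : a (j + 1) + a j = 0 :=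
        two_vec (μ := θ * k) (by linarith) (by linarith)
      rw [this, mul_zero] at hsum
      exact mul_ne_zero hK hσ hsum.symm
  · intro j k he
    rw [revolve_succ_eq_mid, revolve_eq_mid, revolve_succ_eq_mid, revolve_eq_mid]
    constructor
    · intro h0
      have e0 := congrArg (fun y : E3 => y 0) h0
      have e1 := congrArg (fun y : E3 => y 1) h0
      simp at e0 e1
      have : f j * Real.sin (θ / 2) = 0 :=
        two_vec (μ := midAngle θ k) (by linarith) (by linarith)
      exact mul_ne_zero (hf j he.1) hs0 this
    · intro h0
      have e0 := congrArg (fun y : E3 => y 0) h0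
      have e1 := congrArg (fun y : E3 => y 1) h0
      have e2 := congrArg (fun y : E3 => y 2) h0
      simp at e0 e1 e2
      have h1 : a j * Real.cos (θ / 2) = 0 :=
        two_vec (μ := midAngle θ k) (by linarith) (by linarith)
      have h2 : a j = 0 := by simpa [hc0.ne'] using h1
      have := hu j he.1
      rw [h2, e2] at this
      norm_num at this
  · intro j k hF
    obtain ⟨l, hl⟩ := hp j hF.1 hF.2.1
    obtain ⟨N, hN, hd, -⟩ := exists_faceNormal_revolve hθ k
      (add_ne_zero_of_sign_eq (hf j hF.1) (hs j hF.1 hF.2.1)) hl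
    exact ⟨N, hN, hd⟩
  · intro j k hF
    obtain ⟨l, l0, ha, hb, hsum, hnd⟩ := hp j hF.1 hF.2.1
    have hm := Real.cos_sq_add_sin_sq (midAngle θ k)
    have hω := Real.cos_sq_add_sin_sq (θ / 2)
    constructor
    -- A sphere whose centre lies in the symmetry plane, at radial position d and height z, contains
    -- both ends of each parallel side. It contains all four corners once one equation holds, linear
    -- in (d, z). The centre can be put on the axis if the heights differ; otherwise d is determined
    -- and z is arbitrary.
    · obtain ⟨d, z, hdz⟩ : ∃ d z : ℝ, f j ^ 2 - 2 * d * f j * Real.cos (θ / 2) + (h j - z) ^ 2 =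
          f (j + 1) ^ 2 - 2 * d * f (j + 1) * Real.cos (θ / 2) + (h (j + 1) - z) ^ 2 := by
        by_cases hh : h (j + 1) - h j = 0
        · refine ⟨(f (j + 1) + f j) / (2 * Real.cos (θ / 2)), 0, ?_⟩
          have : h (j + 1) = h j := by linarith
          rw [this]
          field_simp
          ring
        · refine ⟨0, (f (j + 1) ^ 2 - f j ^ 2 + h (j + 1) ^ 2 - h j ^ 2)
            / (2 * (h (j + 1) - h j)), ?_⟩
          field_simp
          ring
      refine ⟨!₂[d * Real.cos (midAngle θ k), d * Real.sin (midAngle θ k), z],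
        Real.sqrt (f j ^ 2 - 2 * d * f j * Real.cos (θ / 2) + (h j - z) ^ 2 + d ^ 2), ?_⟩
      intro p hp'
      rw [EuclideanSpace.dist_eq, Fin.sum_univ_three]
      simp only [Real.dist_eq, sq_abs]
      congr 1
      simp only [Set.mem_insert_iff, Set.mem_singleton_iff] at hp'
      rcases hp' with rfl | rfl | rfl | rfl
      · rw [revolve_eq_mid]
        simp
        linear_combination (f j ^ 2 * (Real.cos (θ / 2) ^ 2 + Real.sin (θ / 2) ^ 2)
          - 2 * d * f j * Real.cos (θ / 2) + d ^ 2) * hm + f j ^ 2 * hω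
      · rw [revolve_eq_mid]
        simp
        linear_combination (f (j + 1) ^ 2 * (Real.cos (θ / 2) ^ 2 + Real.sin (θ / 2) ^ 2)
          - 2 * d * f (j + 1) * Real.cos (θ / 2) + d ^ 2) * hm + f (j + 1) ^ 2 * hω - hdz
      · rw [revolve_succ_eq_mid]
        simp
        linear_combination (f (j + 1) ^ 2 * (Real.cos (θ / 2) ^ 2 + Real.sin (θ / 2) ^ 2)
          - 2 * d * f (j + 1) * Real.cos (θ / 2) + d ^ 2) * hm + f (j + 1) ^ 2 * hω - hdz
      · rw [revolve_succ_eq_mid]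
        simp
        linear_combination (f j ^ 2 * (Real.cos (θ / 2) ^ 2 + Real.sin (θ / 2) ^ 2)
          - 2 * d * f j * Real.cos (θ / 2) + d ^ 2) * hm + f j ^ 2 * hω
    -- The two sides in the direction of rotation are parallel with ratio f (j + 1) / f j, which
    -- gives the fourth corner as an affine combination of the other three.
    · have hmem : revolve θ f h (j + 1) (k + 1) ∈ affineSpan ℝ ({revolve θ f h j k,
          revolve θ f h (j + 1) k, revolve θ f h j (k + 1)} : Set E3) := by
        have m1 := mem_affineSpan ℝ (s := ({revolve θ f h j k, revolve θ f h (j + 1) k,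
          revolve θ f h j (k + 1)} : Set E3)) (p := revolve θ f h j k) (by simp)
        have m2 := mem_affineSpan ℝ (s := ({revolve θ f h j k, revolve θ f h (j + 1) k,
          revolve θ f h j (k + 1)} : Set E3)) (p := revolve θ f h (j + 1) k) (by simp)
        have m3 := mem_affineSpan ℝ (s := ({revolve θ f h j k, revolve θ f h (j + 1) k,
          revolve θ f h j (k + 1)} : Set E3)) (p := revolve θ f h j (k + 1)) (by simp)
        have := AffineSubspace.smul_vsub_vadd_mem _ (f (j + 1) / f j) m3 m1 m2
        convert this using 1
        have hfj := hf j hF.1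
        ext i
        fin_cases i
        · simp [revolve]
          field_simp
          ring
        · simp [revolve]
          field_simp
          ring
        · simp [revolve]
      rw [show ({revolve θ f h j k, revolve θ f h (j + 1) k, revolve θ f h (j + 1) (k + 1),
          revolve θ f h j (k + 1)} : Set E3) = insert (revolve θ f h (j + 1) (k + 1))
          {revolve θ f h j k, revolve θ f h (j + 1) k, revolve θ f h j (k + 1)} by
        ext p
        simp only [Set.mem_insert_iff, Set.mem_singleton_iff]
        tauto, coplanar_insert_iff_of_mem_affineSpan hmem]
      exact coplanar_triple _ _ _ _
  · intro j k he
    obtain ⟨l, l0, ha, hb, -, -⟩ := hp j he.1 he.2.1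
    refine ⟨l, ?_⟩
    ext i
    fin_cases i
    · simp [revolve]
      linear_combination Real.cos (θ * k) * ha
    · simp [revolve]
      linear_combination Real.sin (θ * k) * ha
    · simp [revolve]
      linear_combination hb
  · intro j k he
    have hfj := hf j he.1
    refine ⟨a j / f j, ?_⟩
    ext i
    fin_cases i
    · simp [revolve]
      field_simp
    · simp [revolve]
      field_simp
    · simp [revolve]

/-- A profile with `ProfileStep`s generates a net of revolution of constant curvature. -/
theorem isRCNet_of_profile (hθ : IsAngle θ) (hK : K ≠ 0) (hf : ∀ j ∈ S, f j ≠ 0)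
    (hs : ∀ j ∈ S, j + 1 ∈ S → SignType.sign (f (j + 1)) = SignType.sign (f j))
    (hu : ∀ j ∈ S, a j ^ 2 + b j ^ 2 = 1)
    (hp : ∀ j ∈ S, j + 1 ∈ S → ∃ l, ProfileStep K f h a b j l)
    (hr : RigidlyEquivalent S T (revolve θ f h) (revolve θ a b) x n) :
    IsRCNet S T x n θ f h a b ∧ HasConstGaussCurvature S T x n K := by
  refine ⟨⟨(isCNet_revolve hθ hK hf hs hu hp).rigid hr, hθ, hr, hf, hs, ?_, hu, ?_, ?_, ?_⟩,
    HasConstGaussCurvature.rigid ?_ hr⟩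
  · intro j hj hj'
    obtain ⟨l, l0, ha, hb, hsum, hnd⟩ := hp j hj hj'
    rw [ha, hb] at hnd
    exact hnd.imp right_ne_zero_of_mul right_ne_zero_of_mul
  · intro j hj hj'
    obtain ⟨l, l0, ha, hb, hsum, hnd⟩ := hp j hj hj'
    left
    intro h0
    rw [h0, mul_zero] at hsum
    exact mul_ne_zero hK (add_ne_zero_of_sign_eq (hf j hj) (hs j hj hj')) hsum.symm
  · intro j hj hj'
    obtain ⟨l, l0, ha, hb, hsum, hnd⟩ := hp j hj hj'
    have h1 := hu j hj
    have h2 := hu (j + 1) hj'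
    apply mul_left_cancel₀ l0
    linear_combination h2 - h1 - (a (j + 1) + a j) * ha - (b (j + 1) + b j) * hb
  · intro j hj hj'
    obtain ⟨l, l0, ha, hb, hsum, hnd⟩ := hp j hj hj'
    linear_combination (f (j + 1) - f j) * hb - (h (j + 1) - h j) * ha
  · intro j k hF
    obtain ⟨l, hl⟩ := hp j hF.1 hF.2.1
    exact exists_faceNormal_revolve hθ k
      (add_ne_zero_of_sign_eq (hf j hF.1) (hs j hF.1 hF.2.1)) hl

/-- The profile of a net of revolution of constant curvature consists of `ProfileStep`s. -/
theorem IsRCNet.profileStep (hr : IsRCNet S T x n θ f h a b) (hK : K ≠ 0)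
    (hc : HasConstGaussCurvature S T x n K) (hT : ∃ k, k ∈ T ∧ k + 1 ∈ T) {j : ℤ}
    (hj : j ∈ S) (hj' : j + 1 ∈ S) : ∃ l, ProfileStep K f h a b j l := by
  obtain ⟨k, hk, hk'⟩ := hT
  obtain ⟨hs, hc0⟩ := hr.angle.half
  obtain ⟨N, ⟨hN, h1, h2⟩, hd, hd'⟩ := hc.rigid hr.param.symm j k ⟨hj, hj', hk, hk'⟩
  rw [div_eq_iff hd, det3_diag_revolve, det3_diag_revolve] at hd'
  rw [det3_diag_revolve] at hd
  rw [inner_diag1_revolve] at h1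
  rw [inner_diag2_revolve] at h2
  have hpar := hr.parallel j hj hj'
  have hσf := add_ne_zero_of_sign_eq (hr.f_ne_zero j hj) (hr.f_sign j hj hj')
  obtain ⟨l, ha, hb⟩ : ∃ l, a (j + 1) - a j = l * (f (j + 1) - f j) ∧
      b (j + 1) - b j = l * (h (j + 1) - h j) := by
    rcases hr.nondeg j hj hj' with h0 | h0
    · refine ⟨(a (j + 1) - a j) / (f (j + 1) - f j), by field_simp, ?_⟩
      field_simp
      linear_combination hpar
    · refine ⟨(b (j + 1) - b j) / (h (j + 1) - h j), ?_, by field_simp⟩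
      field_simp
      linear_combination -hpar
  rw [ha, hb] at hd'
  have hD : (f (j + 1) - f j) * Real.cos (θ / 2) * N 2
          - (h (j + 1) - h j) * (N 0 * Real.cos (midAngle θ k) + N 1 * Real.sin (midAngle θ k))
          ≠ 0 := right_ne_zero_of_mul hd
  -- Since δ(a,b) = l δ(f,h), the planar factor of both determinants cancels, whichever face normal
  -- N is given.
  have hsum : l * (a (j + 1) + a j) = K * (f (j + 1) + f j) := by
    apply mul_left_cancel₀ (mul_ne_zero hs hD)
    linear_combination (-1 / 2) * hd'
  have l0 : l ≠ 0 := by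
    rintro rfl
    rw [zero_mul] at hsum
    exact mul_ne_zero hK hσf hsum.symm
  refine ⟨l, l0, ha, hb, hsum, ?_⟩
  rw [ha, hb]
  exact (hr.nondeg j hj hj').imp (mul_ne_zero l0) (mul_ne_zero l0)

end profile

/-! ### Intervals of integers -/

/-- The step is an equivalence because the interval may extend to both sides of the base point. -/
theorem ordConnected_int_induction {S : Set ℤ} (hS : S.OrdConnected) {p : ℤ → Prop} {j₀ : ℤ}
    (h₀ : j₀ ∈ S) (hp : p j₀) (hstep : ∀ j ∈ S, j + 1 ∈ S → (p j ↔ p (j + 1))) :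
    ∀ j ∈ S, p j := by
  have up : ∀ n : ℕ, j₀ + n ∈ S → p (j₀ + n) := by
    intro n
    induction n with
    | zero => intro _; simpa using hp
    | succ n ih =>
      intro hn
      have hn' : j₀ + (n + 1 : ℕ) = j₀ + n + 1 := by push_cast; ring
      have hm : j₀ + n ∈ S := hS.out h₀ hn ⟨by lia, by lia⟩
      rw [hn'] at hn ⊢
      exact (hstep _ hm hn).1 (ih hm)
  have down : ∀ n : ℕ, j₀ - n ∈ S → p (j₀ - n) := by
    intro n
    induction n with
    | zero => intro _; simpa using hp
    | succ n ih =>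
      intro hn
      have hn' : j₀ - n = j₀ - (n + 1 : ℕ) + 1 := by push_cast; ring
      have hm : j₀ - n ∈ S := hS.out hn h₀ ⟨by lia, by lia⟩
      have := ih hm
      rw [hn'] at this hm
      exact (hstep _ hn hm).2 this
  intro j hj
  rcases le_total j₀ j with h | h
  · have e : j = j₀ + (j - j₀).toNat := by lia
    rw [e]
    exact up _ (by rwa [← e])
  · have e : j = j₀ - (j₀ - j).toNat := by lia
    rw [e]
    exact down _ (by rwa [← e])

theorem exists_step {S : Set ℤ} (hS : S.OrdConnected) (hS' : S.Nontrivial) :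
    ∃ j, j ∈ S ∧ j + 1 ∈ S := by
  obtain ⟨a, ha, b, hb, hab⟩ := hS'.exists_lt
  exact ⟨a, ha, hS.out ha hb ⟨by lia, by lia⟩⟩

/-- The last point of an interval starts no edge but ends one. This makes a face available next to
edges on the far boundary. -/
theorem mem_step {S : Set ℤ} (hS : S.OrdConnected) (hS' : S.Nontrivial) {j : ℤ} (hj : j ∈ S) :
    ∃ i, i ∈ S ∧ i + 1 ∈ S ∧ (j = i ∨ j = i + 1) := by
  obtain ⟨b, hb, hne⟩ := hS'.exists_ne j
  rcases lt_or_gt_of_ne hne with h | h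
  · exact ⟨j - 1, hS.out hb hj ⟨by lia, by lia⟩, by simpa using hj, by simp⟩
  · exact ⟨j, hj, hS.out hj hb ⟨by lia, by lia⟩, by simp⟩

theorem vertex_induction {S T : Set ℤ} (hS : S.OrdConnected) (hT : T.OrdConnected)
    {p : ℤ → ℤ → Prop} {j₀ k₀ : ℤ} (h₀ : IsVertex S T j₀ k₀) (hp : p j₀ k₀)
    (h1 : ∀ j k, IsEdge1 S T j k → (p j k ↔ p (j + 1) k))
    (h2 : ∀ j k, IsEdge2 S T j k → (p j k ↔ p j (k + 1))) :
    ∀ j k, IsVertex S T j k → p j k := by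
  intro j k hv
  have : p j₀ k := ordConnected_int_induction hT (p := p j₀) h₀.2 hp
    (fun k hk hk' => h2 j₀ k ⟨h₀.1, hk, hk'⟩) k hv.2
  exact ordConnected_int_induction hS (p := fun j => p j k) h₀.1 this
    (fun j hj hj' => h1 j k ⟨hj, hj', hv.2⟩) j hv.1

/-! ### Families of quaternions -/

/-- A differentiable family of unit quaternions. -/
structure IsUnitFamily (F : ℝ → Mat2) : Prop where
  isQuat : ∀ t, IsQuat (F t)
  det_eq : ∀ t, (F t).det = 1
  differentiable : ∀ m n, Differentiable ℝ fun t => F t m n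

theorem isUnitFamily_one : IsUnitFamily (fun _ => 1) :=
  ⟨fun _ => isQuat_one, fun _ => Matrix.det_one, fun _ _ => differentiable_const _⟩

theorem IsUnitFamily.mul {F G : ℝ → Mat2} (hF : IsUnitFamily F) (hG : IsUnitFamily G) :
    IsUnitFamily (fun t => F t * G t) := by
  refine ⟨fun t => (hF.isQuat t).mul (hG.isQuat t), fun t => ?_, fun m n => ?_⟩
  · rw [Matrix.det_mul, hF.det_eq, hG.det_eq, one_mul]
  · simp only [Matrix.mul_apply, Fin.sum_univ_two]
    exact ((hF.differentiable _ _).mul (hG.differentiable _ _)).add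
      ((hF.differentiable _ _).mul (hG.differentiable _ _))

theorem IsUnitFamily.adjugate {F : ℝ → Mat2} (hF : IsUnitFamily F) :
    IsUnitFamily (fun t => (F t).adjugate) := by
  refine ⟨fun t => (hF.isQuat t).adjugate, fun t => ?_, fun m n => ?_⟩
  · rw [Matrix.det_adjugate, hF.det_eq, one_pow]
  · have := hF.differentiable
    simp only [Matrix.adjugate_fin_two]
    fin_cases m <;> fin_cases n <;> simp <;> exact this _ _

theorem IsUnitFamily.ne_zero {F : ℝ → Mat2} (hF : IsUnitFamily F) (t : ℝ) : F t ≠ 0 := by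
  intro h
  have := hF.det_eq t
  rw [h] at this
  simp at this

theorem IsUnitFamily.adjugate_mul {F : ℝ → Mat2} (hF : IsUnitFamily F) (t : ℝ) (G : Mat2) :
    F t * ((F t).adjugate * G) = G := by
  rw [← mul_assoc, Matrix.mul_adjugate, hF.det_eq, one_smul, one_mul]

theorem IsUnitFamily.adjugate_mul' {F : ℝ → Mat2} (hF : IsUnitFamily F) (t : ℝ) (G : Mat2) :
    (F t).adjugate * (F t * G) = G := by
  rw [← mul_assoc, Matrix.adjugate_mul, hF.det_eq, one_smul, one_mul]

/-- Steps that are bijections can be undone, so the recursion also runs to the left of the base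
point. -/
theorem exists_int_rec {X : Type*} (e : ℤ → X ≃ X) (x₀ : X) (j₀ : ℤ) :
    ∃ P : ℤ → X, P j₀ = x₀ ∧ ∀ j, P (j + 1) = e j (P j) := by
  let U : ℕ → X := fun n => Nat.rec x₀ (fun n x => e (j₀ + n) x) n
  let D : ℕ → X := fun n => Nat.rec x₀ (fun n x => (e (j₀ - n - 1)).symm x) n
  have U0 : U 0 = x₀ := rfl
  refine ⟨fun j => if j₀ ≤ j then U (j - j₀).toNat else D (j₀ - j).toNat, by simp [U0], ?_⟩
  intro j
  dsimp only
  rcases le_or_gt j₀ j with h | h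
  · rw [if_pos h, if_pos (by lia), show (j + 1 - j₀).toNat = (j - j₀).toNat + 1 by lia]
    change e (j₀ + ((j - j₀).toNat : ℤ)) _ = _
    rw [show j₀ + ((j - j₀).toNat : ℤ) = j by lia]
  · rw [if_neg (not_le.2 h), show (j₀ - j).toNat = (j₀ - (j + 1)).toNat + 1 by lia]
    change _ = e j ((e (j₀ - ((j₀ - (j + 1)).toNat : ℤ) - 1)).symm _)
    rw [show j₀ - ((j₀ - (j + 1)).toNat : ℤ) - 1 = j by lia, Equiv.apply_symm_apply]
    split_ifs with h'
    · have : j + 1 = j₀ := by lia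
      rw [this]
      simp [U0]
    · rfl

theorem exists_antidifference (d : ℤ → ℝ) : ∃ h : ℤ → ℝ, ∀ j, h (j + 1) - h j = d j := by
  obtain ⟨h, -, hh⟩ := exists_int_rec (fun j => Equiv.addLeft (d j)) 0 0
  exact ⟨h, fun j => by rw [hh, Equiv.coe_addLeft, add_sub_cancel_right]⟩

/-- With determinant 1 the adjugate is the inverse and stays differentiable, so multiplication by `A
j` is a bijection of the unit families. -/
theorem exists_path {A : ℤ → ℝ → Mat2} (hA : ∀ j, IsUnitFamily (A j)) (j₀ : ℤ) :
    ∃ P : ℤ → ℝ → Mat2, P j₀ = (fun _ => 1) ∧ (∀ j, IsUnitFamily (P j)) ∧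
      ∀ j t, P (j + 1) t = A j t * P j t := by
  let e : ℤ → {F : ℝ → Mat2 // IsUnitFamily F} ≃ {F : ℝ → Mat2 // IsUnitFamily F} := fun j =>
    { toFun := fun F => ⟨fun t => A j t * F.1 t, (hA j).mul F.2⟩
      invFun := fun F => ⟨fun t => (A j t).adjugate * F.1 t, (hA j).adjugate.mul F.2⟩
      left_inv := fun F => Subtype.ext <| funext fun t => (hA j).adjugate_mul' t _
      right_inv := fun F => Subtype.ext <| funext fun t => (hA j).adjugate_mul t _ }
  obtain ⟨P, P0, hP⟩ := exists_int_rec e ⟨fun _ => 1, isUnitFamily_one⟩ j₀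
  exact ⟨fun j => (P j).1, congrArg Subtype.val P0, fun j => (P j).2,
    fun j t => congrFun (congrArg Subtype.val (hP j)) t⟩

/-- Discrete integration: transport along one column, then along every row starting from it.
Flatness propagates parallelism in the second direction from that column to all others. -/
theorem exists_parallelFrameFamily {S T : Set ℤ} (hS : S.OrdConnected) (hS' : S.Nonempty)
    {L M : ℝ → ℤ → ℤ → Mat2}
    (hL : ∀ j k, IsEdge1 S T j k → IsUnitFamily fun t => L t j k)
    (hM : ∀ j k, IsEdge2 S T j k → IsUnitFamily fun t => M t j k)
    (hflat : ∀ t, IsFlat S T (L t) (M t)) : ∃ Φ, IsParallelFrameFamily S T L M Φ := by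
  classical
  obtain ⟨j₀, hj₀⟩ := hS'
  obtain ⟨Q, -, hQ, hQ'⟩ := exists_path
    -- Outside the graph the transport is set to 1, so that the path exists over all integers.
    (A := fun k t => if IsEdge2 S T j₀ k then M t j₀ k else 1) (by
      intro k
      by_cases h : IsEdge2 S T j₀ k
      · simpa only [h, if_true] using hM j₀ k h
      · simpa only [h, if_false] using isUnitFamily_one) 0
  have hP : ∀ k, ∃ P : ℤ → ℝ → Mat2, P j₀ = (fun _ => 1) ∧ (∀ j, IsUnitFamily (P j)) ∧
      ∀ j t, P (j + 1) t = (if IsEdge1 S T j k then L t j k else 1) * P j t := by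
    intro k
    apply exists_path
    intro j
    by_cases h : IsEdge1 S T j k
    · simpa only [h, if_true] using hL j k h
    · simpa only [h, if_false] using isUnitFamily_one
  choose P P0 P1 P2 using hP
  have hΦ : ∀ j k, IsUnitFamily fun t => P k j t * Q k t := fun j k => (P1 k j).mul (hQ k)
  have par1 : ∀ t j k, IsEdge1 S T j k → P k (j + 1) t * Q k t = L t j k * (P k j t * Q k t) := by
    intro t j k he
    rw [P2, if_pos he, mul_assoc]
  refine ⟨fun t j k => P k j t * Q k t, fun t j k _ => (hΦ j k).isQuat t,
    fun t j k _ => (hΦ j k).ne_zero t, fun j k _ => (hΦ j k).differentiable, par1, ?_⟩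
  intro t j k he
  refine ordConnected_int_induction hS
    (p := fun j => P (k + 1) j t * Q (k + 1) t = M t j k * (P k j t * Q k t)) hj₀ ?_ ?_ j he.1
  · have he' : IsEdge2 S T j₀ k := ⟨hj₀, he.2⟩
    simp only [P0, one_mul]
    rw [hQ', if_pos he']
  · intro j hj hj'
    have e1 : IsEdge1 S T j k := ⟨hj, hj', he.2.1⟩
    have e2 : IsEdge1 S T j (k + 1) := ⟨hj, hj', he.2.2⟩
    rw [par1 t j k e1, par1 t j (k + 1) e2, ← mul_assoc (M t (j + 1) k),
      hflat t j k ⟨hj, hj', he.2.1, he.2.2⟩, mul_assoc]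
    constructor
    · intro h
      rw [h]
    · intro h
      have hu := (hL j (k + 1) e2).det_eq t
      have := congrArg (fun B => (L t j (k + 1))⁻¹ * B) h
      rwa [Matrix.nonsing_inv_mul_cancel_left _ _ (by rw [hu]; exact isUnit_one),
        Matrix.nonsing_inv_mul_cancel_left _ _ (by rw [hu]; exact isUnit_one)] at this

/-! ### The Sym formula along edges -/

/-- Entrywise differentiability of a family of matrices. -/
def HasMatDeriv (F : ℝ → Mat2) (F' : Mat2) (t : ℝ) : Prop :=
  ∀ m n, HasDerivAt (fun s => F s m n) (F' m n) t

theorem HasMatDeriv.mul {F G : ℝ → Mat2} {F' G' : Mat2} {t : ℝ} (hF : HasMatDeriv F F' t)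
    (hG : HasMatDeriv G G' t) : HasMatDeriv (fun s => F s * G s) (F' * G t + F t * G') t := by
  intro m n
  simp only [Matrix.mul_apply, Matrix.add_apply, Fin.sum_univ_two]
  exact (((hF m 0).mul (hG 0 n)).add ((hF m 1).mul (hG 1 n))).congr_deriv (by ring)

theorem traceFree_add (A B : Mat2) : traceFree (A + B) = traceFree A + traceFree B := by
  simp only [traceFree, Matrix.trace_add, add_div, add_smul]
  abel

theorem traceFree_conj {R : Mat2} (hR : IsUnit R.det) (A : Mat2) :
    traceFree (R⁻¹ * A * R) = R⁻¹ * traceFree A * R := by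
  rw [traceFree, traceFree, trace_inv_mul_mul hR, mul_sub, sub_mul, mul_smul_comm,
    smul_mul_assoc, mul_one, Matrix.nonsing_inv_mul R hR]

theorem trace_traceFree (A : Mat2) : (traceFree A).trace = 0 := by
  simp [traceFree, Matrix.trace_sub, Matrix.trace_smul]

theorem traceFree_of_trace_eq_zero {A : Mat2} (hA : A.trace = 0) : traceFree A = A := by
  simp [traceFree, hA]

theorem traceFree_smul_one (c : ℂ) : traceFree (c • (1 : Mat2)) = 0 := by
  simp [traceFree, Matrix.trace_smul]

theorem IsQuat.traceFree {A : Mat2} (hA : IsQuat A) : IsQuat (traceFree A) := by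
  obtain ⟨a1, a2⟩ := (isQuat_iff A).1 hA
  have : A.trace / 2 = ((A 0 0).re : ℂ) := by
    rw [Matrix.trace_fin_two, a1, Complex.add_conj]
    push_cast
    ring
  rw [_root_.traceFree, this]
  exact hA.sub (isQuat_one.smul _)

theorem isQuat_derivT {Φ : ℝ → ℤ → ℤ → Mat2} {j k : ℤ} (hq : ∀ t, IsQuat (Φ t j k))
    (hd : ∀ m n, Differentiable ℝ fun t => Φ t j k m n) (t : ℝ) : IsQuat (derivT Φ t j k) := by
  rw [isQuat_iff]
  simp only [derivT, Matrix.of_apply]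
  have h1 : (fun s => Φ s j k 1 1) = fun s => star (Φ s j k 0 0) :=
    funext fun s => ((isQuat_iff _).1 (hq s)).1
  have h2 : (fun s => Φ s j k 0 1) = fun s => -star (Φ s j k 1 0) :=
    funext fun s => ((isQuat_iff _).1 (hq s)).2
  rw [h1, h2]
  exact ⟨((hd 0 0) t).hasDerivAt.star.deriv, ((hd 1 0) t).hasDerivAt.star.neg.deriv⟩

theorem imH_symPoint {Φ : ℝ → ℤ → ℤ → Mat2} {j k : ℤ} (hq : ∀ t, IsQuat (Φ t j k))
    (hd : ∀ m n, Differentiable ℝ fun t => Φ t j k m n) (ξ t : ℝ) :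
    imH (symPoint ξ 0 Φ t j k) =
      (ξ : ℂ) • traceFree ((Φ t j k)⁻¹ * derivT Φ t j k) := by
  rw [symPoint, zero_smul, add_zero, imH_smul,
    imH_imCoord ((hq t).inv.mul (isQuat_derivT hq hd t)).traceFree (trace_traceFree _)]

theorem imH_symNormal {Φ : ℝ → ℤ → ℤ → Mat2} {j k : ℤ} {t : ℝ} (hq : IsQuat (Φ t j k))
    (h0 : Φ t j k ≠ 0) :
    imH (symNormal Φ t j k) = (Φ t j k)⁻¹ * (-Complex.I • pauli3) * Φ t j k := by
  have : IsQuat (-Complex.I • pauli3) := by simp [isQuat_iff, pauli3]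
  rw [symNormal, imH_imCoord ((hq.inv.mul this).mul hq)]
  rw [trace_inv_mul_mul (hq.isUnit_det h0)]
  simp [pauli3, Matrix.trace_fin_two]

/-- By the product rule the logarithmic derivative of A Φ exceeds that of Φ by Φ⁻¹ (A⁻¹ A') Φ. Edge
vectors of the Sym formula thus involve the frame only through conjugation. -/
theorem imH_symPoint_step {Φ : ℝ → ℤ → ℤ → Mat2} {j k j' k' : ℤ} {A : ℝ → Mat2} {A' : Mat2}
    {ξ t : ℝ} (hq : ∀ t, IsQuat (Φ t j k)) (hd : ∀ m n, Differentiable ℝ fun t => Φ t j k m n)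
    (h0 : Φ t j k ≠ 0)
    (hq' : ∀ t, IsQuat (Φ t j' k')) (hd' : ∀ m n, Differentiable ℝ fun t => Φ t j' k' m n)
    (hA : HasMatDeriv A A' t) (hA0 : IsUnit (A t).det)
    (hp : ∀ t, Φ t j' k' = A t * Φ t j k) :
    imH (symPoint ξ 0 Φ t j' k' - symPoint ξ 0 Φ t j k) =
      (Φ t j k)⁻¹ * ((ξ : ℂ) • traceFree ((A t)⁻¹ * A')) * Φ t j k := by
  have hu := (hq t).isUnit_det h0
  have hder : derivT Φ t j' k' = A' * Φ t j k + A t * derivT Φ t j k := by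
    ext m n
    have h1 : HasMatDeriv (fun s => Φ s j k) (derivT Φ t j k) t :=
      fun m n => (hd m n t).hasDerivAt
    have h2 := (hA.mul h1) m n
    simp only [derivT, Matrix.of_apply, hp]
    exact h2.deriv
  rw [imH_sub, imH_symPoint hq hd, imH_symPoint hq' hd', hder, hp t, Matrix.mul_inv_rev, mul_add,
    mul_assoc _ (A t)⁻¹ (A t * _), Matrix.nonsing_inv_mul_cancel_left _ _ hA0, traceFree_add,
    ← mul_assoc, mul_assoc (Φ t j k)⁻¹, traceFree_conj hu, smul_add, add_sub_cancel_right,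
    mul_smul_comm, smul_mul_assoc]

/-- Here A and B are frames that agree up to the scalar c and the right factor R. The scalar cancels
under conjugation, so the vector seen as Z in either frame differs only by the rotation R. -/
theorem conj_eq_of_mul_eq {A B R X Z : Mat2} {c : ℂ} (hA : IsUnit A.det) (hR : IsUnit R.det)
    (hc : c ≠ 0) (h : A * R = c • B) (hX : A * X = Z * A) : R⁻¹ * X * R = B⁻¹ * Z * B := by
  have hB : B = c⁻¹ • (A * R) := by rw [h, smul_smul, inv_mul_cancel₀ hc, one_smul]
  have hu : IsUnit (A * R).det := by rw [Matrix.det_mul]; exact hA.mul hR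
  have hBi : B⁻¹ = c • (R⁻¹ * A⁻¹) := by
    apply Matrix.inv_eq_left_inv
    rw [hB, ← Matrix.mul_inv_rev, smul_mul_smul_comm, mul_inv_cancel₀ hc,
      Matrix.nonsing_inv_mul _ hu, one_smul]
  rw [hBi, hB, smul_mul_assoc, smul_mul_smul_comm, mul_inv_cancel₀ hc, one_smul]
  rw [mul_assoc (R⁻¹ * A⁻¹), ← mul_assoc Z, ← hX, mul_assoc A, mul_assoc R⁻¹ A⁻¹,
    Matrix.nonsing_inv_mul_cancel_left _ _ hA, mul_assoc]

/-- Along an edge with transport `A`, the frame `P` is carried to a multiple of the frame `P'`, and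
`y` is the edge vector which the Sym formula assigns to it. -/
def SymEdge (ξ : ℝ) (A : ℝ → Mat2) (P P' : Mat2) (y : E3) : Prop :=
  (∃ c : ℝ, A 0 * P = (c : ℂ) • P') ∧
  ∃ A', HasMatDeriv A A' 0 ∧ P * imH y = ((ξ : ℂ) • traceFree ((A 0)⁻¹ * A')) * P

/-- Agreement of the model frame times R with Φ, up to a real factor, passes across an edge in both
directions. Where it holds, conjugation turns the model edge vector into that of Φ. The factors are
needed because the model frames are not normalized. -/
theorem SymEdge.step {Φ : ℝ → ℤ → ℤ → Mat2} {j k j' k' : ℤ} {A : ℝ → Mat2} {P P' R : Mat2}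
    {y : E3} {ξ : ℝ} (hq : ∀ t, IsQuat (Φ t j k))
    (hd : ∀ m n, Differentiable ℝ fun t => Φ t j k m n) (h0 : Φ 0 j k ≠ 0)
    (hq' : ∀ t, IsQuat (Φ t j' k')) (hd' : ∀ m n, Differentiable ℝ fun t => Φ t j' k' m n)
    (h0' : Φ 0 j' k' ≠ 0) (hp : ∀ t, Φ t j' k' = A t * Φ t j k) (hP : IsUnit P.det)
    (hR : IsQuat R) (hR0 : R ≠ 0) (hs : SymEdge ξ A P P' y) :
    ((∃ c : ℝ, c ≠ 0 ∧ P * R = (c : ℂ) • Φ 0 j k) ↔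
      (∃ c : ℝ, c ≠ 0 ∧ P' * R = (c : ℂ) • Φ 0 j' k')) ∧
    ((∃ c : ℝ, c ≠ 0 ∧ P * R = (c : ℂ) • Φ 0 j k) →
      symPoint ξ 0 Φ 0 j' k' - symPoint ξ 0 Φ 0 j k = rot R y) := by
  obtain ⟨⟨d, hd0⟩, A', hA', hy⟩ := hs
  have hA : IsUnit (A 0).det := by
    have := (hq' 0).isUnit_det h0'
    rw [hp 0, Matrix.det_mul] at this
    exact isUnit_of_mul_isUnit_left this
  have hdne : d ≠ 0 := by
    rintro rfl
    have : IsUnit (A 0 * P).det := by rw [Matrix.det_mul]; exact hA.mul hP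
    rw [hd0] at this
    simp at this
  have hdc : (d : ℂ) ≠ 0 := by exact_mod_cast hdne
  have hP' : P' = ((d⁻¹ : ℝ) : ℂ) • (A 0 * P) := by
    rw [hd0, smul_smul]
    push_cast
    rw [inv_mul_cancel₀ hdc, one_smul]
  refine ⟨⟨?_, ?_⟩, ?_⟩
  · rintro ⟨c, hc, h⟩
    refine ⟨d⁻¹ * c, mul_ne_zero (inv_ne_zero hdne) hc, ?_⟩
    rw [hP', smul_mul_assoc, mul_assoc, h, hp, mul_smul_comm, smul_smul]
    push_cast
    rfl
  · rintro ⟨c, hc, h⟩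
    refine ⟨d * c, mul_ne_zero hdne hc, ?_⟩
    rw [hp, hP', smul_mul_assoc, mul_assoc] at h
    rw [← Matrix.nonsing_inv_mul_cancel_left (A 0) (P * R) hA,
      ← Matrix.nonsing_inv_mul_cancel_left (A 0) (Φ 0 j k) hA, ← mul_smul_comm]
    congr 1
    push_cast
    rw [mul_smul, ← h, smul_smul]
    push_cast
    rw [mul_inv_cancel₀ hdc, one_smul]
  · rintro ⟨c, hc, h⟩
    apply imH_injective
    rw [imH_symPoint_step hq hd h0 hq' hd' hA' hA hp, imH_rot hR hR0]
    exact (conj_eq_of_mul_eq hP (hR.isUnit_det hR0) (by exact_mod_cast hc) h hy).symm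

/-- The right factor R is read off at a base vertex and persists over the connected graph. The
rotation by R then matches all normals and all edge vectors, and summing edge vectors leaves one
constant translation. -/
theorem rigidlyEquivalent_sym {S T : Set ℤ} (hS : S.OrdConnected) (hS' : S.Nonempty)
    (hT : T.OrdConnected) (hT' : T.Nonempty) {L M Φ : ℝ → ℤ → ℤ → Mat2}
    (hΦ : IsParallelFrameFamily S T L M Φ) {ξ : ℝ} {Ψ : ℤ → ℤ → Mat2} {x n : ℤ → ℤ → E3}
    (hΨ : ∀ j k, IsVertex S T j k → IsQuat (Ψ j k) ∧ Ψ j k ≠ 0)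
    (hn : ∀ j k, IsVertex S T j k → Ψ j k * imH (n j k) = (-Complex.I • pauli3) * Ψ j k)
    (h1 : ∀ j k, IsEdge1 S T j k →
      SymEdge ξ (fun t => L t j k) (Ψ j k) (Ψ (j + 1) k) (x (j + 1) k - x j k))
    (h2 : ∀ j k, IsEdge2 S T j k →
      SymEdge ξ (fun t => M t j k) (Ψ j k) (Ψ j (k + 1)) (x j (k + 1) - x j k)) :
    RigidlyEquivalent S T x n (symPoint ξ 0 Φ 0) (symNormal Φ 0) := by
  obtain ⟨j₀, hj₀⟩ := hS'
  obtain ⟨k₀, hk₀⟩ := hT'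
  have hv₀ : IsVertex S T j₀ k₀ := ⟨hj₀, hk₀⟩
  have e1 : ∀ {j k}, IsEdge1 S T j k → IsVertex S T j k ∧ IsVertex S T (j + 1) k :=
    fun he => ⟨⟨he.1, he.2.2⟩, ⟨he.2.1, he.2.2⟩⟩
  have e2 : ∀ {j k}, IsEdge2 S T j k → IsVertex S T j k ∧ IsVertex S T j (k + 1) :=
    fun he => ⟨⟨he.1, he.2.1⟩, ⟨he.1, he.2.2⟩⟩
  have hu : ∀ {j k}, IsVertex S T j k → IsUnit (Ψ j k).det :=
    fun {j k} hv => (hΨ j k hv).1.isUnit_det (hΨ j k hv).2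
  set R := (Ψ j₀ k₀)⁻¹ * Φ 0 j₀ k₀ with hRdef
  have hR : IsQuat R := (hΨ j₀ k₀ hv₀).1.inv.mul (hΦ.isQuat 0 j₀ k₀ hv₀)
  have hR0 : R ≠ 0 := by
    apply mul_ne_zero_of_isUnit_det _ (hΦ.ne_zero 0 j₀ k₀ hv₀)
    exact (Matrix.isUnit_nonsing_inv_det_iff).2 (hu hv₀)
  have step1 := fun j k (he : IsEdge1 S T j k) =>
    (h1 j k he).step (R := R) (fun t => hΦ.isQuat t _ _ (e1 he).1)
      (hΦ.differentiable _ _ (e1 he).1) (hΦ.ne_zero 0 _ _ (e1 he).1)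
      (fun t => hΦ.isQuat t _ _ (e1 he).2) (hΦ.differentiable _ _ (e1 he).2)
      (hΦ.ne_zero 0 _ _ (e1 he).2) (fun t => hΦ.parallel1 t _ _ he) (hu (e1 he).1) hR hR0
  have step2 := fun j k (he : IsEdge2 S T j k) =>
    (h2 j k he).step (R := R) (fun t => hΦ.isQuat t _ _ (e2 he).1)
      (hΦ.differentiable _ _ (e2 he).1) (hΦ.ne_zero 0 _ _ (e2 he).1)
      (fun t => hΦ.isQuat t _ _ (e2 he).2) (hΦ.differentiable _ _ (e2 he).2)
      (hΦ.ne_zero 0 _ _ (e2 he).2) (fun t => hΦ.parallel2 t _ _ he) (hu (e2 he).1) hR hR0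
  have frame := vertex_induction hS hT
    (p := fun j k => ∃ c : ℝ, c ≠ 0 ∧ Ψ j k * R = (c : ℂ) • Φ 0 j k) hv₀
    ⟨1, one_ne_zero, by
      rw [hRdef, Matrix.mul_nonsing_inv_cancel_left _ _ (hu hv₀)]
      simp⟩
    (fun j k he => (step1 j k he).1) (fun j k he => (step2 j k he).1)
  have point := vertex_induction hS hT
    (p := fun j k => symPoint ξ 0 Φ 0 j k =
      rot R (x j k) + (symPoint ξ 0 Φ 0 j₀ k₀ - rot R (x j₀ k₀))) hv₀ (by abel)
    (fun j k he => by
      have := (step1 j k he).2 (frame j k (e1 he).1)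
      rw [rot_sub hR hR0, sub_eq_iff_eq_add] at this
      rw [this]
      constructor
      · intro h
        rw [h]
        abel
      · intro h
        have h' := eq_sub_of_add_eq' h
        rw [h']
        abel)
    (fun j k he => by
      have := (step2 j k he).2 (frame j k (e2 he).1)
      rw [rot_sub hR hR0, sub_eq_iff_eq_add] at this
      rw [this]
      constructor
      · intro h
        rw [h]
        abel
      · intro h
        have h' := eq_sub_of_add_eq' h
        rw [h']
        abel)
  refine rigidlyEquivalent_iff.2 ⟨R, symPoint ξ 0 Φ 0 j₀ k₀ - rot R (x j₀ k₀), hR, hR0,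
    fun j k hv => ⟨point j k hv, imH_injective ?_⟩⟩
  obtain ⟨c, hc, h⟩ := frame j k hv
  rw [imH_symNormal (hΦ.isQuat 0 j k hv) (hΦ.ne_zero 0 j k hv), imH_rot hR hR0]
  exact (conj_eq_of_mul_eq (hu hv) (hR.isUnit_det hR0) (by exact_mod_cast hc) h
    (hn j k hv)).symm

/-! ### Frames adapted to nets of revolution -/

/-- The quaternion of the rotation by the angle `2 φ` about the third axis. -/
noncomputable def rotZ (φ : ℝ) : Mat2 :=
  !![Real.cos φ + Complex.I * Real.sin φ, 0; 0, Real.cos φ - Complex.I * Real.sin φ]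

theorem rotZ_add (φ ψ : ℝ) : rotZ (φ + ψ) = rotZ φ * rotZ ψ := by
  ext m n
  fin_cases m <;> fin_cases n <;> simp [rotZ, Complex.cos_add, Complex.sin_add] <;>
    linear_combination (-(Complex.sin φ * Complex.sin ψ)) * Complex.I_sq

theorem isQuat_rotZ (φ : ℝ) : IsQuat (rotZ φ) := by
  rw [isQuat_iff]
  simp [rotZ, -Complex.ofReal_cos, -Complex.ofReal_sin]
  ring

theorem det_rotZ (φ : ℝ) : (rotZ φ).det = 1 := by
  rw [Matrix.det_fin_two]
  simp [rotZ]
  linear_combination (-(Complex.sin φ) ^ 2) * Complex.I_sq + Complex.sin_sq_add_cos_sq (φ : ℂ)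

/-- Conjugation undoes the rotation of the profile; this is why the half angle θ/2 · k appears in
the frames. -/
theorem rotZ_mul_imH_revolve (θ : ℝ) (f h : ℤ → ℝ) (j k : ℤ) :
    rotZ (θ / 2 * k) * imH (revolve θ f h j k) = imH !₂[f j, 0, h j] * rotZ (θ / 2 * k) := by
  have e : θ * k = 2 * (θ / 2 * k) := by ring
  have h1 : ((Real.sin (θ / 2 * k) : ℂ)) ^ 2 + (Real.cos (θ / 2 * k) : ℂ) ^ 2 = 1 := by
    exact_mod_cast Real.sin_sq_add_cos_sq (θ / 2 * k)
  rw [revolve, e, Real.cos_two_mul, Real.sin_two_mul, rotZ]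
  generalize Real.cos (θ / 2 * k) = c at *
  generalize Real.sin (θ / 2 * k) = s at *
  ext m n
  fin_cases m <;> fin_cases n <;> simp [imH_eq]
  · ring
  · linear_combination (-2 * Complex.I * f j * c) * h1 - 2 * f j * s * c ^ 2 * Complex.I_sq
  · linear_combination (-2 * Complex.I * f j * c) * h1 + 2 * f j * s * c ^ 2 * Complex.I_sq
  · ring

/-- Only the component orthogonal to the axis fails to commute with the rotation. Up to a rotation
factor the commutator is the chord between consecutive positions, that is, the edge in the direction
of rotation. -/
theorem rotZ_conj_diff (φ x z : ℝ) :
    imH !₂[x, 0, z] * rotZ φ - rotZ φ * imH !₂[x, 0, z] =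
      (-2 * Complex.I * Real.sin φ * x) • pauli2 := by
  ext m n
  fin_cases m <;> fin_cases n <;> simp [rotZ, imH_eq, pauli2] <;> ring

/-- Differentiating the normalizing factor contributes a multiple of the transport itself. In A⁻¹ A'
this is a scalar matrix, which the trace-free projection removes, so the derivatives of α and β
never matter. -/
theorem HasMatDeriv.one_div_smul {α : ℝ → ℝ} {F : ℝ → Mat2} {F' : Mat2} {t : ℝ}
    (hα : DifferentiableAt ℝ α t) (h0 : α t ≠ 0) (hF : HasMatDeriv F F' t) :
    ∃ c : ℂ, HasMatDeriv (fun s => (1 / (α s : ℂ)) • F s)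
      ((1 / (α t : ℂ)) • F' + c • ((1 / (α t : ℂ)) • F t)) t := by
  refine ⟨-((deriv α t : ℝ) : ℂ) / α t, fun m n => ?_⟩
  have h0' : (α t : ℂ) ≠ 0 := by exact_mod_cast h0
  have h1 : HasDerivAt (fun s => (α s : ℂ)) ((deriv α t : ℝ) : ℂ) t := hα.hasDerivAt.ofReal_comp
  have h2 := (h1.inv h0').mul (hF m n)
  simp only [one_div]
  refine h2.congr_deriv ?_
  simp
  field_simp
  ring

/-- The Sym formula yields a net of revolution, if the transports along the edges act on adapted
frames `P j * rotZ (θ / 2 * k)` in the right way. -/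
theorem rigidlyEquivalent_revolve {S T : Set ℤ} (hS : S.OrdConnected) (hS' : S.Nonempty)
    (hT : T.OrdConnected) (hT' : T.Nonempty) {L M Φ : ℝ → ℤ → ℤ → Mat2}
    (hΦ : IsParallelFrameFamily S T L M Φ) {ξ θ : ℝ} (hξ : ξ ≠ 0) {f h a b : ℤ → ℝ}
    {P : ℤ → Mat2}
    (hP : ∀ j ∈ S, IsQuat (P j) ∧ P j ≠ 0 ∧
      P j * imH !₂[a j, 0, b j] = (-Complex.I • pauli3) * P j)
    (h1 : ∀ j k, IsEdge1 S T j k → (L 0 j k).det = 1 ∧ ∃ (l c : ℝ) (c' : ℂ) (L' : Mat2), l ≠ 0 ∧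
      a (j + 1) - a j = l * (f (j + 1) - f j) ∧ b (j + 1) - b j = l * (h (j + 1) - h j) ∧
      L 0 j k * P j = (c : ℂ) • P (j + 1) ∧
      HasMatDeriv (fun t => L t j k) (L' + c' • L 0 j k) 0 ∧
      ((ξ : ℂ) * l) • L' = -Complex.I • (pauli3 * L 0 j k - L 0 j k * pauli3))
    (h2 : ∀ j k, IsEdge2 S T j k → (M 0 j k).det = 1 ∧ ∃ (c' : ℂ) (M' : Mat2),
      M 0 j k * P j = P j * rotZ (θ / 2) ∧
      HasMatDeriv (fun t => M t j k) (M' + c' • M 0 j k) 0 ∧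
      (ξ : ℂ) • (M' * P j) = (-2 * Complex.I * Real.sin (θ / 2) * f j) • (P j * pauli2)) :
    RigidlyEquivalent S T (revolve θ f h) (revolve θ a b) (symPoint ξ 0 Φ 0)
      (symNormal Φ 0) := by
  have hDu : ∀ φ, IsUnit (rotZ φ).det := fun φ => by rw [det_rotZ]; exact isUnit_one
  have hD0 : ∀ φ, rotZ φ ≠ 0 := fun φ h0 => by simpa [h0] using det_rotZ φ
  refine rigidlyEquivalent_sym hS hS' hT hT' hΦ (Ψ := fun j k => P j * rotZ (θ / 2 * k))
    ?_ ?_ ?_ ?_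
  · intro j k hv
    obtain ⟨q, q0, -⟩ := hP j hv.1
    exact ⟨q.mul (isQuat_rotZ _), mul_ne_zero_of_isUnit_det (q.isUnit_det q0) (hD0 _)⟩
  · intro j k hv
    obtain ⟨-, -, hn⟩ := hP j hv.1
    rw [mul_assoc, rotZ_mul_imH_revolve, ← mul_assoc, hn, mul_assoc]
  · intro j k he
    obtain ⟨hdet, l, c, c', L', l0, ha, hb, hc, hL, hL'⟩ := h1 j k he
    have hu : IsUnit (L 0 j k).det := by rw [hdet]; exact isUnit_one
    obtain ⟨-, -, hn⟩ := hP j he.1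
    obtain ⟨-, -, hn'⟩ := hP (j + 1) he.2.1
    refine ⟨⟨c, by rw [← mul_assoc, hc, smul_mul_assoc]⟩, _, hL, ?_⟩
    -- L' is a commutator with the third axis, so L⁻¹ L' is the difference of the normals at the two
    -- ends, seen in the frame of the first. The edge vector is therefore δn / l.
    have key : ((ξ : ℂ) * l) • ((L 0 j k)⁻¹ * L') =
        (L 0 j k)⁻¹ * (-Complex.I • pauli3) * L 0 j k - -Complex.I • pauli3 := by
      rw [← mul_smul_comm, hL', mul_smul_comm, mul_sub,
        Matrix.nonsing_inv_mul_cancel_left _ _ hu, smul_sub, mul_smul_comm, smul_mul_assoc,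
        mul_assoc]
    have hξl : (ξ : ℂ) * l ≠ 0 := mul_ne_zero (by exact_mod_cast hξ) (by exact_mod_cast l0)
    have htr : ((L 0 j k)⁻¹ * L').trace = 0 := by
      have := congrArg Matrix.trace key
      rw [Matrix.trace_smul, Matrix.trace_sub, trace_inv_mul_mul hu, sub_self] at this
      exact (smul_eq_zero.1 this).resolve_left hξl
    have htf : traceFree ((L 0 j k)⁻¹ * (L' + c' • L 0 j k)) = (L 0 j k)⁻¹ * L' := by
      rw [mul_add, mul_smul_comm, Matrix.nonsing_inv_mul _ hu, traceFree_add,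
        traceFree_smul_one, add_zero, traceFree_of_trace_eq_zero htr]
    rw [htf]
    have hd : imH !₂[f (j + 1), 0, h (j + 1)] - imH !₂[f j, 0, h j] =
        (l : ℂ)⁻¹ • (imH !₂[a (j + 1), 0, b (j + 1)] - imH !₂[a j, 0, b j]) := by
      have hlc : (l : ℂ) ≠ 0 := by exact_mod_cast l0
      rw [eq_inv_smul_iff₀ hlc, ← imH_sub, ← imH_sub, ← imH_smul]
      congr 1
      ext i
      fin_cases i
      · simpa using ha.symm
      · simp
      · simpa using hb.symm
    have hPn : P j * imH !₂[a (j + 1), 0, b (j + 1)] =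
        (L 0 j k)⁻¹ * (-Complex.I • pauli3) * L 0 j k * P j := by
      rw [mul_assoc, hc, mul_assoc, mul_smul_comm, ← hn', ← smul_mul_assoc, ← hc, mul_assoc,
        Matrix.nonsing_inv_mul_cancel_left _ _ hu]
    rw [imH_sub, mul_assoc, mul_sub, rotZ_mul_imH_revolve, rotZ_mul_imH_revolve, ← sub_mul, hd,
      smul_mul_assoc, mul_smul_comm, ← mul_assoc, mul_sub, hn, hPn, ← sub_mul, ← key,
      ← mul_assoc, ← smul_mul_assoc, ← smul_mul_assoc, smul_smul]
    congr 3
    have hlc : (l : ℂ) ≠ 0 := by exact_mod_cast l0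
    field_simp
  · intro j k he
    obtain ⟨hdet, c', M', hM0, hM, hM'⟩ := h2 j k he
    have hu : IsUnit (M 0 j k).det := by rw [hdet]; exact isUnit_one
    have hPu : IsUnit (P j).det := (hP j he.1).1.isUnit_det (hP j he.1).2.1
    have hDs : rotZ (θ / 2 * ((k + 1 : ℤ) : ℝ)) = rotZ (θ / 2) * rotZ (θ / 2 * k) := by
      rw [← rotZ_add]
      congr 1
      push_cast
      ring
    have hξc : (ξ : ℂ) ≠ 0 := by exact_mod_cast hξ
    refine ⟨⟨1, ?_⟩, _, hM, ?_⟩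
    · rw [← mul_assoc, hM0, hDs, mul_assoc]
      simp
    have hPD : (M 0 j k)⁻¹ * P j = P j * (rotZ (θ / 2))⁻¹ := by
      have e : P j * rotZ (θ / 2) * (rotZ (θ / 2))⁻¹ = P j :=
        Matrix.mul_nonsing_inv_cancel_right _ _ (hDu _)
      rw [← hM0, mul_assoc (M 0 j k)] at e
      rw [← Matrix.nonsing_inv_mul_cancel_left (M 0 j k) (P j * (rotZ (θ / 2))⁻¹) hu, e]
    -- The derivative points along the second axis in the adapted frame, which is the direction of
    -- the chord in `rotZ_conj_diff`.
    have key : (ξ : ℂ) • ((M 0 j k)⁻¹ * M' * P j) =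
        (-2 * Complex.I * Real.sin (θ / 2) * f j) • (P j * ((rotZ (θ / 2))⁻¹ * pauli2)) := by
      rw [mul_assoc, ← mul_smul_comm, hM', mul_smul_comm, ← mul_assoc, hPD, mul_assoc (P j)]
    have htr : ((M 0 j k)⁻¹ * M').trace = 0 := by
      have h3 := congrArg (fun B => (P j)⁻¹ * B) key
      simp only [mul_smul_comm] at h3
      rw [Matrix.nonsing_inv_mul_cancel_left _ _ hPu, ← mul_assoc] at h3
      have h4 := congrArg Matrix.trace h3
      rw [Matrix.trace_smul, trace_inv_mul_mul hPu, Matrix.trace_smul] at h4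
      have h5 : ((rotZ (θ / 2))⁻¹ * pauli2).trace = 0 := by
        rw [Matrix.inv_def, det_rotZ]
        simp [rotZ, pauli2, Matrix.adjugate_fin_two, Matrix.trace_fin_two]
      rw [h5, smul_zero] at h4
      exact (smul_eq_zero.1 h4).resolve_left hξc
    have htf : traceFree ((M 0 j k)⁻¹ * (M' + c' • M 0 j k)) = (M 0 j k)⁻¹ * M' := by
      rw [mul_add, mul_smul_comm, Matrix.nonsing_inv_mul _ hu, traceFree_add,
        traceFree_smul_one, add_zero, traceFree_of_trace_eq_zero htr]
    have hdiff := rotZ_conj_diff (θ / 2) (f j) (h j)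
    have hrev : rotZ (θ / 2 * k) * imH (revolve θ f h j (k + 1)) =
        (rotZ (θ / 2))⁻¹ * (imH !₂[f j, 0, h j] * rotZ (θ / 2) * rotZ (θ / 2 * k)) := by
      rw [mul_assoc, ← hDs, ← rotZ_mul_imH_revolve, hDs, mul_assoc,
        Matrix.nonsing_inv_mul_cancel_left _ _ (hDu _)]
    rw [htf, smul_mul_assoc, ← mul_assoc _ (P j), ← smul_mul_assoc, key, imH_sub, mul_assoc,
      mul_sub, hrev, rotZ_mul_imH_revolve, ← mul_smul_comm, ← mul_smul_comm, ← hdiff]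
    simp only [mul_sub, sub_mul, mul_assoc]
    rw [Matrix.nonsing_inv_mul_cancel_left _ _ (hDu _)]

/-! ### Frames of the profile -/

/-- The frame of a profile with normal `(2 p q, p² - q²)`, up to a rotation about the third axis
that is described by `e`. -/
noncomputable def profileFrame (e : ℂ) (p q : ℝ) : Mat2 :=
  !![e * p, e * q; -(conj e * q), conj e * p]

theorem isQuat_profileFrame (e : ℂ) (p q : ℝ) : IsQuat (profileFrame e p q) := by
  simp [isQuat_iff, profileFrame]

theorem profileFrame_ne_zero {e : ℂ} (he : e ≠ 0) {p q : ℝ} (h : p ^ 2 + q ^ 2 = 1) :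
    profileFrame e p q ≠ 0 := by
  intro h0
  have h1 := congrFun (congrFun h0 0) 0
  have h2 := congrFun (congrFun h0 0) 1
  simp [profileFrame, he] at h1 h2
  rw [h1, h2] at h
  norm_num at h

theorem profileFrame_mul_imH (e : ℂ) {p q a b : ℝ} (h : p ^ 2 + q ^ 2 = 1) (ha : a = 2 * p * q)
    (hb : b = p ^ 2 - q ^ 2) :
    profileFrame e p q * imH !₂[a, 0, b] = (-Complex.I • pauli3) * profileFrame e p q := by
  have h' : (p : ℂ) ^ 2 + (q : ℂ) ^ 2 = 1 := by exact_mod_cast h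
  subst ha hb
  ext m n
  fin_cases m <;> fin_cases n <;> simp [profileFrame, imH_eq, pauli3]
  · linear_combination (-(e * p * Complex.I)) * h'
  · linear_combination (-(e * q * Complex.I)) * h'
  · linear_combination (-(conj e * q * Complex.I)) * h'
  · linear_combination (conj e * p * Complex.I) * h'

/-- The half angle comes from a complex square root of b + i a. -/
theorem exists_half_angle {a b : ℝ} (h : a ^ 2 + b ^ 2 = 1) :
    ∃ p q : ℝ, p ^ 2 + q ^ 2 = 1 ∧ a = 2 * p * q ∧ b = p ^ 2 - q ^ 2 := by
  obtain ⟨z, hz⟩ := IsAlgClosed.exists_pow_nat_eq (⟨b, a⟩ : ℂ) (n := 2) (by norm_num)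
  have h1 := congrArg Complex.re hz
  have h2 := congrArg Complex.im hz
  simp [pow_two] at h1 h2
  refine ⟨z.re, z.im, ?_, by linarith, by linarith⟩
  have h3 : (z.re ^ 2 + z.im ^ 2) ^ 2 = 1 := by
    rw [← h, ← h1, ← h2]
    ring
  nlinarith [sq_nonneg z.re, sq_nonneg z.im]

/-- With (p, q) = (cos φ, sin φ) and (p', q') = (cos φ', sin φ'), the hypotheses are cos(φ + φ') and
sin(φ + φ') times the conclusion m sin(φ' - φ) + g cos(φ' - φ) = 0. These two factors never vanish
together. -/
theorem half_angle_step {p q p' q' a b a' b' m g : ℝ} (h : p ^ 2 + q ^ 2 = 1)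
    (ha : a = 2 * p * q) (hb : b = p ^ 2 - q ^ 2) (h' : p' ^ 2 + q' ^ 2 = 1)
    (ha' : a' = 2 * p' * q') (hb' : b' = p' ^ 2 - q' ^ 2) (h1 : m * (a' - a) = -(g * (b' + b)))
    (h2 : m * (b' - b) = g * (a' + a)) : m * (p * q' - q * p') + g * (q * q' + p * p') = 0 := by
  subst ha hb ha' hb'
  have e1 : (p * p' - q * q') * (m * (p * q' - q * p') + g * (q * q' + p * p')) = 0 := by
    linear_combination h1 / 2 + (m * p' * q' + g * (p' ^ 2 - q' ^ 2) / 2) * h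
      - (m * p * q - g * (p ^ 2 - q ^ 2) / 2) * h'
  have e2 : (p * q' + q * p') * (m * (p * q' - q * p') + g * (q * q' + p * p')) = 0 := by
    linear_combination (-1 / 2) * h2 + (g * p' * q' - m * (p' ^ 2 - q' ^ 2) / 2) * h
      + (g * p * q + m * (p ^ 2 - q ^ 2) / 2) * h'
  have e3 : (p * p' - q * q') ^ 2 + (p * q' + q * p') ^ 2 = 1 := by
    linear_combination (p' ^ 2 + q' ^ 2) * h + h'
  linear_combination (p * p' - q * q') * e1 + (p * q' + q * p') * e2
    - (m * (p * q' - q * p') + g * (q * q' + p * p')) * e3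

/-! ### Connections of CMC type -/

theorem exp_add_exp_neg (t : ℝ) :
    Complex.exp (2 * Complex.I * t) + Complex.exp (-(2 * Complex.I * t)) =
      ((2 * Real.cos (2 * t) : ℝ) : ℂ) := by
  push_cast
  rw [Complex.two_cos]
  congr 2 <;> ring

namespace CMCConnection

variable {S T : Set ℤ} (C : CMCConnection S T)

theorem α_sq_real {j k : ℤ} (he : IsEdge1 S T j k) (t : ℝ) :
    C.α j k t ^ 2 = (C.𝔳 j k).re ^ 2 + (C.𝔳 j k).im ^ 2 + C.u j k ^ 2 + (C.u j k)⁻¹ ^ 2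
      + 2 * Real.cos (2 * t) := by
  have h := C.α_sq j k he t
  rw [add_assoc, exp_add_exp_neg] at h
  rw [pow_two (C.𝔳 j k).re, pow_two (C.𝔳 j k).im, ← Complex.normSq_apply, Complex.normSq_eq_norm_sq]
  exact_mod_cast h

theorem β_sq_real {j k : ℤ} (he : IsEdge2 S T j k) (t : ℝ) :
    C.β j k t ^ 2 = (C.𝔥 j k).re ^ 2 + (C.𝔥 j k).im ^ 2 + C.v j k ^ 2 + (C.v j k)⁻¹ ^ 2
      - 2 * Real.cos (2 * t) := by
  have h := C.β_sq j k he t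
  rw [sub_sub, exp_add_exp_neg] at h
  rw [pow_two (C.𝔥 j k).re, pow_two (C.𝔥 j k).im, ← Complex.normSq_apply, Complex.normSq_eq_norm_sq]
  exact_mod_cast h

theorem conj_exp_I (t : ℝ) : conj (Complex.exp (Complex.I * t)) = Complex.exp (-(Complex.I * t)) := by
  rw [← Complex.exp_conj]
  simp

theorem conj_exp_neg_I (t : ℝ) :
    conj (Complex.exp (-(Complex.I * t))) = Complex.exp (Complex.I * t) := by
  rw [← Complex.exp_conj]
  simp

/-- The prescribed α² is exactly the determinant of the matrix before normalization. -/
theorem isUnitFamily_L {j k : ℤ} (he : IsEdge1 S T j k) : IsUnitFamily fun t => C.L t j k := by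
  have hα : ∀ t, (C.α j k t : ℂ) ≠ 0 := fun t => by exact_mod_cast C.α_ne_zero j k he t
  refine ⟨fun t => ?_, fun t => ?_, fun m n => ?_⟩
  · have := IsQuat.smul (A := !![C.𝔳 j k,
       -Complex.exp (Complex.I * t) * C.u j k - Complex.exp (-(Complex.I * t)) * (C.u j k : ℂ)⁻¹;
       Complex.exp (-(Complex.I * t)) * C.u j k + Complex.exp (Complex.I * t) * (C.u j k : ℂ)⁻¹,
       conj (C.𝔳 j k)]) (by
        simp [isQuat_iff, conj_exp_I, conj_exp_neg_I]
        ring) (1 / C.α j k t)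
    push_cast at this
    exact this
  · have h := C.α_sq j k he t
    have hu : (C.u j k : ℂ) ≠ 0 := by exact_mod_cast C.u_ne_zero j k he
    have e0 : Complex.exp (Complex.I * t) * Complex.exp (-(Complex.I * t)) = 1 := by
      rw [← Complex.exp_add]; simp
    have e1 : Complex.exp (2 * Complex.I * t) = Complex.exp (Complex.I * t) ^ 2 := by
      rw [← Complex.exp_nat_mul]; congr 1; push_cast; ring
    have e2 : Complex.exp (-(2 * Complex.I * t)) = Complex.exp (-(Complex.I * t)) ^ 2 := by
      rw [← Complex.exp_nat_mul]; congr 1; push_cast; ring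
    rw [e1, e2, ← Complex.mul_conj'] at h
    rw [L, Matrix.det_smul, Matrix.det_fin_two_of, Fintype.card_fin, one_div, inv_pow,
      inv_mul_eq_one₀ (pow_ne_zero 2 (hα t)), h]
    generalize Complex.exp (Complex.I * t) = x at *
    generalize Complex.exp (-(Complex.I * t)) = y at *
    field_simp
    linear_combination (-(C.u j k : ℂ) ^ 4 - 1) * e0
  · have hα' : Differentiable ℝ fun t => (1 / (C.α j k t : ℂ)) := by
      simp only [one_div]
      exact fun t => ((C.α_differentiable j k he t).hasDerivAt.ofReal_comp).differentiableAt.inv (hα t)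
    simp only [L, Matrix.smul_apply, smul_eq_mul]
    refine hα'.mul ?_
    fin_cases m <;> fin_cases n <;> simp <;> fun_prop

theorem isUnitFamily_M {j k : ℤ} (he : IsEdge2 S T j k) : IsUnitFamily fun t => C.M t j k := by
  have hβ : ∀ t, (C.β j k t : ℂ) ≠ 0 := fun t => by exact_mod_cast C.β_ne_zero j k he t
  refine ⟨fun t => ?_, fun t => ?_, fun m n => ?_⟩
  · have := IsQuat.smul (A := !![C.𝔥 j k,
       -Complex.I * Complex.exp (Complex.I * t) * C.v j k
         + Complex.I * Complex.exp (-(Complex.I * t)) * (C.v j k : ℂ)⁻¹;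
       Complex.I * Complex.exp (Complex.I * t) * (C.v j k : ℂ)⁻¹
         - Complex.I * Complex.exp (-(Complex.I * t)) * C.v j k,
       conj (C.𝔥 j k)]) (by
        simp [isQuat_iff, conj_exp_I, conj_exp_neg_I]) (1 / C.β j k t)
    push_cast at this
    exact this
  · have h := C.β_sq j k he t
    have hv : (C.v j k : ℂ) ≠ 0 := by exact_mod_cast C.v_ne_zero j k he
    have e0 : Complex.exp (Complex.I * t) * Complex.exp (-(Complex.I * t)) = 1 := by
      rw [← Complex.exp_add]; simp
    have e1 : Complex.exp (2 * Complex.I * t) = Complex.exp (Complex.I * t) ^ 2 := by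
      rw [← Complex.exp_nat_mul]; congr 1; push_cast; ring
    have e2 : Complex.exp (-(2 * Complex.I * t)) = Complex.exp (-(Complex.I * t)) ^ 2 := by
      rw [← Complex.exp_nat_mul]; congr 1; push_cast; ring
    rw [e1, e2, ← Complex.mul_conj'] at h
    rw [M, Matrix.det_smul, Matrix.det_fin_two_of, Fintype.card_fin, one_div, inv_pow,
      inv_mul_eq_one₀ (pow_ne_zero 2 (hβ t)), h]
    generalize Complex.exp (Complex.I * t) = x at *
    generalize Complex.exp (-(Complex.I * t)) = y at *
    field_simp
    rw [Complex.I_sq]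
    linear_combination (-(C.v j k : ℂ) ^ 4 - 1) * e0
  · have hβ' : Differentiable ℝ fun t => (1 / (C.β j k t : ℂ)) := by
      simp only [one_div]
      exact fun t => ((C.β_differentiable j k he t).hasDerivAt.ofReal_comp).differentiableAt.inv (hβ t)
    simp only [M, Matrix.smul_apply, smul_eq_mul]
    refine hβ'.mul ?_
    fin_cases m <;> fin_cases n <;> simp <;> fun_prop

theorem L_zero (j k : ℤ) : C.L 0 j k = (1 / (C.α j k 0 : ℂ)) •
    !![C.𝔳 j k, -(C.u j k + (C.u j k : ℂ)⁻¹); C.u j k + (C.u j k : ℂ)⁻¹, conj (C.𝔳 j k)] := by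
  simp only [L, Complex.ofReal_zero, mul_zero, neg_zero, Complex.exp_zero]
  congr 1
  ext m n
  fin_cases m <;> fin_cases n <;> simp
  ring

theorem M_zero (j k : ℤ) : C.M 0 j k = (1 / (C.β j k 0 : ℂ)) •
    !![C.𝔥 j k, -(Complex.I * (C.v j k - (C.v j k : ℂ)⁻¹));
      -(Complex.I * (C.v j k - (C.v j k : ℂ)⁻¹)), conj (C.𝔥 j k)] := by
  simp only [M, Complex.ofReal_zero, mul_zero, neg_zero, Complex.exp_zero]
  congr 1
  ext m n
  fin_cases m <;> fin_cases n <;> simp <;> ring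

theorem hasMatDeriv_L {j k : ℤ} (he : IsEdge1 S T j k) :
    ∃ c : ℂ, HasMatDeriv (fun t => C.L t j k)
      ((1 / (C.α j k 0 : ℂ)) • !![0, -(Complex.I * (C.u j k - (C.u j k : ℂ)⁻¹));
        -(Complex.I * (C.u j k - (C.u j k : ℂ)⁻¹)), 0] + c • C.L 0 j k) 0 := by
  refine HasMatDeriv.one_div_smul (C.α_differentiable j k he 0) (C.α_ne_zero j k he 0) ?_
  have h1 : HasDerivAt (fun t : ℝ => Complex.exp (Complex.I * t)) Complex.I 0 := by
    have := ((hasDerivAt_id (0 : ℝ)).ofReal_comp.const_mul Complex.I).cexp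
    simpa using this
  have h2 : HasDerivAt (fun t : ℝ => Complex.exp (-(Complex.I * t))) (-Complex.I) 0 := by
    have := ((hasDerivAt_id (0 : ℝ)).ofReal_comp.const_mul Complex.I).neg.cexp
    simpa using this
  intro m n
  fin_cases m <;> fin_cases n
  · simpa using hasDerivAt_const (0 : ℝ) (C.𝔳 j k)
  · exact ((h1.neg.mul_const _).sub (h2.mul_const _)).congr_deriv (by simp; ring)
  · exact ((h2.mul_const _).add (h1.mul_const _)).congr_deriv (by simp; ring)
  · simpa using hasDerivAt_const (0 : ℝ) (conj (C.𝔳 j k))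

theorem hasMatDeriv_M {j k : ℤ} (he : IsEdge2 S T j k) :
    ∃ c : ℂ, HasMatDeriv (fun t => C.M t j k)
      ((1 / (C.β j k 0 : ℂ)) • !![0, C.v j k + (C.v j k : ℂ)⁻¹;
        -(C.v j k + (C.v j k : ℂ)⁻¹), 0] + c • C.M 0 j k) 0 := by
  refine HasMatDeriv.one_div_smul (C.β_differentiable j k he 0) (C.β_ne_zero j k he 0) ?_
  have h1 : HasDerivAt (fun t : ℝ => Complex.exp (Complex.I * t)) Complex.I 0 := by
    have := ((hasDerivAt_id (0 : ℝ)).ofReal_comp.const_mul Complex.I).cexp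
    simpa using this
  have h2 : HasDerivAt (fun t : ℝ => Complex.exp (-(Complex.I * t))) (-Complex.I) 0 := by
    have := ((hasDerivAt_id (0 : ℝ)).ofReal_comp.const_mul Complex.I).neg.cexp
    simpa using this
  intro m n
  fin_cases m <;> fin_cases n
  · simpa using hasDerivAt_const (0 : ℝ) (C.𝔥 j k)
  · refine (((h1.const_mul (-Complex.I)).mul_const _).add
      ((h2.const_mul Complex.I).mul_const _)).congr_deriv ?_
    simp
  · refine (((h1.const_mul Complex.I).mul_const _).sub
      ((h2.const_mul Complex.I).mul_const _)).congr_deriv ?_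
    simp
    ring
  · simpa using hasDerivAt_const (0 : ℝ) (conj (C.𝔥 j k))

/-- The entries of both products are Laurent polynomials in e^{it}, compared by coefficients. The
relation u u' = v v' settles the powers ±2, and the other three equations settle the powers 0, 1 and
-1. -/
theorem isFlat_of_compatible {C : CMCConnection S T} (hC : C.Compatible) (t : ℝ) :
    IsFlat S T (C.L t) (C.M t) := by
  intro j k hF
  obtain ⟨h1, h2, h3, h4⟩ := hC j k hF
  obtain ⟨f1, f2, f3, f4⟩ := hF
  have hu : (C.u j k : ℂ) ≠ 0 := by exact_mod_cast C.u_ne_zero j k ⟨f1, f2, f3⟩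
  have hu' : (C.u j (k + 1) : ℂ) ≠ 0 := by exact_mod_cast C.u_ne_zero j (k + 1) ⟨f1, f2, f4⟩
  have hv : (C.v j k : ℂ) ≠ 0 := by exact_mod_cast C.v_ne_zero j k ⟨f1, f3, f4⟩
  have hv' : (C.v (j + 1) k : ℂ) ≠ 0 := by exact_mod_cast C.v_ne_zero (j + 1) k ⟨f2, f3, f4⟩
  have hc : (C.u j k : ℂ) * C.u j (k + 1) = C.v j k * C.v (j + 1) k := by exact_mod_cast h1
  -- As u u' = v v', all four inverses share the factor (v v')⁻¹; each is this factor times the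
  -- value on the opposite edge.
  have i1 : (C.v (j + 1) k : ℂ)⁻¹ = (C.v j k * C.v (j + 1) k : ℂ)⁻¹ * C.v j k := by field_simp
  have i2 : (C.v j k : ℂ)⁻¹ = (C.v j k * C.v (j + 1) k : ℂ)⁻¹ * C.v (j + 1) k := by field_simp
  have i3 : (C.u (j) (k + 1) : ℂ)⁻¹ = (C.v j k * C.v (j + 1) k : ℂ)⁻¹ * C.u j k := by
    rw [← hc]; field_simp
  have i4 : (C.u j k : ℂ)⁻¹ = (C.v j k * C.v (j + 1) k : ℂ)⁻¹ * C.u j (k + 1) := by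
    rw [← hc]; field_simp
  have e0 : Complex.exp (Complex.I * t) * Complex.exp (-(Complex.I * t)) = 1 := by
    rw [← Complex.exp_add]; simp
  apply IsQuat.ext
  · exact ((C.isUnitFamily_M ⟨f2, f3, f4⟩).isQuat t).mul ((C.isUnitFamily_L ⟨f1, f2, f3⟩).isQuat t)
  · exact ((C.isUnitFamily_L ⟨f1, f2, f4⟩).isQuat t).mul ((C.isUnitFamily_M ⟨f1, f3, f4⟩).isQuat t)
  all_goals
    rw [L, M, L, M, smul_mul_smul_comm, smul_mul_smul_comm, C.α_opposite j k ⟨f1, f2, f3, f4⟩ t,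
      C.β_opposite j k ⟨f1, f2, f3, f4⟩ t, Matrix.smul_apply, Matrix.smul_apply,
      mul_comm (1 / (C.β (j + 1) k t : ℂ))]
    congr 1
    simp only [Matrix.mul_apply, Fin.sum_univ_two]
    simp
  · rw [mul_inv, mul_inv] at h2
    have r1 : (C.v (j + 1) k : ℂ) * (C.u j k : ℂ)⁻¹ = C.u j (k + 1) * (C.v j k : ℂ)⁻¹ := by
      rw [i4, i2]; ring
    have r2 : (C.u j k : ℂ) * (C.v (j + 1) k : ℂ)⁻¹ = C.v j k * (C.u j (k + 1) : ℂ)⁻¹ := by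
      rw [i1, i3]; ring
    generalize Complex.exp (Complex.I * t) = x at *
    generalize Complex.exp (-(Complex.I * t)) = y at *
    linear_combination h2 + (Complex.I * (-(C.v (j + 1) k : ℂ) * C.u j k
      + (C.v (j + 1) k : ℂ)⁻¹ * (C.u j k : ℂ)⁻¹ - C.u j (k + 1) * C.v j k
      + (C.u j (k + 1) : ℂ)⁻¹ * (C.v j k : ℂ)⁻¹)) * e0 - Complex.I * x ^ 2 * r1
      + Complex.I * y ^ 2 * r2
  · rw [i1, i2, i3, i4]
    linear_combination (-Complex.exp (Complex.I * t)) * h3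
      + Complex.exp (-(Complex.I * t)) * (C.v j k * C.v (j + 1) k : ℂ)⁻¹ * h4

end CMCConnection

/-- The two scalar equations behind the compatibility of a face, for the data `u`, `m` of a pair of
equal opposite edges and the data `v`, `y` and `v'`, `y'` of the other two. -/
theorem face_equations {u v v' m y y' : ℝ} (hu : u ≠ 0) (hv : v ≠ 0) (hv' : v' ≠ 0)
    (h : u ^ 2 = v * v') (hβ : y ^ 2 + v ^ 2 + v⁻¹ ^ 2 = y' ^ 2 + v' ^ 2 + v'⁻¹ ^ 2)
    (h1 : v ≠ v' → m * (v - v') = u * (y + y'))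
    (h2 : v = v' → m * (y' - y) = 2 * (u * v - u⁻¹ * v⁻¹) ∧ y' = -y) :
    m * (v - v') = u * (y + y') ∧
      m * (y' - y) = u * v - (u * v)⁻¹ + v' * u - (v' * u)⁻¹ := by
  by_cases hvv : v = v'
  · obtain ⟨e1, e2⟩ := h2 hvv
    subst hvv
    refine ⟨by rw [e2]; ring, ?_⟩
    rw [e1, mul_inv, mul_inv]
    ring
  · have e1 := h1 hvv
    refine ⟨e1, ?_⟩
    -- After multiplication by v - v' the first equation turns the left side into u (y'² - y²),
    -- which the equality of squares evaluates in terms of v and v'.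
    apply mul_left_cancel₀ (sub_ne_zero.2 hvv)
    have i1 : v'⁻¹ = (u ^ 2)⁻¹ * v := by rw [h]; field_simp
    have i2 : v⁻¹ = (u ^ 2)⁻¹ * v' := by rw [h]; field_simp
    rw [i1, i2] at hβ
    rw [mul_inv, mul_inv, i1, i2]
    have i3 : u⁻¹ = u * (u ^ 2)⁻¹ := by field_simp
    rw [i3]
    linear_combination (y' - y) * e1 - u * hβ

namespace CMCConnection

variable {S T : Set ℤ} {C : CMCConnection S T}

/-- Opposite edges share β; the constant real part and the cosine then drop out of β². -/
theorem β_inv_sq_eq {j k : ℤ} (hF : IsFace S T j k) (hre : (C.𝔥 (j + 1) k).re = (C.𝔥 j k).re) :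
    (C.𝔥 j k).im ^ 2 + C.v j k ^ 2 + (C.v j k)⁻¹ ^ 2 =
      (C.𝔥 (j + 1) k).im ^ 2 + C.v (j + 1) k ^ 2 + (C.v (j + 1) k)⁻¹ ^ 2 := by
  have h1 := C.β_sq_real (j := j) (k := k) ⟨hF.1, hF.2.2⟩ 0
  have h2 := C.β_sq_real (j := j + 1) (k := k) ⟨hF.2.1, hF.2.2⟩ 0
  rw [C.β_opposite j k hF 0] at h1
  rw [hre] at h2
  linarith

theorem α_inv_sq_eq {j k : ℤ} (hF : IsFace S T j k) (hre : (C.𝔳 j (k + 1)).re = (C.𝔳 j k).re) :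
    (C.𝔳 j k).im ^ 2 + C.u j k ^ 2 + (C.u j k)⁻¹ ^ 2 =
      (C.𝔳 j (k + 1)).im ^ 2 + C.u j (k + 1) ^ 2 + (C.u j (k + 1))⁻¹ ^ 2 := by
  have h1 := C.α_sq_real (j := j) (k := k) ⟨hF.1, hF.2.1, hF.2.2.1⟩ 0
  have h2 := C.α_sq_real (j := j) (k := k + 1) ⟨hF.1, hF.2.1, hF.2.2.2⟩ 0
  rw [C.α_opposite j k hF 0] at h1
  rw [hre] at h2
  linarith

/-! ### Rotation in the second direction, positive curvature -/

/-- Because 𝔳 is real and Re 𝔥 is constant, each complex formula for 𝔳 contains one real equation.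
`face_equations` supplies the other. -/
theorem Cond2.face (h : C.Cond2) (hc : C.Const2) {j k : ℤ} (hF : IsFace S T j k) :
    (C.𝔥 (j + 1) k).re = (C.𝔥 j k).re ∧
    (C.𝔳 j k).re * (C.v j k - C.v (j + 1) k) =
      C.u j k * ((C.𝔥 j k).im + (C.𝔥 (j + 1) k).im) ∧
    (C.𝔳 j k).re * ((C.𝔥 (j + 1) k).im - (C.𝔥 j k).im) =
      C.u j k * C.v j k - (C.u j k * C.v j k)⁻¹ + C.v (j + 1) k * C.u j k
        - (C.v (j + 1) k * C.u j k)⁻¹ := by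
  obtain ⟨h1, h2, h3, h4, h5, h6, h7⟩ := h j k hF
  have e2 : IsEdge2 S T j k := ⟨hF.1, hF.2.2⟩
  have e2' : IsEdge2 S T (j + 1) k := ⟨hF.2.1, hF.2.2⟩
  have hre : (C.𝔥 (j + 1) k).re = (C.𝔥 j k).re := by
    obtain ⟨c, hc⟩ := hc.2
    rw [hc _ _ e2, hc _ _ e2']
  refine ⟨hre, face_equations (C.u_ne_zero j k ⟨hF.1, hF.2.1, hF.2.2.1⟩) (C.v_ne_zero j k e2)
    (C.v_ne_zero (j + 1) k e2') h3 (β_inv_sq_eq hF hre) ?_ ?_⟩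
  · intro hne
    have h8 := h6 hne
    have hne' : (C.v j k : ℂ) - C.v (j + 1) k ≠ 0 := by
      rw [sub_ne_zero]
      exact_mod_cast hne
    rw [eq_div_iff hne'] at h8
    have h9 := congrArg Complex.re h8
    simp [hre] at h9
    linarith
  · intro heq
    obtain ⟨h8, h9, h10⟩ := h7 heq
    have him : (C.𝔥 (j + 1) k).im = -(C.𝔥 j k).im := by
      have := congrArg Complex.im h9
      simp at this
      linarith
    rw [eq_div_iff (sub_ne_zero.2 h10)] at h8
    have h11 := congrArg Complex.im h8
    simp [hre, h5, ← Complex.ofReal_mul, ← Complex.ofReal_inv] at h11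
    exact ⟨by linarith, him⟩

/-- The last two compatibility equations are multiples by ∓i of the first scalar equation of the
face, and the second one is i times the second scalar equation. -/
theorem Cond2.compatible (h : C.Cond2) (hc : C.Const2) : C.Compatible := by
  intro j k hF
  obtain ⟨h1, h2, h3, h4, h5, -, -⟩ := h j k hF
  obtain ⟨hre, e1, e2⟩ := h.face hc hF
  have hm : C.𝔳 j k = ((C.𝔳 j k).re : ℂ) := by
    apply Complex.ext <;> simp [h5]
  have hm' : conj (C.𝔳 j k) = ((C.𝔳 j k).re : ℂ) := by rw [hm]; simp
  have hh : C.𝔥 j k = ((C.𝔥 j k).re : ℂ) + Complex.I * (C.𝔥 j k).im := by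
    rw [mul_comm, Complex.re_add_im]
  have hh' : C.𝔥 (j + 1) k = ((C.𝔥 j k).re : ℂ) + Complex.I * (C.𝔥 (j + 1) k).im := by
    rw [mul_comm, ← hre, Complex.re_add_im]
  have hcj : conj (C.𝔥 j k) = ((C.𝔥 j k).re : ℂ) - Complex.I * (C.𝔥 j k).im := by
    apply Complex.ext <;> simp
  have e1' : ((C.𝔳 j k).re : ℂ) * (C.v j k - C.v (j + 1) k) =
      C.u j k * ((C.𝔥 j k).im + (C.𝔥 (j + 1) k).im) := by exact_mod_cast e1
  have e2' : ((C.𝔳 j k).re : ℂ) * ((C.𝔥 (j + 1) k).im - (C.𝔥 j k).im) =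
      C.u j k * C.v j k - (C.u j k * C.v j k : ℂ)⁻¹ + C.v (j + 1) k * C.u j k
        - (C.v (j + 1) k * C.u j k : ℂ)⁻¹ := by exact_mod_cast e2
  rw [← h4, ← h2, hm', hcj]
  refine ⟨by rw [← h3]; ring, ?_, ?_, ?_⟩
  · rw [hm, hh', hh]
    simp only [Complex.ofReal_re, Complex.add_re, Complex.I_mul_re, Complex.ofReal_im, neg_zero,
      add_zero]
    linear_combination Complex.I * e2'
  · rw [hm, hh']
    simp only [Complex.ofReal_re]
    linear_combination (-Complex.I) * e1'
  · rw [hm, hh']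
    simp only [Complex.ofReal_re]
    linear_combination (Complex.I) * e1'

theorem Cond2.kInvariant1 (h : C.Cond2) : KInvariant1 S T C.L := by
  intro t j k he he'
  have hF : IsFace S T j k := ⟨he.1, he.2.1, he.2.2, he'.2.2⟩
  obtain ⟨h1, h2, h3, h4, h5, -, -⟩ := h j k hF
  rw [L, L, ← h2, ← h4, C.α_opposite j k hF t]

/-! ### Rotation in the first direction -/

/-- The scalar argument is that of the second case with u and v exchanged, the real datum 𝔥 in place
of 𝔳, and -Im 𝔳 in place of Im 𝔥. -/
theorem Cond1.face (h : C.Cond1) (hc : C.Const1) {j k : ℤ} (hF : IsFace S T j k) :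
    (C.𝔳 j (k + 1)).re = (C.𝔳 j k).re ∧
    (C.𝔥 j k).re * (C.u j k - C.u j (k + 1)) =
      -(C.v j k * ((C.𝔳 j k).im + (C.𝔳 j (k + 1)).im)) ∧
    (C.𝔥 j k).re * ((C.𝔳 j k).im - (C.𝔳 j (k + 1)).im) =
      C.v j k * C.u j k - (C.v j k * C.u j k)⁻¹ + C.u j (k + 1) * C.v j k
        - (C.u j (k + 1) * C.v j k)⁻¹ := by
  obtain ⟨h1, h2, h3, h4, h5, h6, h7⟩ := h j k hF
  have e1 : IsEdge1 S T j k := ⟨hF.1, hF.2.1, hF.2.2.1⟩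
  have e1' : IsEdge1 S T j (k + 1) := ⟨hF.1, hF.2.1, hF.2.2.2⟩
  have hre : (C.𝔳 j (k + 1)).re = (C.𝔳 j k).re := by
    obtain ⟨c, hc⟩ := hc.2
    rw [hc _ _ e1, hc _ _ e1']
  have key := face_equations (y := -(C.𝔳 j k).im) (y' := -(C.𝔳 j (k + 1)).im)
    (m := (C.𝔥 j k).re) (C.v_ne_zero j k ⟨hF.1, hF.2.2⟩)
    (C.u_ne_zero j k e1) (C.u_ne_zero j (k + 1) e1') h3
    (by rw [neg_sq, neg_sq]; exact α_inv_sq_eq hF hre) ?_ ?_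
  · obtain ⟨k1, k2⟩ := key
    exact ⟨hre, by linarith, by linarith⟩
  · intro hne
    have h8 := h6 hne
    have hne' : (C.u j k : ℂ) - C.u j (k + 1) ≠ 0 := by
      rw [sub_ne_zero]
      exact_mod_cast hne
    rw [eq_div_iff (mul_ne_zero Complex.I_ne_zero hne')] at h8
    have h9 := congrArg Complex.im h8
    simp [hre, h5] at h9
    linarith
  · intro heq
    obtain ⟨h8, h9, h10⟩ := h7 heq
    have him : (C.𝔳 j (k + 1)).im = -(C.𝔳 j k).im := by
      have := congrArg Complex.im h9
      simp at this
      linarith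
    rw [eq_div_iff (sub_ne_zero.2 h10)] at h8
    have h11 := congrArg Complex.im h8
    simp [hre, h5, ← Complex.ofReal_mul, ← Complex.ofReal_inv] at h11
    refine ⟨?_, by rw [him]⟩
    linarith

theorem Cond1.compatible (h : C.Cond1) (hc : C.Const1) : C.Compatible := by
  intro j k hF
  obtain ⟨h1, h2, h3, h4, h5, -, -⟩ := h j k hF
  obtain ⟨hre, e1, e2⟩ := h.face hc hF
  have hm : C.𝔥 j k = ((C.𝔥 j k).re : ℂ) := by
    apply Complex.ext <;> simp [h5]
  have hm' : conj (C.𝔥 j k) = ((C.𝔥 j k).re : ℂ) := by rw [hm]; simp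
  have hh : C.𝔳 j k = ((C.𝔳 j k).re : ℂ) + Complex.I * (C.𝔳 j k).im := by
    rw [mul_comm, Complex.re_add_im]
  have hh' : C.𝔳 j (k + 1) = ((C.𝔳 j k).re : ℂ) + Complex.I * (C.𝔳 j (k + 1)).im := by
    rw [mul_comm, ← hre, Complex.re_add_im]
  have hcj : conj (C.𝔳 j k) = ((C.𝔳 j k).re : ℂ) - Complex.I * (C.𝔳 j k).im := by
    apply Complex.ext <;> simp
  have e1' : ((C.𝔥 j k).re : ℂ) * (C.u j k - C.u j (k + 1)) =
      -(C.v j k * ((C.𝔳 j k).im + (C.𝔳 j (k + 1)).im)) := by exact_mod_cast e1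
  have e2' : ((C.𝔥 j k).re : ℂ) * ((C.𝔳 j k).im - (C.𝔳 j (k + 1)).im) =
      C.v j k * C.u j k - (C.v j k * C.u j k : ℂ)⁻¹ + C.u j (k + 1) * C.v j k
        - (C.u j (k + 1) * C.v j k : ℂ)⁻¹ := by exact_mod_cast e2
  rw [← h4, ← h2, hm', hcj]
  refine ⟨by rw [← h3]; ring, ?_, ?_, ?_⟩
  · rw [hm, hh', hh]
    simp only [Complex.ofReal_re, Complex.add_re, Complex.I_mul_re, Complex.ofReal_im, neg_zero,
      add_zero]
    linear_combination Complex.I * e2'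
  · rw [hm, hh']
    simp only [Complex.ofReal_re]
    linear_combination e1' - (C.v j k * ((C.𝔳 j k).im + (C.𝔳 j (k + 1)).im) : ℂ) * Complex.I_sq
  · rw [hm, hh']
    simp only [Complex.ofReal_re]
    linear_combination e1' - (C.v j k * ((C.𝔳 j k).im + (C.𝔳 j (k + 1)).im) : ℂ) * Complex.I_sq

theorem Cond1.jInvariant2 (h : C.Cond1) : JInvariant2 S T C.M := by
  intro t j k he he'
  have hF : IsFace S T j k := ⟨he.1, he'.1, he.2⟩
  obtain ⟨h1, h2, h3, h4, h5, -, -⟩ := h j k hF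
  rw [M, M, ← h2, ← h4, C.β_opposite j k hF t]

end CMCConnection

/-! ### Transport of profile frames along the profile and along the rotation. -/

theorem inv_sin_sq_sub_cot_sq {φ : ℝ} (h : Real.sin φ ≠ 0) :
    (1 / Real.sin φ) ^ 2 - Real.cot φ ^ 2 = 1 := by
  rw [Real.cot_eq_cos_div_sin]
  have := Real.sin_sq_add_cos_sq φ
  field_simp
  linarith

/-- Transport of the profile frame, in the case of a gauge `e` that is constant up to scaling. -/
theorem profileFrame_step {A : Mat2} {e e' : ℂ} {p q p' q' m g c : ℝ} (h' : p' ^ 2 + q' ^ 2 = 1)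
    (hX : m * (p * q' - q * p') + g * (q * q' + p * p') = 0)
    (h00 : A 0 0 * e = c * m * e') (h01 : A 0 1 * conj e = -(c * g * e'))
    (h10 : A 1 0 * e = c * g * conj e') (h11 : A 1 1 * conj e = c * m * conj e') :
    A * profileFrame e p q =
      ((c * ((m * p + g * q) * p' + (m * q - g * p) * q') : ℝ) : ℂ) • profileFrame e' p' q' := by
  -- `hX` says that the transported row (m p + g q, m q - g p) is parallel to (p', q'); the factor
  -- of proportionality is their inner product.
  have hX' : (m : ℂ) * (p * q' - q * p') + g * (q * q' + p * p') = 0 := by exact_mod_cast hX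
  have hh' : (p' : ℂ) ^ 2 + q' ^ 2 = 1 := by exact_mod_cast h'
  ext i j
  fin_cases i <;> fin_cases j <;>
    simp only [profileFrame, Matrix.mul_apply, Fin.sum_univ_two, Matrix.smul_apply, smul_eq_mul]
  · simp
    linear_combination p * h00 - q * h01 + c * e' * q' * hX' - c * e' * (m * p + g * q) * hh'
  · simp
    linear_combination q * h00 + p * h01 - c * e' * p' * hX' - c * e' * (m * q - g * p) * hh'
  · simp
    linear_combination p * h10 - q * h11 + c * conj e' * p' * hX'
      + c * conj e' * (m * q - g * p) * hh'
  · simp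
    linear_combination q * h10 + p * h11 + c * conj e' * q' * hX'
      - c * conj e' * (m * p + g * q) * hh'

/-- The rotation about the third axis in a profile frame. -/
theorem mul_profileFrame_eq {A : Mat2} {e : ℂ} {p q a b φ : ℝ} (h : p ^ 2 + q ^ 2 = 1)
    (ha : a = 2 * p * q) (hb : b = p ^ 2 - q ^ 2)
    (h00 : A 0 0 = Real.cos φ + Complex.I * (Real.sin φ * b))
    (h01 : A 0 1 * conj e = -(Complex.I * (Real.sin φ * a) * e))
    (h10 : A 1 0 * e = -(Complex.I * (Real.sin φ * a) * conj e))
    (h11 : A 1 1 = Real.cos φ - Complex.I * (Real.sin φ * b)) :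
    A * profileFrame e p q = profileFrame e p q * rotZ φ := by
  have hh : (p : ℂ) ^ 2 + q ^ 2 = 1 := by exact_mod_cast h
  subst ha hb
  generalize hc : Real.cos φ = c at *
  generalize hs : Real.sin φ = s at *
  ext i j
  fin_cases i <;> fin_cases j <;>
    simp only [profileFrame, rotZ, Matrix.mul_apply, Fin.sum_univ_two, hc, hs]
  · simp [h00]
    push_cast at h01
    linear_combination (-(q : ℂ)) * h01 + Complex.I * s * e * p * hh
  · simp [h00]
    push_cast at h01
    linear_combination (p : ℂ) * h01 - Complex.I * s * e * q * hh
  · simp [h11]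
    push_cast at h10
    linear_combination (p : ℂ) * h10 - Complex.I * s * conj e * q * hh
  · simp [h11]
    push_cast at h10
    linear_combination (q : ℂ) * h10 - Complex.I * s * conj e * p * hh

/-! ### Profile and frames for K = 1 and rotation in the second direction. -/

namespace CMCConnection

variable {S T : Set ℤ} {C : CMCConnection S T}

/-- The data on the edges of the second kind in terms of the profile of a net of revolution. -/
structure Profile2 (C : CMCConnection S T) (θ r : ℝ) (f a b : ℤ → ℝ) : Prop where
  β_eq : ∀ j k, IsEdge2 S T j k → C.β j k 0 = r / Real.sin (θ / 2)
  re_eq : ∀ j k, IsEdge2 S T j k → (C.𝔥 j k).re = r * Real.cot (θ / 2)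
  im_eq : ∀ j k, IsEdge2 S T j k → (C.𝔥 j k).im = r * b j
  sub_eq : ∀ j k, IsEdge2 S T j k → C.v j k - (C.v j k)⁻¹ = r * a j
  add_eq : ∀ j k, IsEdge2 S T j k → C.v j k + (C.v j k)⁻¹ = r * f j

/-- At t = 0 the formula reads β² = |𝔥|² + (v - 1/v)². Divided by r² it is 1/sin² = cot² + b² + a².
-/
theorem Profile2.unit {θ r : ℝ} {f a b : ℤ → ℝ} (hp : C.Profile2 θ r f a b) (hθ : IsAngle θ)
    (hr : r ≠ 0) {j k : ℤ} (he : IsEdge2 S T j k) : a j ^ 2 + b j ^ 2 = 1 := by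
  have h1 := C.β_sq_real he 0
  have hv := mul_inv_cancel₀ (C.v_ne_zero j k he)
  rw [hp.β_eq j k he, hp.re_eq j k he, hp.im_eq j k he, mul_zero, Real.cos_zero] at h1
  have h2 := inv_sin_sq_sub_cot_sq hθ.half.1
  have h3 := hp.sub_eq j k he
  apply mul_left_cancel₀ (pow_ne_zero 2 hr)
  rw [div_eq_mul_one_div] at h1
  linear_combination -h1 + r ^ 2 * h2 + (-(C.v j k - (C.v j k)⁻¹) - r * a j) * h3 - 2 * hv

/-- This is (v + 1/v)² - (v - 1/v)² = 4. -/
theorem Profile2.integral {θ r : ℝ} {f a b : ℤ → ℝ} (hp : C.Profile2 θ r f a b)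
    {j k : ℤ} (he : IsEdge2 S T j k) : r ^ 2 * (f j ^ 2 - a j ^ 2) = 4 := by
  have hv := mul_inv_cancel₀ (C.v_ne_zero j k he)
  have h3 := hp.sub_eq j k he
  have h4 := hp.add_eq j k he
  have : r ^ 2 * (f j ^ 2 - a j ^ 2) = (r * f j) ^ 2 - (r * a j) ^ 2 := by ring
  rw [this, ← h3, ← h4]
  linear_combination 4 * hv

/-- The relations of the profile along a face. -/
theorem Profile2.face {θ r : ℝ} {f a b : ℤ → ℝ} (hp : C.Profile2 θ r f a b) (hr : r ≠ 0)
    (h : C.Cond2) (hc : C.Const2) {j k : ℤ} (hF : IsFace S T j k) :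
    (C.𝔳 j k).re * (a (j + 1) - a j) = -((C.u j k + (C.u j k)⁻¹) * (b (j + 1) + b j)) ∧
    (C.𝔳 j k).re * (b (j + 1) - b j) = (C.u j k + (C.u j k)⁻¹) * (a (j + 1) + a j) ∧
    (C.u j k - (C.u j k)⁻¹) * (f (j + 1) + f j) = (C.u j k + (C.u j k)⁻¹) * (a (j + 1) + a j) ∧
    (C.u j k - (C.u j k)⁻¹) * (a (j + 1) - a j) = (C.u j k + (C.u j k)⁻¹) * (f (j + 1) - f j) ∧
    0 < f (j + 1) * f j := by
  obtain ⟨h1, h2, h3, h4, h5, -, -⟩ := h j k hF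
  obtain ⟨-, e1, e2⟩ := h.face hc hF
  have he : IsEdge2 S T j k := ⟨hF.1, hF.2.2⟩
  have he' : IsEdge2 S T (j + 1) k := ⟨hF.2.1, hF.2.2⟩
  have hu0 := C.u_ne_zero j k ⟨hF.1, hF.2.1, hF.2.2.1⟩
  have hv0 := C.v_ne_zero j k he
  have hv0' := C.v_ne_zero (j + 1) k he'
  have s1 := hp.sub_eq j k he
  have s2 := hp.sub_eq (j + 1) k he'
  have a1 := hp.add_eq j k he
  have a2 := hp.add_eq (j + 1) k he'
  rw [hp.im_eq j k he, hp.im_eq (j + 1) k he'] at e1 e2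
  set u := C.u j k
  set v := C.v j k
  set v' := C.v (j + 1) k
  -- With w = (v v')⁻¹ = u⁻² all inverses become polynomial, and each relation is a linear
  -- consequence of the face equations and the dictionary.
  have i0 : u⁻¹ = u * (v * v')⁻¹ := by rw [← h3]; field_simp
  have i1 : v'⁻¹ = (v * v')⁻¹ * v := by field_simp
  have i2 : v⁻¹ = (v * v')⁻¹ * v' := by field_simp
  rw [mul_inv, mul_inv, i0, i1, i2] at e2
  rw [i1] at s2 a2
  rw [i2] at s1 a1
  have hw : v * v' * (v * v')⁻¹ = 1 := mul_inv_cancel₀ (mul_ne_zero hv0 hv0')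
  rw [i0]
  have hpos : 0 < v' * v := by
    have : 0 < u ^ 2 := by positivity
    rw [h3] at this
    linarith
  generalize (v * v')⁻¹ = w at *
  refine ⟨?_, ?_, ?_, ?_, ?_⟩
  · apply mul_left_cancel₀ hr
    linear_combination (-(1 + w)) * e1 + (C.𝔳 j k).re * (s1 - s2)
  · apply mul_left_cancel₀ hr
    linear_combination e2 + (u + u * w) * (s1 + s2)
  · apply mul_left_cancel₀ hr
    linear_combination (u + u * w) * (s1 + s2) - (u - u * w) * (a1 + a2)
  · apply mul_left_cancel₀ hr
    linear_combination (u + u * w) * (a2 - a1) - (u - u * w) * (s2 - s1)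
  -- Expansion of (v + 1/v)(v' + 1/v'). Since v v' = u² > 0 and v ≠ -v', the sign of f is preserved
  -- without any further assumption.
  · have h6 : r ^ 2 * (f (j + 1) * f j) = (v + v') ^ 2 * w + (v' * v) * (1 - w) ^ 2 := by
      linear_combination (-(r * f j)) * a2 - (v' + w * v) * a1
    have hw' : 0 < w := by
      have : 0 < v * v' * w := by rw [hw]; exact one_pos
      exact pos_of_mul_pos_right this (by linarith)
    have h7 : 0 < r ^ 2 * (f (j + 1) * f j) := by
      have : v + v' ≠ 0 := fun h0 => h1 (by linarith)
      rw [h6]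
      positivity
    exact pos_of_mul_pos_right h7 (by positivity)

end CMCConnection

namespace CMCConnection

variable {S T : Set ℤ} {C : CMCConnection S T}

theorem Profile2.const2 {θ r : ℝ} {f a b : ℤ → ℝ} (hp : C.Profile2 θ r f a b) : C.Const2 :=
  ⟨⟨_, hp.β_eq⟩, ⟨_, hp.re_eq⟩⟩

/-- The ratio l comes from the relations between f and a, and u ≠ ±1 keeps it finite. If δa and δb
both vanished, the other two relations would give σa = σb = 0, against a² + b² = 1. -/
theorem Profile2.profileStep {θ r : ℝ} {f h a b : ℤ → ℝ} (hp : C.Profile2 θ r f a b)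
    (hθ : IsAngle θ) (hr : r ≠ 0) (hC : C.Cond2) {j k : ℤ} (hF : IsFace S T j k)
    (hu : C.u j k ≠ 1 ∧ C.u j k ≠ -1)
    (hh : b (j + 1) - b j =
      (C.u j k + (C.u j k)⁻¹) / (C.u j k - (C.u j k)⁻¹) * (h (j + 1) - h j)) :
    ProfileStep 1 f h a b j ((C.u j k + (C.u j k)⁻¹) / (C.u j k - (C.u j k)⁻¹)) := by
  obtain ⟨e1, e2, e3, e4, -⟩ := hp.face hr hC hp.const2 hF
  have hu0 := C.u_ne_zero j k ⟨hF.1, hF.2.1, hF.2.2.1⟩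
  have hg : C.u j k + (C.u j k)⁻¹ ≠ 0 := by
    have : C.u j k * (C.u j k + (C.u j k)⁻¹) = C.u j k ^ 2 + 1 := by field_simp
    intro h0
    rw [h0] at this
    nlinarith [sq_nonneg (C.u j k)]
  have hd : C.u j k - (C.u j k)⁻¹ ≠ 0 := by
    have : C.u j k * (C.u j k - (C.u j k)⁻¹) = (C.u j k - 1) * (C.u j k + 1) := by
      field_simp
      ring
    intro h0
    rw [h0, mul_zero] at this
    rcases mul_eq_zero.1 this.symm with h' | h'
    · exact hu.1 (by linarith)
    · exact hu.2 (by linarith)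
  refine ⟨div_ne_zero hg hd, ?_, hh, ?_, ?_⟩
  · rw [div_mul_eq_mul_div, eq_div_iff hd]
    linear_combination e4
  · rw [div_mul_eq_mul_div, div_eq_iff hd]
    linear_combination -e3
  · by_contra! h0
    rw [h0.1, mul_zero] at e1
    rw [h0.2, mul_zero] at e2
    have hb : b (j + 1) + b j = 0 := by
      simpa [hg] using e1
    have ha : a (j + 1) + a j = 0 := by
      simpa [hg] using e2.symm
    have := hp.unit hθ hr (j := j) (k := k) ⟨hF.1, hF.2.2⟩
    have ha0 : a j = 0 := by linarith [h0.1]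
    have hb0 : b j = 0 := by linarith [h0.2]
    rw [ha0, hb0] at this
    norm_num at this

/-- An edge on the far boundary is not the labelling edge of a face, but it shares its data with the
opposite edge, which is. -/
theorem Cond2.exists_face (hC : C.Cond2) (hT : T.OrdConnected) (hT' : T.Nontrivial) {j k : ℤ}
    (he : IsEdge1 S T j k) :
    ∃ i, IsFace S T j i ∧ C.u j k = C.u j i ∧ C.𝔳 j k = C.𝔳 j i := by
  obtain ⟨i, hi, hi', h⟩ := mem_step hT hT' he.2.2
  have hF : IsFace S T j i := ⟨he.1, he.2.1, hi, hi'⟩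
  obtain ⟨-, h2, -, h4, -⟩ := hC j i hF
  rcases h with rfl | rfl
  · exact ⟨k, hF, rfl, rfl⟩
  · exact ⟨i, hF, h2.symm, h4.symm⟩

/-- The Sym formula yields the net of revolution with the given profile. -/
theorem Profile2.rigidlyEquivalent (hS : S.OrdConnected) (hS' : S.Nontrivial)
    (hT : T.OrdConnected) (hT' : T.Nontrivial) {θ r : ℝ} {f h a b : ℤ → ℝ}
    (hp : C.Profile2 θ r f a b) (hθ : IsAngle θ) (hr : r ≠ 0) (hC : C.Cond2)
    (hstep : ∀ j ∈ S, j + 1 ∈ S → ∃ l, ProfileStep 1 f h a b j l)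
    {Φ : ℝ → ℤ → ℤ → Mat2} (hΦ : IsParallelFrameFamily S T C.L C.M Φ) :
    RigidlyEquivalent S T (revolve θ f h) (revolve θ a b) (symPoint (-2) 0 Φ 0)
      (symNormal Φ 0) := by
  obtain ⟨hs, -⟩ := hθ.half
  obtain ⟨k₀, hk₀, hk₀'⟩ := exists_step hT hT'
  have hpq : ∀ j, ∃ p q : ℝ, j ∈ S → p ^ 2 + q ^ 2 = 1 ∧ a j = 2 * p * q ∧ b j = p ^ 2 - q ^ 2 := by
    intro j
    by_cases hj : j ∈ S
    · obtain ⟨p, q, h⟩ := exists_half_angle (hp.unit hθ hr (j := j) (k := k₀) ⟨hj, hk₀, hk₀'⟩)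
      exact ⟨p, q, fun _ => h⟩
    · exact ⟨0, 0, fun h => absurd h hj⟩
  choose p q hpq using hpq
  refine rigidlyEquivalent_revolve hS hS'.nonempty hT hT'.nonempty hΦ (by norm_num)
    (P := fun j => profileFrame 1 (p j) (q j)) ?_ ?_ ?_
  · intro j hj
    obtain ⟨h1, h2, h3⟩ := hpq j hj
    exact ⟨isQuat_profileFrame _ _ _, profileFrame_ne_zero one_ne_zero h1,
      profileFrame_mul_imH 1 h1 h2 h3⟩
  · intro j k he
    refine ⟨(C.isUnitFamily_L he).det_eq 0, ?_⟩
    obtain ⟨c', hL⟩ := C.hasMatDeriv_L he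
    obtain ⟨l, hl⟩ := hstep j he.1 he.2.1
    obtain ⟨i, hF, hui, hmi⟩ := hC.exists_face hT hT' he
    obtain ⟨-, -, -, -, h5, -⟩ := hC j i hF
    obtain ⟨e1, e2, e3, e4, e5⟩ := hp.face hr hC hp.const2 hF
    rw [← hmi, ← hui] at e1 e2
    rw [← hui] at e3 e4
    rw [← hmi] at h5
    have hm : C.𝔳 j k = ((C.𝔳 j k).re : ℂ) := by
      apply Complex.ext <;> simp [h5]
    obtain ⟨p1, p2, p3⟩ := hpq j he.1
    obtain ⟨p1', p2', p3'⟩ := hpq (j + 1) he.2.1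
    have hX := half_angle_step p1 p2 p3 p1' p2' p3' e1 e2
    refine ⟨l, _, c', _, hl.ne_zero, hl.diff_a, hl.diff_b,
      profileFrame_step (c := 1 / C.α j k 0) p1' hX ?_ ?_ ?_ ?_, hL, ?_⟩
    · rw [L_zero, hm]
      simp
    · rw [L_zero]
      simp
      ring
    · rw [L_zero]
      simp
    · rw [L_zero, hm]
      simp
    -- Only the existence of some l is given. As σa ≠ 0, comparing `sum_a` with the face relation
    -- identifies it.
    · have hlg : l * (C.u j k - (C.u j k)⁻¹) = C.u j k + (C.u j k)⁻¹ := by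
        have hσ : a (j + 1) + a j ≠ 0 := by
          intro h0
          have h1 := hl.sum_a
          rw [h0, mul_zero, one_mul] at h1
          have h2 : f (j + 1) = -f j := by linarith
          rw [h2] at e5
          nlinarith [sq_nonneg (f j)]
        apply mul_right_cancel₀ hσ
        linear_combination e3 + (C.u j k - (C.u j k)⁻¹) * hl.sum_a
      have hlg' : (l : ℂ) * (C.u j k - (C.u j k : ℂ)⁻¹) = C.u j k + (C.u j k : ℂ)⁻¹ := by
        exact_mod_cast hlg
      rw [L_zero]
      ext m n
      fin_cases m <;> fin_cases n <;>
        simp [pauli3]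
      · linear_combination (2 * Complex.I * (C.α j k 0 : ℂ)⁻¹) * hlg'
      · linear_combination (2 * Complex.I * (C.α j k 0 : ℂ)⁻¹) * hlg'
  · intro j k he
    refine ⟨(C.isUnitFamily_M he).det_eq 0, ?_⟩
    obtain ⟨c', hM⟩ := C.hasMatDeriv_M he
    obtain ⟨p1, p2, p3⟩ := hpq j he.1
    have hs' : (Real.sin (θ / 2) : ℂ) ≠ 0 := by exact_mod_cast hs
    have hr' : (r : ℂ) ≠ 0 := by exact_mod_cast hr
    have hh : C.𝔥 j k = r * (Real.cos (θ / 2) / Real.sin (θ / 2) + Complex.I * b j) := by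
      rw [← Complex.re_add_im (C.𝔥 j k), hp.re_eq j k he, hp.im_eq j k he,
        Real.cot_eq_cos_div_sin]
      push_cast
      ring
    have hsub : (C.v j k : ℂ) - (C.v j k : ℂ)⁻¹ = r * a j := by exact_mod_cast hp.sub_eq j k he
    have hadd : (C.v j k : ℂ) + (C.v j k : ℂ)⁻¹ = r * f j := by exact_mod_cast hp.add_eq j k he
    refine ⟨c', _, mul_profileFrame_eq p1 p2 p3 ?_ ?_ ?_ ?_, hM, ?_⟩
    · rw [M_zero, hp.β_eq j k he, hh]
      simp [-Complex.ofReal_cos, -Complex.ofReal_sin]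
      field_simp
    · rw [M_zero, hp.β_eq j k he, hsub]
      simp [-Complex.ofReal_cos, -Complex.ofReal_sin]
      field_simp
    · rw [M_zero, hp.β_eq j k he, hsub]
      simp [-Complex.ofReal_cos, -Complex.ofReal_sin]
      field_simp
    · rw [M_zero, hp.β_eq j k he, hh]
      simp [-Complex.ofReal_cos, -Complex.ofReal_sin]
      field_simp
      ring
    · rw [hp.β_eq j k he, hadd]
      ext m n
      fin_cases m <;> fin_cases n <;>
        simp [profileFrame, pauli2, -Complex.ofReal_cos, -Complex.ofReal_sin] <;>
        field_simp <;> simp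

end CMCConnection

/-! ### Recovering the data from invariant transports, and the net for κ > 1. -/

theorem ordConnected_steps {T : Set ℤ} (hT : T.OrdConnected) :
    {k | k ∈ T ∧ k + 1 ∈ T}.OrdConnected := by
  refine ⟨fun a ha b hb c hc => ⟨hT.out ha.1 hb.1 hc, hT.out ha.2 hb.2 ?_⟩⟩
  exact ⟨by linarith [hc.1], by linarith [hc.2]⟩

theorem IsAngle.cot_ne_zero {θ : ℝ} (hθ : IsAngle θ) : Real.cot (θ / 2) ≠ 0 := by
  rw [Real.cot_eq_cos_div_sin]
  exact div_ne_zero hθ.half.2.ne' hθ.half.1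

theorem exp_I_mul_pi_div_two : Complex.exp (Complex.I * ((Real.pi / 2 : ℝ) : ℂ)) = Complex.I := by
  push_cast
  rw [mul_comm]
  exact Complex.exp_pi_div_two_mul_I

theorem exp_neg_I_mul_pi_div_two :
    Complex.exp (-(Complex.I * ((Real.pi / 2 : ℝ) : ℂ))) = -Complex.I := by
  rw [Complex.exp_neg, exp_I_mul_pi_div_two, Complex.inv_I]

theorem eq_of_sub_inv_eq_of_add_inv_eq {x y : ℝ} (h1 : x - x⁻¹ = y - y⁻¹)
    (h2 : x + x⁻¹ = y + y⁻¹) : x = y := by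
  linarith

namespace CMCConnection

variable {S T : Set ℤ} {C : CMCConnection S T}

/-- At t = 0 the factors β agree, so the entries give 𝔥 and v - 1/v. At t = π/2, where e^{it} = i,
the nonzero diagonal entry shows that β agrees again, and the off-diagonal entry gives v + 1/v. -/
theorem eq_of_M_eq {j k j' k' : ℤ} (he : IsEdge2 S T j k)
    (h0 : C.β j k 0 = C.β j' k' 0) (hre : (C.𝔥 j k).re ≠ 0)
    (hM : ∀ t, C.M t j k = C.M t j' k') : C.v j k = C.v j' k' ∧ C.𝔥 j k = C.𝔥 j' k' := by
  have hβ : ∀ t, (1 / C.β j k t : ℂ) ≠ 0 := fun t =>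
    one_div_ne_zero (by exact_mod_cast C.β_ne_zero j k he t)
  have a00 := congrFun (congrFun (hM 0) 0) 0
  have a10 := congrFun (congrFun (hM 0) 1) 0
  have b00 := congrFun (congrFun (hM (Real.pi / 2)) 0) 0
  have b10 := congrFun (congrFun (hM (Real.pi / 2)) 1) 0
  rw [M_zero, M_zero, ← h0] at a00 a10
  rw [M, M, exp_I_mul_pi_div_two, exp_neg_I_mul_pi_div_two] at b00 b10
  simp only [Matrix.smul_apply, smul_eq_mul, Matrix.of_apply, Matrix.cons_val', Matrix.cons_val_zero,
    Matrix.cons_val_one, Matrix.cons_val_fin_one] at a00 a10 b00 b10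
  have e1 := mul_left_cancel₀ (hβ 0) a00
  have e2 := mul_left_cancel₀ (hβ 0) a10
  rw [← e1] at b00
  have hne : C.𝔥 j k ≠ 0 := fun h => hre (by rw [h]; rfl)
  rw [← mul_right_cancel₀ hne b00] at b10
  have e3 := mul_left_cancel₀ (hβ _) b10
  rw [neg_inj, mul_right_inj' Complex.I_ne_zero] at e2
  refine ⟨eq_of_sub_inv_eq_of_add_inv_eq (by exact_mod_cast e2) ?_, e1⟩
  have e4 : (C.v j k : ℂ) + (C.v j k : ℂ)⁻¹ = C.v j' k' + (C.v j' k' : ℂ)⁻¹ := by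
    linear_combination -e3 + ((C.v j k : ℂ) + (C.v j k : ℂ)⁻¹ - C.v j' k' - (C.v j' k' : ℂ)⁻¹)
      * Complex.I_sq
  exact_mod_cast e4

theorem eq_of_L_eq {j k j' k' : ℤ} (he : IsEdge1 S T j k)
    (h0 : C.α j k 0 = C.α j' k' 0) (hre : (C.𝔳 j k).re ≠ 0)
    (hL : ∀ t, C.L t j k = C.L t j' k') : C.u j k = C.u j' k' ∧ C.𝔳 j k = C.𝔳 j' k' := by
  have hα : ∀ t, (1 / C.α j k t : ℂ) ≠ 0 := fun t =>
    one_div_ne_zero (by exact_mod_cast C.α_ne_zero j k he t)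
  have a00 := congrFun (congrFun (hL 0) 0) 0
  have a10 := congrFun (congrFun (hL 0) 1) 0
  have b00 := congrFun (congrFun (hL (Real.pi / 2)) 0) 0
  have b10 := congrFun (congrFun (hL (Real.pi / 2)) 1) 0
  rw [L_zero, L_zero, ← h0] at a00 a10
  rw [L, L, exp_I_mul_pi_div_two, exp_neg_I_mul_pi_div_two] at b00 b10
  simp only [Matrix.smul_apply, smul_eq_mul, Matrix.of_apply, Matrix.cons_val', Matrix.cons_val_zero,
    Matrix.cons_val_one, Matrix.cons_val_fin_one] at a00 a10 b00 b10
  have e1 := mul_left_cancel₀ (hα 0) a00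
  have e2 := mul_left_cancel₀ (hα 0) a10
  rw [← e1] at b00
  have hne : C.𝔳 j k ≠ 0 := fun h => hre (by rw [h]; rfl)
  rw [← mul_right_cancel₀ hne b00] at b10
  have e3 := mul_left_cancel₀ (hα _) b10
  have e4 : (C.u j k : ℂ) - (C.u j k : ℂ)⁻¹ = C.u j' k' - (C.u j' k' : ℂ)⁻¹ := by
    linear_combination Complex.I * e3 + ((C.u j k : ℂ) - (C.u j k : ℂ)⁻¹ - C.u j' k'
      + (C.u j' k' : ℂ)⁻¹) * Complex.I_sq
  exact ⟨eq_of_sub_inv_eq_of_add_inv_eq (by exact_mod_cast e4) (by exact_mod_cast e2), e1⟩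

theorem Cond2.isRCNet (hS : S.OrdConnected) (hS' : S.Nontrivial) (hT : T.OrdConnected)
    (hT' : T.Nontrivial) (hC : C.Cond2) (hc : C.Const2) {θ κ : ℝ} (hK : KInvariant2 S T C.M)
    (hθ : IsAngle θ) (hκ : 1 < κ) (hN : C.Norm2 θ κ) {Φ : ℝ → ℤ → ℤ → Mat2}
    (hΦ : IsParallelFrameFamily S T C.L C.M Φ) :
    ∃ f h a b : ℤ → ℝ,
      IsRCNet S T (symPoint (-2) 0 Φ 0) (symNormal Φ 0) θ f h a b ∧
      HasConstGaussCurvature S T (symPoint (-2) 0 Φ 0) (symNormal Φ 0) 1 ∧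
      PosIntegral S f a b κ := by
  obtain ⟨hN1, hN2, -⟩ := hN
  obtain ⟨k₀, hk₀, hk₀'⟩ := exists_step hT hT'
  have hκ2 : 0 < κ ^ 2 - 1 := by nlinarith
  have hsq : Real.sqrt (κ ^ 2 - 1) ^ 2 = κ ^ 2 - 1 := Real.sq_sqrt hκ2.le
  have hsq0 : 0 < Real.sqrt (κ ^ 2 - 1) := Real.sqrt_pos.2 hκ2
  set r := 2 / Real.sqrt (κ ^ 2 - 1) with hrdef
  have hr : r ≠ 0 := by positivity
  have hr2 : r ^ 2 * (κ ^ 2 - 1) = 4 := by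
    rw [hrdef, div_pow, hsq]
    field_simp
    norm_num
  -- Invariance is assumed for the matrices only. It passes to v and 𝔥 because Re 𝔥 is a nonzero
  -- multiple of cot(θ/2), which does not vanish for |θ| < π.
  have hinv : ∀ j k, IsEdge2 S T j k → C.v j k = C.v j k₀ ∧ C.𝔥 j k = C.𝔥 j k₀ := by
    intro j k he
    refine ordConnected_int_induction (ordConnected_steps hT)
      (p := fun k => C.v j k = C.v j k₀ ∧ C.𝔥 j k = C.𝔥 j k₀) ⟨hk₀, hk₀'⟩ ⟨rfl, rfl⟩ ?_ k he.2
    intro i hi hi'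
    have e1 : IsEdge2 S T j i := ⟨he.1, hi⟩
    have e2 : IsEdge2 S T j (i + 1) := ⟨he.1, hi'⟩
    obtain ⟨h1, h2⟩ := eq_of_M_eq e1 (by rw [(hN1 j i e1).1, (hN1 j _ e2).1])
      (by
        rw [(hN1 j i e1).2]
        have := hθ.cot_ne_zero
        positivity) (fun t => hK t j i e1 e2)
    rw [h1, h2]
  have hp : C.Profile2 θ r (fun j => (C.v j k₀ + (C.v j k₀)⁻¹) / r)
      (fun j => (C.v j k₀ - (C.v j k₀)⁻¹) / r) (fun j => (C.𝔥 j k₀).im / r) := by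
    refine ⟨?_, ?_, ?_, ?_, ?_⟩ <;> intro j k he
    · rw [(hN1 j k he).1, hrdef, div_div]
    · rw [(hN1 j k he).2, hrdef]
      ring
    · rw [(hinv j k he).2]
      field_simp
    · rw [(hinv j k he).1]
      field_simp
    · rw [(hinv j k he).1]
      field_simp
  set f : ℤ → ℝ := fun j => (C.v j k₀ + (C.v j k₀)⁻¹) / r
  set a : ℤ → ℝ := fun j => (C.v j k₀ - (C.v j k₀)⁻¹) / r
  set b : ℤ → ℝ := fun j => (C.𝔥 j k₀).im / r
  -- The connection fixes h only up to a translation, through δh = δb / l.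
  obtain ⟨h, hh⟩ := exists_antidifference fun j =>
    (b (j + 1) - b j) / ((C.u j k₀ + (C.u j k₀)⁻¹) / (C.u j k₀ - (C.u j k₀)⁻¹))
  have he : ∀ {j}, j ∈ S → IsEdge2 S T j k₀ := fun hj => ⟨hj, hk₀, hk₀'⟩
  have hint : ∀ j ∈ S, r ^ 2 * (f j ^ 2 - a j ^ 2) = 4 := fun j hj => hp.integral (he hj)
  have hunit : ∀ j ∈ S, a j ^ 2 + b j ^ 2 = 1 := fun j hj => hp.unit hθ hr (he hj)
  have hstep : ∀ j ∈ S, j + 1 ∈ S → ∃ l, ProfileStep 1 f h a b j l := by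
    intro j hj hj'
    refine ⟨_, hp.profileStep hθ hr hC (k := k₀) ⟨hj, hj', hk₀, hk₀'⟩
      (hN2 j k₀ ⟨hj, hj', hk₀⟩) ?_⟩
    have hu := hN2 j k₀ ⟨hj, hj', hk₀⟩
    have hu0 := C.u_ne_zero j k₀ ⟨hj, hj', hk₀⟩
    have hl : (C.u j k₀ + (C.u j k₀)⁻¹) / (C.u j k₀ - (C.u j k₀)⁻¹) ≠ 0 := by
      have h1 : C.u j k₀ * (C.u j k₀ + (C.u j k₀)⁻¹) = C.u j k₀ ^ 2 + 1 := by field_simp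
      have h2 : C.u j k₀ * (C.u j k₀ - (C.u j k₀)⁻¹) = (C.u j k₀ - 1) * (C.u j k₀ + 1) := by
        field_simp
        ring
      apply div_ne_zero
      · apply right_ne_zero_of_mul (a := C.u j k₀)
        rw [h1]
        positivity
      · apply right_ne_zero_of_mul (a := C.u j k₀)
        rw [h2]
        exact mul_ne_zero (sub_ne_zero.2 hu.1) (fun h0 => hu.2 (by linarith))
    rw [hh, mul_div_cancel₀ _ hl]
  have hrig := hp.rigidlyEquivalent hS hS' hT hT' hθ hr hC hstep hΦ
  have hf0 : ∀ j ∈ S, f j ≠ 0 := by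
    intro j hj h0
    have := hint j hj
    rw [h0] at this
    nlinarith [sq_nonneg (r * a j)]
  obtain ⟨h1, h2⟩ := isRCNet_of_profile hθ one_ne_zero hf0 (fun j hj hj' =>
    sign_eq_of_mul_pos (hp.face hr hC hc (k := k₀) ⟨hj, hj', hk₀, hk₀'⟩).2.2.2.2) hunit hstep hrig
  refine ⟨f, h, a, b, h1, h2, fun j hj => ?_⟩
  have h3 : f j ^ 2 - a j ^ 2 = κ ^ 2 - 1 := by
    apply mul_left_cancel₀ (pow_ne_zero 2 hr)
    rw [hint j hj, hr2]
  exact ⟨h3, by linarith [hunit j hj]⟩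

end CMCConnection

/-! ### Construction of a connection from a profile for κ > 1. -/

theorem α_sq_complex {z : ℂ} {u A t : ℝ}
    (h : A ^ 2 = z.re ^ 2 + z.im ^ 2 + u ^ 2 + u⁻¹ ^ 2 + 2 * Real.cos (2 * t)) :
    (A : ℂ) ^ 2 = (‖z‖ : ℂ) ^ 2 + (u : ℂ) ^ 2 + ((u : ℂ)⁻¹) ^ 2
      + Complex.exp (2 * Complex.I * t) + Complex.exp (-(2 * Complex.I * t)) := by
  rw [add_assoc, exp_add_exp_neg]
  rw [pow_two z.re, pow_two z.im, ← Complex.normSq_apply, Complex.normSq_eq_norm_sq] at h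
  exact_mod_cast h

theorem β_sq_complex {z : ℂ} {u A t : ℝ}
    (h : A ^ 2 = z.re ^ 2 + z.im ^ 2 + u ^ 2 + u⁻¹ ^ 2 - 2 * Real.cos (2 * t)) :
    (A : ℂ) ^ 2 = (‖z‖ : ℂ) ^ 2 + (u : ℂ) ^ 2 + ((u : ℂ)⁻¹) ^ 2
      - Complex.exp (2 * Complex.I * t) - Complex.exp (-(2 * Complex.I * t)) := by
  rw [sub_sub, exp_add_exp_neg]
  rw [pow_two z.re, pow_two z.im, ← Complex.normSq_apply, Complex.normSq_eq_norm_sq] at h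
  exact_mod_cast h

theorem sign_mul_ne_zero {s x : ℝ} (hs : s ≠ 0) (hx : 0 < x) :
    (SignType.sign s : ℝ) * Real.sqrt x ≠ 0 := by
  have : (SignType.sign s : ℝ) ≠ 0 := by
    rcases lt_or_gt_of_ne hs with h | h
    · rw [sign_neg h]; simp
    · rw [sign_pos h]; simp
  exact mul_ne_zero this (Real.sqrt_pos.2 hx).ne'

theorem sign_mul_sqrt_sq {s x : ℝ} (hs : s ≠ 0) (hx : 0 < x) :
    ((SignType.sign s : ℝ) * Real.sqrt x) ^ 2 = x := by
  have : (SignType.sign s : ℝ) ^ 2 = 1 := by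
    rcases lt_or_gt_of_ne hs with h | h
    · rw [sign_neg h]; simp
    · rw [sign_pos h]; simp
  rw [mul_pow, this, Real.sq_sqrt hx.le, one_mul]

theorem sign_mul_sqrt_eq {s x r : ℝ} (hr : 0 < r) (hs : s ≠ 0) (h : x = (r / s) ^ 2) :
    (SignType.sign s : ℝ) * Real.sqrt x = r / s := by
  rw [h, Real.sqrt_sq_eq_abs, abs_div, abs_of_pos hr]
  rcases lt_or_gt_of_ne hs with h | h
  · rw [sign_neg h, abs_of_neg h]
    simp [div_neg]
  · rw [sign_pos h, abs_of_pos h]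
    simp

/-- For equal signs of `f`, `f'` the values `(f ± a)`, `(f' ± a')` have equal signs too. -/
theorem mul_pos_of_sq_lt {f a f' a' : ℝ} (h : 0 < f' * f) (h1 : 0 < f ^ 2 - a ^ 2)
    (h2 : 0 < f' ^ 2 - a' ^ 2) : 0 < (f + a) * (f' + a') := by
  -- 2 f (f + a) = (f + a)² + (f² - a²).
  have e1 : 0 < f * (f + a) := by nlinarith [sq_nonneg (f + a)]
  have e2 : 0 < f' * (f' + a') := by nlinarith [sq_nonneg (f' + a')]
  have e3 : 0 < (f' * f) * ((f + a) * (f' + a')) := by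
    have := mul_pos e1 e2
    linarith
  exact pos_of_mul_pos_right e3 h.le

theorem two_le_sq_add_inv_sq {x : ℝ} (hx : x ≠ 0) : 2 ≤ x ^ 2 + x⁻¹ ^ 2 := by
  have := mul_inv_cancel₀ hx
  nlinarith [sq_nonneg (x - x⁻¹)]

theorem two_lt_sq_add_inv_sq {x : ℝ} (hx : x ≠ 0) (h1 : x ^ 2 ≠ 1) : 2 < x ^ 2 + x⁻¹ ^ 2 := by
  have h := mul_inv_cancel₀ hx
  have h2 : x - x⁻¹ ≠ 0 := by
    intro h0
    apply h1
    have : x⁻¹ = x := by linarith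
    rw [this] at h
    linarith
  have := pow_pos (abs_pos.2 h2) 2
  rw [sq_abs] at this
  nlinarith

namespace CMCConnection

variable {S T : Set ℤ}

/-- The connection of a profile whose net of revolution has curvature one, with rotation in the
second direction. -/
theorem exists_profile2 {θ r : ℝ} {f h a b : ℤ → ℝ} (hθ : IsAngle θ) (hr : 0 < r)
    (hint : ∀ j ∈ S, r ^ 2 * (f j ^ 2 - a j ^ 2) = 4) (hunit : ∀ j ∈ S, a j ^ 2 + b j ^ 2 = 1)
    (hpos : ∀ j ∈ S, j + 1 ∈ S → 0 < f (j + 1) * f j)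
    (hstep : ∀ j ∈ S, j + 1 ∈ S → ∃ l, ProfileStep 1 f h a b j l) :
    ∃ C : CMCConnection S T, C.Cond2 ∧ C.Profile2 θ r f a b ∧ KInvariant2 S T C.M ∧
      ∀ j k, IsEdge1 S T j k → C.u j k ≠ 1 ∧ C.u j k ≠ -1 := by
  obtain ⟨hs, -⟩ := hθ.half
  have hcot := hθ.cot_ne_zero
  -- Half the sum of the two prescribed values of v + 1/v and v - 1/v. The first integral says that
  -- half their difference is indeed the inverse.
  set V : ℤ → ℝ := fun j => r * (f j + a j) / 2 with hV
  set Y : ℤ → ℝ := fun j => r * b j with hY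
  set U : ℤ → ℝ := fun j => Real.sqrt (V j * V (j + 1)) with hU
  set ρ : ℝ := r * Real.cot (θ / 2) with hρ
  set m : ℤ → ℝ := fun j => if V j = V (j + 1) then
    2 * (U j * V j - (U j)⁻¹ * (V j)⁻¹) / (Y (j + 1) - Y j)
    else U j * (Y j + Y (j + 1)) / (V j - V (j + 1)) with hm
  have hρ0 : ρ ≠ 0 := mul_ne_zero hr.ne' hcot
  have hV1 : ∀ j ∈ S, V j * (r * (f j - a j) / 2) = 1 := by
    intro j hj
    linear_combination hint j hj / 4
  have hV0 : ∀ j ∈ S, V j ≠ 0 := fun j hj => left_ne_zero_of_mul (by rw [hV1 j hj]; exact one_ne_zero)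
  have hVi : ∀ j ∈ S, (V j)⁻¹ = r * (f j - a j) / 2 := fun j hj =>
    inv_eq_of_mul_eq_one_right (hV1 j hj)
  have hVV : ∀ j ∈ S, j + 1 ∈ S → 0 < V j * V (j + 1) := by
    intro j hj hj'
    have h1 : ∀ i ∈ S, 0 < f i ^ 2 - a i ^ 2 := fun i hi =>
      pos_of_mul_pos_right (by rw [hint i hi]; norm_num) (sq_nonneg r)
    have := mul_pos_of_sq_lt (hpos j hj hj') (h1 j hj) (h1 _ hj')
    have e : V j * V (j + 1) = r ^ 2 / 4 * ((f j + a j) * (f (j + 1) + a (j + 1))) := by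
      simp only [hV]
      ring
    rw [e]
    positivity
  have hU2 : ∀ j ∈ S, j + 1 ∈ S → U j ^ 2 = V j * V (j + 1) := fun j hj hj' =>
    Real.sq_sqrt (hVV j hj hj').le
  have hU0 : ∀ j ∈ S, j + 1 ∈ S → U j ≠ 0 := fun j hj hj' =>
    (Real.sqrt_pos.2 (hVV j hj hj')).ne'
  -- U² = 1 would mean V (j + 1) = 1 / V j, hence σa = 0 and by `sum_a` also σf = 0. This gives u ≠
  -- ±1 as well as α² > 0 for all t.
  have hU1 : ∀ j ∈ S, j + 1 ∈ S → U j ^ 2 ≠ 1 := by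
    intro j hj hj' h1
    obtain ⟨l, hl⟩ := hstep j hj hj'
    rw [hU2 j hj hj'] at h1
    have h2 : (V j)⁻¹ = V (j + 1) := inv_eq_of_mul_eq_one_right h1
    have h3 : (V (j + 1))⁻¹ = V j := inv_eq_of_mul_eq_one_left h1
    rw [hVi _ hj] at h2
    rw [hVi _ hj'] at h3
    simp only [hV] at h2 h3
    have h4 : r * (a (j + 1) + a j) = 0 := by linarith
    have h5 : a (j + 1) + a j = 0 := by simpa [hr.ne'] using h4
    have h6 := hl.sum_a
    rw [h5, mul_zero, one_mul] at h6
    have h7 := hpos j hj hj'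
    have h8 : f (j + 1) = -f j := by linarith
    rw [h8] at h7
    nlinarith [sq_nonneg (f j)]
  -- Equal values of V force δa = 0, so δb ≠ 0, and a² + b² = 1 leaves only b (j + 1) = -b j ≠ 0.
  -- This is the exceptional case of the edge conditions.
  have hyy : ∀ j ∈ S, j + 1 ∈ S → V j = V (j + 1) → Y (j + 1) = -Y j ∧ Y j ≠ 0 := by
    intro j hj hj' h1
    obtain ⟨l, hl⟩ := hstep j hj hj'
    have h2 : (V j)⁻¹ = (V (j + 1))⁻¹ := by rw [h1]
    rw [hVi _ hj, hVi _ hj'] at h2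
    simp only [hV] at h1
    have h4 : r * (a (j + 1) - a j) = 0 := by linarith
    have h5 : a (j + 1) - a j = 0 := by simpa [hr.ne'] using h4
    have h6 := hl.nondeg.resolve_left (not_not.2 h5)
    have h7 : a (j + 1) = a j := by linarith
    have h8 : (b (j + 1) - b j) * (b (j + 1) + b j) = 0 := by
      have := hunit _ hj'
      rw [h7] at this
      linarith [hunit j hj]
    have h9 := (mul_eq_zero.1 h8).resolve_left h6
    have h10 : b (j + 1) = -b j := by linarith
    refine ⟨by simp only [hY, h10]; ring, ?_⟩
    intro h0
    have : b j = 0 := by simpa [hY, hr.ne'] using h0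
    exact h6 (by rw [h10, this]; simp)
  have hpα : ∀ j ∈ S, j + 1 ∈ S → ∀ t : ℝ,
      0 < m j ^ 2 + U j ^ 2 + (U j)⁻¹ ^ 2 + 2 * Real.cos (2 * t) := by
    intro j hj hj' t
    have h1 := two_lt_sq_add_inv_sq (hU0 j hj hj') (hU1 j hj hj')
    have h2 := Real.neg_one_le_cos (2 * t)
    nlinarith [sq_nonneg (m j)]
  have hβ0 : ∀ j ∈ S, ρ ^ 2 + Y j ^ 2 + V j ^ 2 + (V j)⁻¹ ^ 2 = (r / Real.sin (θ / 2)) ^ 2 + 2 := by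
    intro j hj
    have h1 := inv_sin_sq_sub_cot_sq hs
    rw [hVi j hj, div_eq_mul_one_div r]
    simp only [hV, hY, hρ]
    linear_combination r ^ 2 * hunit j hj + hint j hj / 2 - r ^ 2 * h1
  have hpβ : ∀ j ∈ S, ∀ t : ℝ,
      0 < ρ ^ 2 + Y j ^ 2 + V j ^ 2 + (V j)⁻¹ ^ 2 - 2 * Real.cos (2 * t) := by
    intro j hj t
    rw [hβ0 j hj]
    have h2 := Real.cos_le_one (2 * t)
    have h3 : 0 < (r / Real.sin (θ / 2)) ^ 2 := by positivity
    linarith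
  let C : CMCConnection S T :=
    { u := fun j _ => U j
      v := fun j _ => V j
      𝔳 := fun j _ => (m j : ℂ)
      𝔥 := fun j _ => ⟨ρ, Y j⟩
      α := fun j _ t => Real.sqrt (m j ^ 2 + U j ^ 2 + (U j)⁻¹ ^ 2 + 2 * Real.cos (2 * t))
      -- The sign is needed because β must equal r / sin(θ/2) at t = 0, which is negative for θ < 0.
      β := fun j _ t => (SignType.sign (Real.sin (θ / 2)) : ℝ) *
        Real.sqrt (ρ ^ 2 + Y j ^ 2 + V j ^ 2 + (V j)⁻¹ ^ 2 - 2 * Real.cos (2 * t))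
      u_ne_zero := fun j k he => hU0 j he.1 he.2.1
      v_ne_zero := fun j k he => hV0 j he.1
      α_ne_zero := fun j k he t => (Real.sqrt_pos.2 (hpα j he.1 he.2.1 t)).ne'
      β_ne_zero := fun j k he t => sign_mul_ne_zero hs (hpβ j he.1 t)
      α_differentiable := fun j k he =>
        Differentiable.sqrt (by fun_prop) fun t => (hpα j he.1 he.2.1 t).ne'
      β_differentiable := fun j k he =>
        (Differentiable.sqrt (by fun_prop) fun t => (hpβ j he.1 t).ne').const_mul _
      α_sq := fun j k he t => α_sq_complex (by
        rw [Real.sq_sqrt (hpα j he.1 he.2.1 t).le]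
        simp)
      β_sq := fun j k he t => β_sq_complex (sign_mul_sqrt_sq hs (hpβ j he.1 t))
      α_opposite := fun j k _ t => rfl
      β_opposite := fun j k hF t => by rw [hβ0 j hF.1, hβ0 (j + 1) hF.2.1] }
  refine ⟨C, ?_, ⟨?_, ?_, ?_, ?_, ?_⟩, fun t j k _ _ => rfl, ?_⟩
  · intro j k hF
    have hVV' := hVV j hF.1 hF.2.1
    refine ⟨?_, rfl, hU2 j hF.1 hF.2.1, rfl, Complex.ofReal_im _, ?_, ?_⟩
    · intro h0
      change V j = -V (j + 1) at h0
      rw [h0] at hVV'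
      nlinarith [sq_nonneg (V (j + 1))]
    · intro h0
      change V j ≠ V (j + 1) at h0
      have h1 : m j = U j * (Y j + Y (j + 1)) / (V j - V (j + 1)) := by
        simp only [hm]
        rw [if_neg h0]
      change (m j : ℂ) = Complex.I * (U j : ℂ) * (conj (⟨ρ, Y j⟩ : ℂ) - ⟨ρ, Y (j + 1)⟩)
        / ((V j : ℂ) - V (j + 1))
      have h2 : conj (⟨ρ, Y j⟩ : ℂ) - ⟨ρ, Y (j + 1)⟩ = -(Complex.I * (Y j + Y (j + 1))) := by
        apply Complex.ext <;> simp
        ring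
      rw [h1, h2]
      push_cast
      congr 1
      linear_combination (U j * (Y j + Y (j + 1)) : ℂ) * Complex.I_sq
    · intro h0
      change V j = V (j + 1) at h0
      obtain ⟨hy, hy0⟩ := hyy j hF.1 hF.2.1 h0
      refine ⟨?_, ?_, ?_⟩
      · have h1 : m j = 2 * (U j * V j - (U j)⁻¹ * (V j)⁻¹) / (Y (j + 1) - Y j) := by
          simp only [hm]
          rw [if_pos h0]
        change (m j : ℂ) = 2 * Complex.I * ((U j : ℂ) * V j - (U j : ℂ)⁻¹ * (V j : ℂ)⁻¹)
          / ((⟨ρ, Y (j + 1)⟩ : ℂ) - ⟨ρ, Y j⟩)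
        have h2 : (⟨ρ, Y (j + 1)⟩ : ℂ) - ⟨ρ, Y j⟩ = Complex.I * (Y (j + 1) - Y j) := by
          apply Complex.ext <;> simp
        rw [h1, h2, mul_comm (2 : ℂ), mul_assoc, mul_div_mul_left _ _ Complex.I_ne_zero]
        push_cast
        rfl
      · change conj (⟨ρ, Y (j + 1)⟩ : ℂ) = ⟨ρ, Y j⟩
        rw [hy]
        apply Complex.ext <;> simp
      · intro h1
        have h2 := congrArg Complex.im h1
        change Y (j + 1) = Y j at h2
        apply hy0
        linarith
  · intro j k he
    refine sign_mul_sqrt_eq hr hs ?_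
    rw [hβ0 j he.1]
    simp
  · intro j k he
    rfl
  · intro j k he
    rfl
  · intro j k he
    change V j - (V j)⁻¹ = _
    rw [hVi j he.1]
    simp only [hV]
    ring
  · intro j k he
    change V j + (V j)⁻¹ = _
    rw [hVi j he.1]
    simp only [hV]
    ring
  · intro j k he
    have := hU1 j he.1 he.2.1
    constructor
    · intro h0
      change U j = 1 at h0
      rw [h0] at this
      norm_num at this
    · intro h0
      change U j = -1 at h0
      rw [h0] at this
      norm_num at this

theorem exists_connection2 (hS : S.OrdConnected) (hS' : S.Nontrivial) (hT : T.OrdConnected)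
    (hT' : T.Nontrivial) {x n : ℤ → ℤ → E3} {θ κ : ℝ} {f h a b : ℤ → ℝ}
    (hrc : IsRCNet S T x n θ f h a b) (hcurv : HasConstGaussCurvature S T x n 1)
    (hint : PosIntegral S f a b κ) (hκ : 1 < κ) :
    ∃ C : CMCConnection S T, C.Cond2 ∧ C.Const2 ∧ KInvariant2 S T C.M ∧ C.Norm2 θ κ ∧
      ∃ Φ, IsParallelFrameFamily S T C.L C.M Φ ∧
        RigidlyEquivalent S T (symPoint (-2) 0 Φ 0) (symNormal Φ 0) x n := by
  have hθ := hrc.angle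
  have hκ2 : 0 < κ ^ 2 - 1 := by nlinarith
  have hsq : Real.sqrt (κ ^ 2 - 1) ^ 2 = κ ^ 2 - 1 := Real.sq_sqrt hκ2.le
  have hsq0 : 0 < Real.sqrt (κ ^ 2 - 1) := Real.sqrt_pos.2 hκ2
  set r := 2 / Real.sqrt (κ ^ 2 - 1) with hrdef
  have hr : 0 < r := by positivity
  have hr2 : r ^ 2 * (κ ^ 2 - 1) = 4 := by
    rw [hrdef, div_pow, hsq]
    field_simp
    norm_num
  have hstep : ∀ j ∈ S, j + 1 ∈ S → ∃ l, ProfileStep 1 f h a b j l := fun j hj hj' =>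
    hrc.profileStep one_ne_zero hcurv (exists_step hT hT') hj hj'
  obtain ⟨C, hC, hp, hK, hu⟩ := exists_profile2 (T := T) hθ hr
    (fun j hj => by rw [(hint j hj).1, hr2]) hrc.unit
    (fun j hj hj' => mul_pos_of_sign_eq (hrc.f_ne_zero j hj) (hrc.f_sign j hj hj')) hstep
  have hcomp := hC.compatible hp.const2
  obtain ⟨Φ, hΦ⟩ := exists_parallelFrameFamily hS hS'.nonempty
    (fun j k he => C.isUnitFamily_L he) (fun j k he => C.isUnitFamily_M he)
    (isFlat_of_compatible hcomp)
  refine ⟨C, hC, hp.const2, hK, ⟨fun j k he => ⟨?_, ?_⟩, hu, fun j k hF => ?_⟩, Φ, hΦ,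
    (hp.rigidlyEquivalent hS hS' hT hT' hθ hr.ne' hC hstep hΦ).symm.trans hrc.param⟩
  · rw [hp.β_eq j k he, hrdef, div_div]
  · rw [hp.re_eq j k he, hrdef]
    ring
  · exact mul_ne_zero (C.v_ne_zero j k ⟨hF.1, hF.2.2⟩) (C.v_ne_zero _ k ⟨hF.2.1, hF.2.2⟩)

end CMCConnection

/-! ### Profile and frames for K = 1 and rotation in the first direction. -/

theorem IsParallelFrameFamily.flip {S T : Set ℤ} {L M Φ : ℝ → ℤ → ℤ → Mat2}
    (h : IsParallelFrameFamily S T L M Φ) :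
    IsParallelFrameFamily T S (fun t k j => M t j k) (fun t k j => L t j k)
      (fun t k j => Φ t j k) where
  isQuat t k j hv := h.isQuat t j k ⟨hv.2, hv.1⟩
  ne_zero t k j hv := h.ne_zero t j k ⟨hv.2, hv.1⟩
  differentiable k j hv := h.differentiable j k ⟨hv.2, hv.1⟩
  parallel1 t k j he := h.parallel2 t j k ⟨he.2.2, he.1, he.2.1⟩
  parallel2 t k j he := h.parallel1 t j k ⟨he.2.1, he.2.2, he.1⟩

namespace CMCConnection

variable {S T : Set ℤ} {C : CMCConnection S T}

/-- The data on the edges of the first kind in terms of the profile of a net of revolution. -/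
structure Profile1 (C : CMCConnection S T) (θ r : ℝ) (f a b : ℤ → ℝ) : Prop where
  α_eq : ∀ j k, IsEdge1 S T j k → C.α j k 0 = r / Real.sin (θ / 2)
  re_eq : ∀ j k, IsEdge1 S T j k → (C.𝔳 j k).re = r * Real.cot (θ / 2)
  im_eq : ∀ j k, IsEdge1 S T j k → (C.𝔳 j k).im = r * b k
  add_eq : ∀ j k, IsEdge1 S T j k → C.u j k + (C.u j k)⁻¹ = r * a k
  sub_eq : ∀ j k, IsEdge1 S T j k → C.u j k - (C.u j k)⁻¹ = r * f k

theorem Profile1.const1 {θ r : ℝ} {f a b : ℤ → ℝ} (hp : C.Profile1 θ r f a b) : C.Const1 :=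
  ⟨⟨_, hp.α_eq⟩, ⟨_, hp.re_eq⟩⟩

theorem Profile1.unit {θ r : ℝ} {f a b : ℤ → ℝ} (hp : C.Profile1 θ r f a b) (hθ : IsAngle θ)
    (hr : r ≠ 0) {j k : ℤ} (he : IsEdge1 S T j k) : a k ^ 2 + b k ^ 2 = 1 := by
  have h1 := C.α_sq_real he 0
  have hv := mul_inv_cancel₀ (C.u_ne_zero j k he)
  rw [hp.α_eq j k he, hp.re_eq j k he, hp.im_eq j k he, mul_zero, Real.cos_zero] at h1
  have h2 := inv_sin_sq_sub_cot_sq hθ.half.1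
  have h3 := hp.add_eq j k he
  apply mul_left_cancel₀ (pow_ne_zero 2 hr)
  rw [div_eq_mul_one_div] at h1
  linear_combination -h1 + r ^ 2 * h2 + (-(C.u j k + (C.u j k)⁻¹) - r * a k) * h3 + 2 * hv

theorem Profile1.integral {θ r : ℝ} {f a b : ℤ → ℝ} (hp : C.Profile1 θ r f a b)
    {j k : ℤ} (he : IsEdge1 S T j k) : r ^ 2 * (a k ^ 2 - f k ^ 2) = 4 := by
  have hv := mul_inv_cancel₀ (C.u_ne_zero j k he)
  have h3 := hp.sub_eq j k he
  have h4 := hp.add_eq j k he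
  have : r ^ 2 * (a k ^ 2 - f k ^ 2) = (r * a k) ^ 2 - (r * f k) ^ 2 := by ring
  rw [this, ← h3, ← h4]
  linear_combination 4 * hv

/-- The relations of the profile along a face. -/
theorem Profile1.face {θ r : ℝ} {f a b : ℤ → ℝ} (hp : C.Profile1 θ r f a b) (hr : r ≠ 0)
    (h : C.Cond1) (hc : C.Const1) {j k : ℤ} (hF : IsFace S T j k) :
    (C.𝔥 j k).re * (a (k + 1) - a k) = (C.v j k - (C.v j k)⁻¹) * (b (k + 1) + b k) ∧
    (C.𝔥 j k).re * (b (k + 1) - b k) = -((C.v j k - (C.v j k)⁻¹) * (a (k + 1) + a k)) ∧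
    (C.v j k + (C.v j k)⁻¹) * (f (k + 1) + f k) = (C.v j k - (C.v j k)⁻¹) * (a (k + 1) + a k) ∧
    (C.v j k + (C.v j k)⁻¹) * (a (k + 1) - a k) = (C.v j k - (C.v j k)⁻¹) * (f (k + 1) - f k) := by
  obtain ⟨h1, h2, h3, h4, h5, -, -⟩ := h j k hF
  obtain ⟨-, e1, e2⟩ := h.face hc hF
  have he : IsEdge1 S T j k := ⟨hF.1, hF.2.1, hF.2.2.1⟩
  have he' : IsEdge1 S T j (k + 1) := ⟨hF.1, hF.2.1, hF.2.2.2⟩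
  have hv0 := C.v_ne_zero j k ⟨hF.1, hF.2.2⟩
  have hu0 := C.u_ne_zero j k he
  have hu0' := C.u_ne_zero j (k + 1) he'
  have s1 := hp.sub_eq j k he
  have s2 := hp.sub_eq j (k + 1) he'
  have a1 := hp.add_eq j k he
  have a2 := hp.add_eq j (k + 1) he'
  rw [hp.im_eq j k he, hp.im_eq j (k + 1) he'] at e1 e2
  set v := C.v j k
  set u := C.u j k
  set u' := C.u j (k + 1)
  have i0 : v⁻¹ = v * (u * u')⁻¹ := by rw [← h3]; field_simp
  have i1 : u'⁻¹ = (u * u')⁻¹ * u := by field_simp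
  have i2 : u⁻¹ = (u * u')⁻¹ * u' := by field_simp
  rw [mul_inv, mul_inv, i0, i1, i2] at e2
  rw [i1] at s2 a2
  rw [i2] at s1 a1
  rw [i0]
  generalize (u * u')⁻¹ = w at *
  refine ⟨?_, ?_, ?_, ?_⟩
  · apply mul_left_cancel₀ hr
    linear_combination (-(1 - w)) * e1 + (C.𝔥 j k).re * (a1 - a2)
  · apply mul_left_cancel₀ hr
    linear_combination -e2 - (v - v * w) * (a1 + a2)
  · apply mul_left_cancel₀ hr
    linear_combination (v - v * w) * (a1 + a2) - (v + v * w) * (s1 + s2)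
  · apply mul_left_cancel₀ hr
    linear_combination (v - v * w) * (s2 - s1) - (v + v * w) * (a2 - a1)

/-- For real v ≠ 0 the sum v + 1/v never vanishes, and v = 1/v would force σf = 0 by the third face
relation. So l is finite and nonzero. -/
theorem Profile1.sub_inv_ne_zero {θ r : ℝ} {f a b : ℤ → ℝ} (hp : C.Profile1 θ r f a b)
    (hr : r ≠ 0) (hC : C.Cond1) {j k : ℤ} (hF : IsFace S T j k) (hf : 0 < f (k + 1) * f k) :
    C.v j k - (C.v j k)⁻¹ ≠ 0 ∧ C.v j k + (C.v j k)⁻¹ ≠ 0 := by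
  obtain ⟨-, -, e3, -⟩ := hp.face hr hC hp.const1 hF
  have hv0 := C.v_ne_zero j k ⟨hF.1, hF.2.2⟩
  have hg : C.v j k + (C.v j k)⁻¹ ≠ 0 := by
    have : C.v j k * (C.v j k + (C.v j k)⁻¹) = C.v j k ^ 2 + 1 := by field_simp
    intro h0
    rw [h0] at this
    nlinarith [sq_nonneg (C.v j k)]
  refine ⟨fun h0 => ?_, hg⟩
  rw [h0, zero_mul] at e3
  have h2 : f (k + 1) = -f k := by linarith [(mul_eq_zero.1 e3).resolve_left hg]
  rw [h2] at hf
  nlinarith [sq_nonneg (f k)]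

theorem Profile1.profileStep {θ r : ℝ} {f h a b : ℤ → ℝ} (hp : C.Profile1 θ r f a b)
    (hθ : IsAngle θ) (hr : r ≠ 0) (hC : C.Cond1) {j k : ℤ} (hF : IsFace S T j k)
    (hf : 0 < f (k + 1) * f k)
    (hh : b (k + 1) - b k =
      (C.v j k - (C.v j k)⁻¹) / (C.v j k + (C.v j k)⁻¹) * (h (k + 1) - h k)) :
    ProfileStep 1 f h a b k ((C.v j k - (C.v j k)⁻¹) / (C.v j k + (C.v j k)⁻¹)) := by
  obtain ⟨e1, e2, e3, e4⟩ := hp.face hr hC hp.const1 hF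
  obtain ⟨hd, hg⟩ := hp.sub_inv_ne_zero hr hC hF hf
  refine ⟨div_ne_zero hd hg, ?_, hh, ?_, ?_⟩
  · rw [div_mul_eq_mul_div, eq_div_iff hg]
    linear_combination e4
  · rw [div_mul_eq_mul_div, div_eq_iff hg]
    linear_combination -e3
  · by_contra! h0
    rw [h0.1, mul_zero] at e1
    rw [h0.2, mul_zero] at e2
    have hb : b (k + 1) + b k = 0 := by
      simpa [hd] using e1.symm
    have ha : a (k + 1) + a k = 0 := by
      simpa [hd] using e2.symm
    have := hp.unit hθ hr (j := j) (k := k) ⟨hF.1, hF.2.1, hF.2.2.1⟩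
    have ha0 : a k = 0 := by linarith [h0.1]
    have hb0 : b k = 0 := by linarith [h0.2]
    rw [ha0, hb0] at this
    norm_num at this

theorem Cond1.exists_face (hC : C.Cond1) (hS : S.OrdConnected) (hS' : S.Nontrivial) {j k : ℤ}
    (he : IsEdge2 S T j k) :
    ∃ i, IsFace S T i k ∧ C.v j k = C.v i k ∧ C.𝔥 j k = C.𝔥 i k := by
  obtain ⟨i, hi, hi', h⟩ := mem_step hS hS' he.1
  have hF : IsFace S T i k := ⟨hi, hi', he.2⟩
  obtain ⟨-, h2, -, h4, -⟩ := hC i k hF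
  rcases h with rfl | rfl
  · exact ⟨j, hF, rfl, rfl⟩
  · exact ⟨i, hF, h2.symm, h4.symm⟩

/-- The Sym formula yields the net of revolution with the given profile. -/
theorem Profile1.rigidlyEquivalent (hS : S.OrdConnected) (hS' : S.Nontrivial)
    (hT : T.OrdConnected) (hT' : T.Nontrivial) {θ r : ℝ} {f h a b : ℤ → ℝ}
    (hp : C.Profile1 θ r f a b) (hθ : IsAngle θ) (hr : r ≠ 0) (hC : C.Cond1)
    (hf : ∀ k ∈ T, k + 1 ∈ T → 0 < f (k + 1) * f k)
    (hstep : ∀ k ∈ T, k + 1 ∈ T → ∃ l, ProfileStep 1 f h a b k l)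
    {Φ : ℝ → ℤ → ℤ → Mat2} (hΦ : IsParallelFrameFamily S T C.L C.M Φ) :
    RigidlyEquivalent T S (revolve θ f h) (revolve θ a b)
      (fun k j => symPoint (-2) 0 Φ 0 j k) (fun k j => symNormal Φ 0 j k) := by
  obtain ⟨hs, -⟩ := hθ.half
  obtain ⟨j₀, hj₀, hj₀'⟩ := exists_step hS hS'
  have hpq : ∀ k, ∃ p q : ℝ, k ∈ T → p ^ 2 + q ^ 2 = 1 ∧ a k = 2 * p * q ∧ b k = p ^ 2 - q ^ 2 := by
    intro k
    by_cases hk : k ∈ T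
    · obtain ⟨p, q, h⟩ := exists_half_angle (hp.unit hθ hr (j := j₀) (k := k) ⟨hj₀, hj₀', hk⟩)
      exact ⟨p, q, fun _ => h⟩
    · exact ⟨0, 0, fun h => absurd h hk⟩
  choose p q hpq using hpq
  have he0 : (1 - Complex.I : ℂ) ≠ 0 := by
    intro h0
    simpa using congrArg Complex.re h0
  refine rigidlyEquivalent_revolve (ξ := -2) hT hT'.nonempty hS hS'.nonempty hΦ.flip (by norm_num)
    -- At t = 0 the off-diagonal entries of M are equal and imaginary. The gauge e = 1 - i satisfies
    -- conj e = i e and turns M into a real rotation, up to scaling, as `profileFrame_step`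
    -- requires.
    (P := fun k => profileFrame (1 - Complex.I) (p k) (q k)) ?_ ?_ ?_
  · intro k hk
    obtain ⟨h1, h2, h3⟩ := hpq k hk
    exact ⟨isQuat_profileFrame _ _ _, profileFrame_ne_zero he0 h1,
      profileFrame_mul_imH _ h1 h2 h3⟩
  · intro k j he'
    have he : IsEdge2 S T j k := ⟨he'.2.2, he'.1, he'.2.1⟩
    refine ⟨(C.isUnitFamily_M he).det_eq 0, ?_⟩
    obtain ⟨c', hM⟩ := C.hasMatDeriv_M he
    obtain ⟨l, hl⟩ := hstep k he.2.1 he.2.2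
    obtain ⟨i, hF, hvi, hmi⟩ := hC.exists_face hS hS' he
    obtain ⟨-, -, -, -, h5, -⟩ := hC i k hF
    obtain ⟨e1, e2, e3, e4⟩ := hp.face hr hC hp.const1 hF
    obtain ⟨hd, hg⟩ := hp.sub_inv_ne_zero hr hC hF (hf k he.2.1 he.2.2)
    rw [← hmi, ← hvi] at e1 e2
    rw [← hvi] at e3 e4 hg hd
    rw [← hmi] at h5
    have hm : C.𝔥 j k = ((C.𝔥 j k).re : ℂ) := by
      apply Complex.ext <;> simp [h5]
    obtain ⟨p1, p2, p3⟩ := hpq k he.2.1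
    obtain ⟨p1', p2', p3'⟩ := hpq (k + 1) he.2.2
    have hX := half_angle_step (g := -(C.v j k - (C.v j k)⁻¹)) p1 p2 p3 p1' p2' p3'
      (by rw [e1]; ring) (by rw [e2]; ring)
    refine ⟨l, _, c', _, hl.ne_zero, hl.diff_a, hl.diff_b,
      profileFrame_step (c := 1 / C.β j k 0) p1' hX ?_ ?_ ?_ ?_, hM, ?_⟩
    · rw [M_zero, hm]
      simp
    · rw [M_zero]
      simp
      linear_combination ((C.β j k 0 : ℂ)⁻¹ * (C.v j k - (C.v j k : ℂ)⁻¹)) * Complex.I_sq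
    · rw [M_zero]
      simp
      linear_combination ((C.β j k 0 : ℂ)⁻¹ * (C.v j k - (C.v j k : ℂ)⁻¹)) * Complex.I_sq
    · rw [M_zero, hm]
      simp
    · have hlg : l * (C.v j k + (C.v j k)⁻¹) = C.v j k - (C.v j k)⁻¹ := by
        have hσ : a (k + 1) + a k ≠ 0 := by
          intro h0
          rw [h0, mul_zero] at e3
          have h2 : f (k + 1) = -f k := by linarith [(mul_eq_zero.1 e3).resolve_left hg]
          have h3 := hf k he.2.1 he.2.2
          rw [h2] at h3
          nlinarith [sq_nonneg (f k)]
        apply mul_right_cancel₀ hσ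
        linear_combination e3 + (C.v j k + (C.v j k)⁻¹) * hl.sum_a
      have hlg' : (l : ℂ) * (C.v j k + (C.v j k : ℂ)⁻¹) = C.v j k - (C.v j k : ℂ)⁻¹ := by
        exact_mod_cast hlg
      simp only [M_zero]
      ext m n
      fin_cases m <;> fin_cases n <;>
        simp [pauli3]
      · linear_combination (2 * (C.β j k 0 : ℂ)⁻¹) * hlg'
          + (2 * (C.β j k 0 : ℂ)⁻¹ * (C.v j k - (C.v j k : ℂ)⁻¹)) * Complex.I_sq
      · linear_combination (-2 * (C.β j k 0 : ℂ)⁻¹) * hlg'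
          + (-2 * (C.β j k 0 : ℂ)⁻¹ * (C.v j k - (C.v j k : ℂ)⁻¹)) * Complex.I_sq
  · intro k j he'
    have he : IsEdge1 S T j k := ⟨he'.2.1, he'.2.2, he'.1⟩
    refine ⟨(C.isUnitFamily_L he).det_eq 0, ?_⟩
    obtain ⟨c', hL⟩ := C.hasMatDeriv_L he
    obtain ⟨p1, p2, p3⟩ := hpq k he.2.2
    have hs' : (Real.sin (θ / 2) : ℂ) ≠ 0 := by exact_mod_cast hs
    have hr' : (r : ℂ) ≠ 0 := by exact_mod_cast hr
    have hh : C.𝔳 j k = r * (Real.cos (θ / 2) / Real.sin (θ / 2) + Complex.I * b k) := by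
      rw [← Complex.re_add_im (C.𝔳 j k), hp.re_eq j k he, hp.im_eq j k he,
        Real.cot_eq_cos_div_sin]
      push_cast
      ring
    have hsub : (C.u j k : ℂ) - (C.u j k : ℂ)⁻¹ = r * f k := by exact_mod_cast hp.sub_eq j k he
    have hadd : (C.u j k : ℂ) + (C.u j k : ℂ)⁻¹ = r * a k := by exact_mod_cast hp.add_eq j k he
    refine ⟨c', _, mul_profileFrame_eq p1 p2 p3 ?_ ?_ ?_ ?_, hL, ?_⟩
    · simp only [L_zero]
      rw [hp.α_eq j k he, hh]
      simp [-Complex.ofReal_cos, -Complex.ofReal_sin]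
      field_simp
    · simp only [L_zero]
      rw [hp.α_eq j k he, hadd]
      simp [-Complex.ofReal_cos, -Complex.ofReal_sin]
      field_simp
      linear_combination (a k : ℂ) * Complex.I_sq
    · simp only [L_zero]
      rw [hp.α_eq j k he, hadd]
      simp [-Complex.ofReal_cos, -Complex.ofReal_sin]
      field_simp
      linear_combination (a k : ℂ) * Complex.I_sq
    · simp only [L_zero]
      rw [hp.α_eq j k he, hh]
      simp [-Complex.ofReal_cos, -Complex.ofReal_sin]
      field_simp
      ring
    · rw [hp.α_eq j k he, hsub]
      ext m n
      fin_cases m <;> fin_cases n <;>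
        simp [profileFrame, pauli2, -Complex.ofReal_cos, -Complex.ofReal_sin] <;>
        field_simp <;> ring_nf <;> simp

end CMCConnection

/-! ### The correspondence between connections and nets for κ < 1. -/

namespace CMCConnection

variable {S T : Set ℤ} {C : CMCConnection S T}

theorem Cond1.isRCNet (hS : S.OrdConnected) (hS' : S.Nontrivial) (hT : T.OrdConnected)
    (hT' : T.Nontrivial) (hC : C.Cond1) {θ κ : ℝ} (hJ : JInvariant1 S T C.L)
    (hθ : IsAngle θ) (hκ0 : 0 < κ) (hκ : κ < 1) (hN : C.Norm1 θ κ) {Φ : ℝ → ℤ → ℤ → Mat2}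
    (hΦ : IsParallelFrameFamily S T C.L C.M Φ) :
    ∃ f h a b : ℤ → ℝ,
      IsRCNet T S (fun k j => symPoint (-2) 0 Φ 0 j k) (fun k j => symNormal Φ 0 j k)
        θ f h a b ∧
      HasConstGaussCurvature S T (symPoint (-2) 0 Φ 0) (symNormal Φ 0) 1 ∧
      PosIntegral T f a b κ := by
  obtain ⟨hN1, hN2⟩ := hN
  obtain ⟨j₀, hj₀, hj₀'⟩ := exists_step hS hS'
  have hκ2 : 0 < 1 - κ ^ 2 := by nlinarith
  have hsq : Real.sqrt (1 - κ ^ 2) ^ 2 = 1 - κ ^ 2 := Real.sq_sqrt hκ2.le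
  have hsq0 : 0 < Real.sqrt (1 - κ ^ 2) := Real.sqrt_pos.2 hκ2
  set r := 2 / Real.sqrt (1 - κ ^ 2) with hrdef
  have hr : r ≠ 0 := by positivity
  have hr2 : r ^ 2 * (1 - κ ^ 2) = 4 := by
    rw [hrdef, div_pow, hsq]
    field_simp
    norm_num
  have hinv : ∀ j k, IsEdge1 S T j k → C.u j k = C.u j₀ k ∧ C.𝔳 j k = C.𝔳 j₀ k := by
    intro j k he
    refine ordConnected_int_induction (ordConnected_steps hS)
      (p := fun j => C.u j k = C.u j₀ k ∧ C.𝔳 j k = C.𝔳 j₀ k) ⟨hj₀, hj₀'⟩ ⟨rfl, rfl⟩ ?_ j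
      ⟨he.1, he.2.1⟩
    intro i hi hi'
    have e1 : IsEdge1 S T i k := ⟨hi.1, hi.2, he.2.2⟩
    have e2 : IsEdge1 S T (i + 1) k := ⟨hi'.1, hi'.2, he.2.2⟩
    obtain ⟨h1, h2⟩ := eq_of_L_eq e1 (by rw [(hN1 i k e1).1, (hN1 _ k e2).1])
      (by
        rw [(hN1 i k e1).2]
        have := hθ.cot_ne_zero
        positivity) (fun t => hJ t i k e1 e2)
    rw [h1, h2]
  have hp : C.Profile1 θ r (fun k => (C.u j₀ k - (C.u j₀ k)⁻¹) / r)
      (fun k => (C.u j₀ k + (C.u j₀ k)⁻¹) / r) (fun k => (C.𝔳 j₀ k).im / r) := by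
    refine ⟨?_, ?_, ?_, ?_, ?_⟩ <;> intro j k he
    · rw [(hN1 j k he).1, hrdef, div_div]
    · rw [(hN1 j k he).2, hrdef]
      ring
    · rw [(hinv j k he).2]
      field_simp
    · rw [(hinv j k he).1]
      field_simp
    · rw [(hinv j k he).1]
      field_simp
  set f : ℤ → ℝ := fun k => (C.u j₀ k - (C.u j₀ k)⁻¹) / r
  set a : ℤ → ℝ := fun k => (C.u j₀ k + (C.u j₀ k)⁻¹) / r
  set b : ℤ → ℝ := fun k => (C.𝔳 j₀ k).im / r
  obtain ⟨h, hh⟩ := exists_antidifference fun k =>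
    (b (k + 1) - b k) / ((C.v j₀ k - (C.v j₀ k)⁻¹) / (C.v j₀ k + (C.v j₀ k)⁻¹))
  have he : ∀ {k}, k ∈ T → IsEdge1 S T j₀ k := fun hk => ⟨hj₀, hj₀', hk⟩
  have hint : ∀ k ∈ T, r ^ 2 * (a k ^ 2 - f k ^ 2) = 4 := fun k hk => hp.integral (he hk)
  have hunit : ∀ k ∈ T, a k ^ 2 + b k ^ 2 = 1 := fun k hk => hp.unit hθ hr (he hk)
  -- Now r f = u - 1/u, whose sign is not controlled by u u' = v² > 0; the sign condition of the
  -- normalization supplies it.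
  have hf : ∀ k ∈ T, k + 1 ∈ T → 0 < f (k + 1) * f k := by
    intro k hk hk'
    have h1 := hN2 j₀ k ⟨hj₀, hj₀', hk, hk'⟩
    rw [hp.sub_eq j₀ k (he hk), hp.sub_eq j₀ (k + 1) (he hk')] at h1
    have h2 : 0 < r ^ 2 * (f (k + 1) * f k) := by linarith
    exact pos_of_mul_pos_right h2 (by positivity)
  have hstep : ∀ k ∈ T, k + 1 ∈ T → ∃ l, ProfileStep 1 f h a b k l := by
    intro k hk hk'
    have hF : IsFace S T j₀ k := ⟨hj₀, hj₀', hk, hk'⟩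
    obtain ⟨hd, hg⟩ := hp.sub_inv_ne_zero hr hC hF (hf k hk hk')
    exact ⟨_, hp.profileStep hθ hr hC hF (hf k hk hk')
      (by rw [hh, mul_div_cancel₀ _ (div_ne_zero hd hg)])⟩
  have hrig := hp.rigidlyEquivalent hS hS' hT hT' hθ hr hC hf hstep hΦ
  have hf0 : ∀ k ∈ T, f k ≠ 0 := by
    intro k hk
    obtain ⟨i, hi, hi', h⟩ := mem_step hT hT' hk
    have h1 := hf i hi hi'
    rcases h with rfl | rfl
    · exact right_ne_zero_of_mul h1.ne'
    · exact left_ne_zero_of_mul h1.ne'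
  obtain ⟨h1, h2⟩ := isRCNet_of_profile hθ one_ne_zero hf0 (fun k hk hk' =>
    sign_eq_of_mul_pos (hf k hk hk')) hunit hstep hrig
  refine ⟨f, h, a, b, h1, h2.flip, fun k hk => ?_⟩
  have h3 : f k ^ 2 - a k ^ 2 = κ ^ 2 - 1 := by
    apply mul_left_cancel₀ (pow_ne_zero 2 hr)
    linarith [hint k hk]
  exact ⟨h3, by linarith [hunit k hk]⟩

/-- The connection of a profile whose net of revolution has curvature one, with rotation in the
first direction. -/
theorem exists_profile1 {θ r : ℝ} {f h a b : ℤ → ℝ} (hθ : IsAngle θ) (hr : 0 < r)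
    (hint : ∀ k ∈ T, r ^ 2 * (a k ^ 2 - f k ^ 2) = 4) (hunit : ∀ k ∈ T, a k ^ 2 + b k ^ 2 = 1)
    (hpos : ∀ k ∈ T, k + 1 ∈ T → 0 < f (k + 1) * f k)
    (hpos' : ∀ k ∈ T, k + 1 ∈ T → 0 < a (k + 1) * a k)
    (hstep : ∀ k ∈ T, k + 1 ∈ T → ∃ l, ProfileStep 1 f h a b k l) :
    ∃ C : CMCConnection S T, C.Cond1 ∧ C.Profile1 θ r f a b ∧ JInvariant1 S T C.L := by
  obtain ⟨hs, -⟩ := hθ.half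
  have hcot := hθ.cot_ne_zero
  set U : ℤ → ℝ := fun k => r * (a k + f k) / 2 with hU
  set Y : ℤ → ℝ := fun k => r * b k with hY
  set V : ℤ → ℝ := fun k => Real.sqrt (U k * U (k + 1)) with hV
  set ρ : ℝ := r * Real.cot (θ / 2) with hρ
  set m : ℤ → ℝ := fun k => if U k = U (k + 1) then
    2 * (U k * V k - (U k)⁻¹ * (V k)⁻¹) / (Y k - Y (k + 1))
    else -(V k * (Y k + Y (k + 1))) / (U k - U (k + 1)) with hm
  have hρ0 : ρ ≠ 0 := mul_ne_zero hr.ne' hcot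
  have hU1 : ∀ k ∈ T, U k * (r * (a k - f k) / 2) = 1 := by
    intro k hk
    linear_combination hint k hk / 4
  have hU0 : ∀ k ∈ T, U k ≠ 0 := fun k hk => left_ne_zero_of_mul (by rw [hU1 k hk]; exact one_ne_zero)
  have hUi : ∀ k ∈ T, (U k)⁻¹ = r * (a k - f k) / 2 := fun k hk =>
    inv_eq_of_mul_eq_one_right (hU1 k hk)
  have hUU : ∀ k ∈ T, k + 1 ∈ T → 0 < U k * U (k + 1) := by
    intro k hk hk'
    have h1 : ∀ i ∈ T, 0 < a i ^ 2 - f i ^ 2 := fun i hi =>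
      pos_of_mul_pos_right (by rw [hint i hi]; norm_num) (sq_nonneg r)
    have := mul_pos_of_sq_lt (hpos' k hk hk') (h1 k hk) (h1 _ hk')
    have e : U k * U (k + 1) = r ^ 2 / 4 * ((a k + f k) * (a (k + 1) + f (k + 1))) := by
      simp only [hU]
      ring
    rw [e]
    positivity
  have hV2 : ∀ k ∈ T, k + 1 ∈ T → V k ^ 2 = U k * U (k + 1) := fun k hk hk' =>
    Real.sq_sqrt (hUU k hk hk').le
  have hV0 : ∀ k ∈ T, k + 1 ∈ T → V k ≠ 0 := fun k hk hk' =>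
    (Real.sqrt_pos.2 (hUU k hk hk')).ne'
  -- V² = 1 would mean U (k + 1) = 1 / U k, that is σf = 0. Its exclusion makes β² positive for all
  -- t.
  have hV1 : ∀ k ∈ T, k + 1 ∈ T → V k ^ 2 ≠ 1 := by
    intro k hk hk' h1
    rw [hV2 k hk hk'] at h1
    have h2 : (U k)⁻¹ = U (k + 1) := inv_eq_of_mul_eq_one_right h1
    have h3 : (U (k + 1))⁻¹ = U k := inv_eq_of_mul_eq_one_left h1
    rw [hUi _ hk] at h2
    rw [hUi _ hk'] at h3
    simp only [hU] at h2 h3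
    have h4 : r * (f (k + 1) + f k) = 0 := by linarith
    have h5 : f (k + 1) + f k = 0 := by simpa [hr.ne'] using h4
    have h7 := hpos k hk hk'
    have h8 : f (k + 1) = -f k := by linarith
    rw [h8] at h7
    nlinarith [sq_nonneg (f k)]
  have hyy : ∀ k ∈ T, k + 1 ∈ T → U k = U (k + 1) → Y (k + 1) = -Y k ∧ Y k ≠ 0 := by
    intro k hk hk' h1
    obtain ⟨l, hl⟩ := hstep k hk hk'
    have h2 : (U k)⁻¹ = (U (k + 1))⁻¹ := by rw [h1]
    rw [hUi _ hk, hUi _ hk'] at h2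
    simp only [hU] at h1
    have h4 : r * (a (k + 1) - a k) = 0 := by linarith
    have h5 : a (k + 1) - a k = 0 := by simpa [hr.ne'] using h4
    have h6 := hl.nondeg.resolve_left (not_not.2 h5)
    have h7 : a (k + 1) = a k := by linarith
    have h8 : (b (k + 1) - b k) * (b (k + 1) + b k) = 0 := by
      have := hunit _ hk'
      rw [h7] at this
      linarith [hunit k hk]
    have h9 := (mul_eq_zero.1 h8).resolve_left h6
    have h10 : b (k + 1) = -b k := by linarith
    refine ⟨by simp only [hY, h10]; ring, ?_⟩
    intro h0
    have : b k = 0 := by simpa [hY, hr.ne'] using h0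
    exact h6 (by rw [h10, this]; simp)
  have hpβ : ∀ k ∈ T, k + 1 ∈ T → ∀ t : ℝ,
      0 < m k ^ 2 + V k ^ 2 + (V k)⁻¹ ^ 2 - 2 * Real.cos (2 * t) := by
    intro k hk hk' t
    have h1 := two_lt_sq_add_inv_sq (hV0 k hk hk') (hV1 k hk hk')
    have h2 := Real.cos_le_one (2 * t)
    nlinarith [sq_nonneg (m k)]
  have hα0 : ∀ k ∈ T, ρ ^ 2 + Y k ^ 2 + U k ^ 2 + (U k)⁻¹ ^ 2 = (r / Real.sin (θ / 2)) ^ 2 - 2 := by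
    intro k hk
    have h1 := inv_sin_sq_sub_cot_sq hs
    rw [hUi k hk, div_eq_mul_one_div r]
    simp only [hU, hY, hρ]
    linear_combination r ^ 2 * hunit k hk - hint k hk / 2 - r ^ 2 * h1
  have hpα : ∀ k ∈ T, ∀ t : ℝ,
      0 < ρ ^ 2 + Y k ^ 2 + U k ^ 2 + (U k)⁻¹ ^ 2 + 2 * Real.cos (2 * t) := by
    intro k hk t
    have h1 := two_le_sq_add_inv_sq (hU0 k hk)
    have h2 := Real.neg_one_le_cos (2 * t)
    have h3 : 0 < ρ ^ 2 := by positivity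
    nlinarith [sq_nonneg (Y k)]
  let C : CMCConnection S T :=
    { u := fun _ k => U k
      v := fun _ k => V k
      𝔳 := fun _ k => ⟨ρ, Y k⟩
      𝔥 := fun _ k => (m k : ℂ)
      α := fun _ k t => (SignType.sign (Real.sin (θ / 2)) : ℝ) *
        Real.sqrt (ρ ^ 2 + Y k ^ 2 + U k ^ 2 + (U k)⁻¹ ^ 2 + 2 * Real.cos (2 * t))
      β := fun _ k t => Real.sqrt (m k ^ 2 + V k ^ 2 + (V k)⁻¹ ^ 2 - 2 * Real.cos (2 * t))
      u_ne_zero := fun j k he => hU0 k he.2.2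
      v_ne_zero := fun j k he => hV0 k he.2.1 he.2.2
      α_ne_zero := fun j k he t => sign_mul_ne_zero hs (hpα k he.2.2 t)
      β_ne_zero := fun j k he t => (Real.sqrt_pos.2 (hpβ k he.2.1 he.2.2 t)).ne'
      α_differentiable := fun j k he =>
        (Differentiable.sqrt (by fun_prop) fun t => (hpα k he.2.2 t).ne').const_mul _
      β_differentiable := fun j k he =>
        Differentiable.sqrt (by fun_prop) fun t => (hpβ k he.2.1 he.2.2 t).ne'
      α_sq := fun j k he t => α_sq_complex (sign_mul_sqrt_sq hs (hpα k he.2.2 t))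
      β_sq := fun j k he t => β_sq_complex (by
        rw [Real.sq_sqrt (hpβ k he.2.1 he.2.2 t).le]
        simp)
      α_opposite := fun j k hF t => by rw [hα0 k hF.2.2.1, hα0 (k + 1) hF.2.2.2]
      β_opposite := fun j k _ t => rfl }
  refine ⟨C, ?_, ⟨?_, ?_, ?_, ?_, ?_⟩, fun t j k _ _ => rfl⟩
  · intro j k hF
    have hk := hF.2.2.1
    have hk' := hF.2.2.2
    have hUU' := hUU k hk hk'
    refine ⟨?_, rfl, hV2 k hk hk', rfl, Complex.ofReal_im _, ?_, ?_⟩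
    · intro h0
      change U k = -U (k + 1) at h0
      rw [h0] at hUU'
      nlinarith [sq_nonneg (U (k + 1))]
    · intro h0
      change U k ≠ U (k + 1) at h0
      have h1 : m k = -(V k * (Y k + Y (k + 1))) / (U k - U (k + 1)) := by
        simp only [hm]
        rw [if_neg h0]
      change (m k : ℂ) = (V k : ℂ) * (conj (⟨ρ, Y k⟩ : ℂ) - ⟨ρ, Y (k + 1)⟩)
        / (Complex.I * ((U k : ℂ) - U (k + 1)))
      have h2 : conj (⟨ρ, Y k⟩ : ℂ) - ⟨ρ, Y (k + 1)⟩ = -(Complex.I * (Y k + Y (k + 1))) := by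
        apply Complex.ext <;> simp
        ring
      have h3 : (V k : ℂ) * -(Complex.I * (Y k + Y (k + 1))) =
        Complex.I * -(V k * (Y k + Y (k + 1))) := by ring
      rw [h1, h2, h3, mul_div_mul_left _ _ Complex.I_ne_zero]
      push_cast
      rfl
    · intro h0
      change U k = U (k + 1) at h0
      obtain ⟨hy, hy0⟩ := hyy k hk hk' h0
      refine ⟨?_, ?_, ?_⟩
      · have h1 : m k = 2 * (U k * V k - (U k)⁻¹ * (V k)⁻¹) / (Y k - Y (k + 1)) := by
          simp only [hm]
          rw [if_pos h0]
        change (m k : ℂ) = 2 * Complex.I * ((U k : ℂ) * V k - (U k : ℂ)⁻¹ * (V k : ℂ)⁻¹)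
          / ((⟨ρ, Y k⟩ : ℂ) - ⟨ρ, Y (k + 1)⟩)
        have h2 : (⟨ρ, Y k⟩ : ℂ) - ⟨ρ, Y (k + 1)⟩ = Complex.I * (Y k - Y (k + 1)) := by
          apply Complex.ext <;> simp
        rw [h1, h2, mul_comm (2 : ℂ), mul_assoc, mul_div_mul_left _ _ Complex.I_ne_zero]
        push_cast
        rfl
      · change conj (⟨ρ, Y k⟩ : ℂ) = ⟨ρ, Y (k + 1)⟩
        rw [hy]
        apply Complex.ext <;> simp
      · intro h1
        have h2 := congrArg Complex.im h1
        change Y k = Y (k + 1) at h2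
        apply hy0
        linarith
  · intro j k he
    refine sign_mul_sqrt_eq hr hs ?_
    rw [hα0 k he.2.2]
    simp
  · intro j k he
    rfl
  · intro j k he
    rfl
  · intro j k he
    change U k + (U k)⁻¹ = _
    rw [hUi k he.2.2]
    simp only [hU]
    ring
  · intro j k he
    change U k - (U k)⁻¹ = _
    rw [hUi k he.2.2]
    simp only [hU]
    ring

/-- The sign condition on a is what v² = u u' demands: |a| > |f| for κ < 1, so u has the sign of a.
-/
theorem exists_connection1 (hS : S.OrdConnected) (hS' : S.Nontrivial) (hT : T.OrdConnected)
    (hT' : T.Nontrivial) {x n : ℤ → ℤ → E3} {θ κ : ℝ} {f h a b : ℤ → ℝ}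
    (hrc : IsRCNet T S (fun k j => x j k) (fun k j => n j k) θ f h a b)
    (hcurv : HasConstGaussCurvature S T x n 1)
    (hint : PosIntegral T f a b κ) (hκ0 : 0 < κ) (hκ : κ < 1)
    (hsign : ∀ k ∈ T, k + 1 ∈ T → SignType.sign (a (k + 1)) = SignType.sign (a k)) :
    ∃ C : CMCConnection S T, C.Cond1 ∧ C.Const1 ∧ JInvariant1 S T C.L ∧ C.Norm1 θ κ ∧
      ∃ Φ, IsParallelFrameFamily S T C.L C.M Φ ∧
        RigidlyEquivalent S T (symPoint (-2) 0 Φ 0) (symNormal Φ 0) x n := by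
  have hθ := hrc.angle
  have hκ2 : 0 < 1 - κ ^ 2 := by nlinarith
  have hsq : Real.sqrt (1 - κ ^ 2) ^ 2 = 1 - κ ^ 2 := Real.sq_sqrt hκ2.le
  have hsq0 : 0 < Real.sqrt (1 - κ ^ 2) := Real.sqrt_pos.2 hκ2
  set r := 2 / Real.sqrt (1 - κ ^ 2) with hrdef
  have hr : 0 < r := by positivity
  have hr2 : r ^ 2 * (1 - κ ^ 2) = 4 := by
    rw [hrdef, div_pow, hsq]
    field_simp
    norm_num
  have hstep : ∀ k ∈ T, k + 1 ∈ T → ∃ l, ProfileStep 1 f h a b k l := fun k hk hk' =>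
    hrc.profileStep one_ne_zero hcurv.flip (exists_step hS hS') hk hk'
  have hf : ∀ k ∈ T, k + 1 ∈ T → 0 < f (k + 1) * f k := fun k hk hk' =>
    mul_pos_of_sign_eq (hrc.f_ne_zero k hk) (hrc.f_sign k hk hk')
  have ha0 : ∀ k ∈ T, a k ≠ 0 := by
    intro k hk h0
    have := (hint k hk).1
    rw [h0] at this
    nlinarith [sq_nonneg (f k)]
  obtain ⟨C, hC, hp, hJ⟩ := exists_profile1 (S := S) hθ hr
    (fun k hk => by rw [← hr2, ← neg_sub (f k ^ 2), (hint k hk).1, neg_sub]) hrc.unit hf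
    (fun k hk hk' => mul_pos_of_sign_eq (ha0 k hk) (hsign k hk hk')) hstep
  have hcomp := hC.compatible hp.const1
  obtain ⟨Φ, hΦ⟩ := exists_parallelFrameFamily hS hS'.nonempty
    (fun j k he => C.isUnitFamily_L he) (fun j k he => C.isUnitFamily_M he)
    (isFlat_of_compatible hcomp)
  have hrig := (hp.rigidlyEquivalent hS hS' hT hT' hθ hr.ne' hC hf hstep hΦ).symm.trans hrc.param
  refine ⟨C, hC, hp.const1, hJ, ⟨fun j k he => ⟨?_, ?_⟩, fun j k hF => ?_⟩, Φ, hΦ, hrig.flip⟩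
  · rw [hp.α_eq j k he, hrdef, div_div]
  · rw [hp.re_eq j k he, hrdef]
    ring
  · rw [hp.sub_eq j k ⟨hF.1, hF.2.1, hF.2.2.1⟩, hp.sub_eq j (k + 1) ⟨hF.1, hF.2.1, hF.2.2.2⟩]
    have := hf k hF.2.2.1 hF.2.2.2
    have h2 : r * f k * (r * f (k + 1)) = r ^ 2 * (f (k + 1) * f k) := by ring
    rw [h2]
    positivity

end CMCConnection

/-! ### Connections of cK type -/

theorem inv_eq_conj_of_norm_eq_one {u : ℂ} (hu : ‖u‖ = 1) : u⁻¹ = conj u :=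
  Complex.inv_eq_conj hu

theorem ne_zero_of_norm_eq_one {u : ℂ} (hu : ‖u‖ = 1) : u ≠ 0 := by
  rw [← norm_ne_zero_iff, hu]
  exact one_ne_zero

theorem re_sq_add_im_sq_of_norm_eq_one {u : ℂ} (hu : ‖u‖ = 1) : u.re ^ 2 + u.im ^ 2 = 1 := by
  rw [pow_two u.re, pow_two u.im, ← Complex.normSq_apply, Complex.normSq_eq_norm_sq, hu, one_pow]

/-- The right hand side in the normalization of the connections of cK type. -/
theorem ck_sq_eq {u z : ℂ} (hu : ‖u‖ = 1) (t : ℝ) :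
    (‖z‖ : ℂ) ^ 2 - u ^ 2 - u⁻¹ ^ 2 + Complex.exp (2 * t) + Complex.exp (-(2 * t)) =
      ((z.re ^ 2 + z.im ^ 2 + 4 * u.im ^ 2 - 2 + 2 * Real.cosh (2 * t) : ℝ) : ℂ) := by
  have h1 : (‖z‖ : ℂ) ^ 2 = ((z.re ^ 2 + z.im ^ 2 : ℝ) : ℂ) := by
    rw [pow_two z.re, pow_two z.im, ← Complex.normSq_apply, Complex.normSq_eq_norm_sq]
    push_cast
    rfl
  have h2 : u ^ 2 + u⁻¹ ^ 2 = ((2 - 4 * u.im ^ 2 : ℝ) : ℂ) := by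
    rw [inv_eq_conj_of_norm_eq_one hu]
    have := re_sq_add_im_sq_of_norm_eq_one hu
    apply Complex.ext
    · simp [pow_two]
      linarith
    · simp [pow_two]
      ring
  have h3 : Complex.exp (2 * t) + Complex.exp (-(2 * t)) = ((2 * Real.cosh (2 * t) : ℝ) : ℂ) := by
    push_cast
    rw [Complex.two_cosh]
  rw [sub_sub, add_assoc, h1, h2, h3]
  push_cast
  ring

/-- The transport along an edge for the connections of cK type. -/
noncomputable def ckTransport (u z : ℂ) (A : ℝ → ℝ) (t : ℝ) : Mat2 :=
  (1 / (A t : ℂ)) •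
    !![z, Complex.exp (-t) * u - Complex.exp t * u⁻¹;
       Complex.exp t * u - Complex.exp (-t) * u⁻¹, conj z]

theorem isUnitFamily_ckTransport {u z : ℂ} {A : ℝ → ℝ} (hu : ‖u‖ = 1) (hA : ∀ t, A t ≠ 0)
    (hd : Differentiable ℝ A) (hsq : ∀ t : ℝ, (A t : ℂ) ^ 2 =
      (‖z‖ : ℂ) ^ 2 - u ^ 2 - u⁻¹ ^ 2 + Complex.exp (2 * t) + Complex.exp (-(2 * t))) :
    IsUnitFamily (ckTransport u z A) := by
  have hA' : ∀ t, (A t : ℂ) ≠ 0 := fun t => by exact_mod_cast hA t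
  have hu0 := ne_zero_of_norm_eq_one hu
  refine ⟨fun t => ?_, fun t => ?_, fun m n => ?_⟩
  · have := IsQuat.smul (A := !![z, Complex.exp (-t) * u - Complex.exp t * u⁻¹;
       Complex.exp t * u - Complex.exp (-t) * u⁻¹, conj z]) (by
        simp [isQuat_iff, ← Complex.exp_conj, inv_eq_conj_of_norm_eq_one hu]) (1 / A t)
    push_cast at this
    exact this
  · have h := hsq t
    have e0 : Complex.exp (t : ℂ) * Complex.exp (-(t : ℂ)) = 1 := by
      rw [← Complex.exp_add]; simp
    have e1 : Complex.exp (2 * (t : ℂ)) = Complex.exp (t : ℂ) ^ 2 := by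
      rw [← Complex.exp_nat_mul]; congr 1
    have e2 : Complex.exp (-(2 * (t : ℂ))) = Complex.exp (-(t : ℂ)) ^ 2 := by
      rw [← Complex.exp_nat_mul]; congr 1; push_cast; ring
    rw [e1, e2, ← Complex.mul_conj'] at h
    rw [ckTransport, Matrix.det_smul, Matrix.det_fin_two_of, Fintype.card_fin, one_div, inv_pow,
      inv_mul_eq_one₀ (pow_ne_zero 2 (hA' t)), h]
    generalize Complex.exp (t : ℂ) = x at *
    generalize Complex.exp (-(t : ℂ)) = y at *
    field_simp
    linear_combination (u ^ 4 + 1) * e0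
  · have hα' : Differentiable ℝ fun t => (1 / (A t : ℂ)) := by
      simp only [one_div]
      exact fun t => ((hd t).hasDerivAt.ofReal_comp).differentiableAt.inv (hA' t)
    simp only [ckTransport, Matrix.smul_apply, smul_eq_mul]
    refine hα'.mul ?_
    fin_cases m <;> fin_cases n <;> simp <;> fun_prop

theorem sub_inv_of_norm_eq_one {u : ℂ} (hu : ‖u‖ = 1) : u - u⁻¹ = 2 * Complex.I * u.im := by
  rw [inv_eq_conj_of_norm_eq_one hu, Complex.sub_conj]
  push_cast
  ring

theorem add_inv_of_norm_eq_one {u : ℂ} (hu : ‖u‖ = 1) : u + u⁻¹ = 2 * u.re := by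
  rw [inv_eq_conj_of_norm_eq_one hu, Complex.add_conj]
  push_cast
  ring

theorem ckTransport_zero {u z : ℂ} (hu : ‖u‖ = 1) (A : ℝ → ℝ) :
    ckTransport u z A 0 = (1 / (A 0 : ℂ)) •
      !![z, 2 * Complex.I * u.im; 2 * Complex.I * u.im, conj z] := by
  simp only [ckTransport, Complex.ofReal_zero, neg_zero, Complex.exp_zero, one_mul,
    sub_inv_of_norm_eq_one hu]

theorem hasMatDeriv_ckTransport {u : ℂ} (z : ℂ) {A : ℝ → ℝ} (hu : ‖u‖ = 1) (hA : A 0 ≠ 0)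
    (hd : DifferentiableAt ℝ A 0) :
    ∃ c : ℂ, HasMatDeriv (ckTransport u z A)
      ((1 / (A 0 : ℂ)) • !![0, -(2 * u.re : ℂ); (2 * u.re : ℂ), 0] + c • ckTransport u z A 0)
      0 := by
  refine HasMatDeriv.one_div_smul hd hA ?_
  have h1 : HasDerivAt (fun t : ℝ => Complex.exp (t : ℂ)) 1 0 := by
    have := ((hasDerivAt_id (0 : ℝ)).ofReal_comp).cexp
    simpa using this
  have h2 : HasDerivAt (fun t : ℝ => Complex.exp (-(t : ℂ))) (-1) 0 := by
    have := ((hasDerivAt_id (0 : ℝ)).ofReal_comp).neg.cexp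
    simpa using this
  have h3 := add_inv_of_norm_eq_one hu
  intro m n
  fin_cases m <;> fin_cases n
  · simpa using hasDerivAt_const (0 : ℝ) z
  · exact ((h2.mul_const _).sub (h1.mul_const _)).congr_deriv (by simp [← h3]; ring)
  · exact ((h1.mul_const _).sub (h2.mul_const _)).congr_deriv (by simp [← h3])
  · simpa using hasDerivAt_const (0 : ℝ) (conj z)

/-- At t = 0 the entries give z and Im u. At t = 1 the nonzero diagonal entry identifies the
normalizing factors, and the real part of the off-diagonal entry is (e - 1/e) Re u up to this
factor. -/
theorem eq_of_ckTransport_eq {u z u' z' : ℂ} {A A' : ℝ → ℝ} (hu : ‖u‖ = 1) (hu' : ‖u'‖ = 1)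
    (hA : ∀ t, A t ≠ 0) (h0 : A 0 = A' 0) (hre : z.re ≠ 0)
    (h : ∀ t, ckTransport u z A t = ckTransport u' z' A' t) : u = u' ∧ z = z' := by
  have hA' : ∀ t, (1 / A t : ℂ) ≠ 0 := fun t => one_div_ne_zero (by exact_mod_cast hA t)
  have a00 := congrFun (congrFun (h 0) 0) 0
  have a10 := congrFun (congrFun (h 0) 1) 0
  have b00 := congrFun (congrFun (h 1) 0) 0
  have b10 := congrFun (congrFun (h 1) 1) 0
  rw [ckTransport_zero hu, ckTransport_zero hu', ← h0] at a00 a10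
  rw [ckTransport, ckTransport] at b00 b10
  simp only [Matrix.smul_apply, smul_eq_mul, Matrix.of_apply, Matrix.cons_val', Matrix.cons_val_zero,
    Matrix.cons_val_one, Matrix.cons_val_fin_one] at a00 a10 b00 b10
  have e1 := mul_left_cancel₀ (hA' 0) a00
  have e2 := mul_left_cancel₀ (hA' 0) a10
  rw [← e1] at b00
  have hne : z ≠ 0 := fun h => hre (by rw [h]; rfl)
  rw [← mul_right_cancel₀ hne b00] at b10
  have e3 := mul_left_cancel₀ (hA' _) b10
  rw [inv_eq_conj_of_norm_eq_one hu, inv_eq_conj_of_norm_eq_one hu', ← Complex.ofReal_neg,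
    ← Complex.ofReal_exp, ← Complex.ofReal_exp] at e3
  have e4 := congrArg Complex.re e3
  simp only [Complex.sub_re, Complex.re_ofReal_mul, Complex.conj_re, ← sub_mul] at e4
  have hexp : Real.exp 1 - Real.exp (-1) ≠ 0 :=
    (sub_pos.2 (Real.exp_lt_exp.2 (by norm_num))).ne'
  have e5 : (u.im : ℂ) = u'.im := mul_left_cancel₀ (by simp) e2
  exact ⟨Complex.ext (mul_left_cancel₀ hexp e4) (by exact_mod_cast e5), e1⟩

/-- The two scalar equations behind the compatibility of a face. -/
theorem ck_face_equations {u v v' m y y' : ℂ} (hu : u ≠ 0) (hv : v ≠ 0) (hv' : v' ≠ 0)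
    (h : u ^ 2 = v * v') (hβ : y ^ 2 - v ^ 2 - v⁻¹ ^ 2 = y' ^ 2 - v' ^ 2 - v'⁻¹ ^ 2)
    (h1 : v ≠ -v' → m * (v + v') = u * (y + y'))
    (h2 : v = -v' → -(m * (y' - y)) = 2 * (u * v + u⁻¹ * v⁻¹) ∧ y' = -y) :
    m * (v + v') = u * (y + y') ∧
      -(m * (y' - y)) = u * v + (u * v)⁻¹ - v' * u - (v' * u)⁻¹ := by
  by_cases hvv : v = -v'
  · obtain ⟨e1, e2⟩ := h2 hvv
    have e3 : v' = -v := by rw [hvv, neg_neg]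
    refine ⟨by rw [e2, e3]; ring, ?_⟩
    rw [e1, e3, mul_inv, mul_inv, inv_neg]
    ring
  · have e1 := h1 hvv
    refine ⟨e1, ?_⟩
    have hvv' : v + v' ≠ 0 := fun h0 => hvv (eq_neg_of_add_eq_zero_left h0)
    -- Multiplication by v + v' turns the left side into u (y² - y'²) by the first equation, and the
    -- equality of squares evaluates it.
    apply mul_left_cancel₀ hvv'
    have i1 : v'⁻¹ = (u ^ 2)⁻¹ * v := by rw [h]; field_simp
    have i2 : v⁻¹ = (u ^ 2)⁻¹ * v' := by rw [h]; field_simp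
    rw [i1, i2] at hβ
    rw [mul_inv, mul_inv, i1, i2]
    have i3 : u⁻¹ = u * (u ^ 2)⁻¹ := by field_simp
    rw [i3]
    linear_combination (y - y') * e1 + u * hβ

namespace CKConnection

variable {S T : Set ℤ} (C : CKConnection S T)

theorem L_eq (t : ℝ) (j k : ℤ) : C.L t j k = ckTransport (C.u j k) (C.𝔳 j k) (C.α j k) t := rfl

theorem M_eq (t : ℝ) (j k : ℤ) : C.M t j k = ckTransport (C.v j k) (C.𝔥 j k) (C.β j k) t := rfl

theorem isUnitFamily_L {j k : ℤ} (he : IsEdge1 S T j k) : IsUnitFamily fun t => C.L t j k :=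
  isUnitFamily_ckTransport (C.u_unit j k he) (C.α_ne_zero j k he) (C.α_differentiable j k he)
    (C.α_sq j k he)

theorem isUnitFamily_M {j k : ℤ} (he : IsEdge2 S T j k) : IsUnitFamily fun t => C.M t j k :=
  isUnitFamily_ckTransport (C.v_unit j k he) (C.β_ne_zero j k he) (C.β_differentiable j k he)
    (C.β_sq j k he)

theorem β_sq_real {j k : ℤ} (he : IsEdge2 S T j k) :
    C.β j k 0 ^ 2 = (C.𝔥 j k).re ^ 2 + (C.𝔥 j k).im ^ 2 + 4 * (C.v j k).im ^ 2 := by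
  have h := C.β_sq j k he 0
  rw [ck_sq_eq (C.v_unit j k he), mul_zero, Real.cosh_zero] at h
  have h' : C.β j k 0 ^ 2 =
      (C.𝔥 j k).re ^ 2 + (C.𝔥 j k).im ^ 2 + 4 * (C.v j k).im ^ 2 - 2 + 2 * 1 := by
    exact_mod_cast h
  linarith

theorem isFlat_of_compatible {C : CKConnection S T} (hC : C.Compatible) (t : ℝ) :
    IsFlat S T (C.L t) (C.M t) := by
  intro j k hF
  obtain ⟨hc, h2, h3, h4⟩ := hC j k hF
  obtain ⟨f1, f2, f3, f4⟩ := hF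
  have hu := ne_zero_of_norm_eq_one (C.u_unit j k ⟨f1, f2, f3⟩)
  have hu' := ne_zero_of_norm_eq_one (C.u_unit j (k + 1) ⟨f1, f2, f4⟩)
  have hv := ne_zero_of_norm_eq_one (C.v_unit j k ⟨f1, f3, f4⟩)
  have hv' := ne_zero_of_norm_eq_one (C.v_unit (j + 1) k ⟨f2, f3, f4⟩)
  have i1 : (C.v (j + 1) k)⁻¹ = (C.v j k * C.v (j + 1) k)⁻¹ * C.v j k := by field_simp
  have i2 : (C.v j k)⁻¹ = (C.v j k * C.v (j + 1) k)⁻¹ * C.v (j + 1) k := by field_simp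
  have i3 : (C.u j (k + 1))⁻¹ = (C.v j k * C.v (j + 1) k)⁻¹ * C.u j k := by
    rw [← hc]; field_simp
  have i4 : (C.u j k)⁻¹ = (C.v j k * C.v (j + 1) k)⁻¹ * C.u j (k + 1) := by
    rw [← hc]; field_simp
  have e0 : Complex.exp (t : ℂ) * Complex.exp (-(t : ℂ)) = 1 := by
    rw [← Complex.exp_add]; simp
  apply IsQuat.ext
  · exact ((C.isUnitFamily_M ⟨f2, f3, f4⟩).isQuat t).mul ((C.isUnitFamily_L ⟨f1, f2, f3⟩).isQuat t)
  · exact ((C.isUnitFamily_L ⟨f1, f2, f4⟩).isQuat t).mul ((C.isUnitFamily_M ⟨f1, f3, f4⟩).isQuat t)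
  all_goals
    rw [L, M, L, M, smul_mul_smul_comm, smul_mul_smul_comm, C.α_opposite j k ⟨f1, f2, f3, f4⟩ t,
      C.β_opposite j k ⟨f1, f2, f3, f4⟩ t, Matrix.smul_apply, Matrix.smul_apply,
      mul_comm (1 / (C.β (j + 1) k t : ℂ))]
    congr 1
    simp only [Matrix.mul_apply, Fin.sum_univ_two]
    simp
  · rw [mul_inv, mul_inv] at h2
    have r1 : C.v (j + 1) k * (C.u j k)⁻¹ = C.u j (k + 1) * (C.v j k)⁻¹ := by
      rw [i4, i2]; ring
    have r2 : C.u j k * (C.v (j + 1) k)⁻¹ = C.v j k * (C.u j (k + 1))⁻¹ := by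
      rw [i1, i3]; ring
    generalize Complex.exp (t : ℂ) = x at *
    generalize Complex.exp (-(t : ℂ)) = y at *
    linear_combination h2 + (C.v (j + 1) k * C.u j k
      + (C.v (j + 1) k)⁻¹ * (C.u j k)⁻¹ - C.u j (k + 1) * C.v j k
      - (C.u j (k + 1))⁻¹ * (C.v j k)⁻¹) * e0 - y ^ 2 * r1 - x ^ 2 * r2
  · rw [i1, i2, i3, i4]
    linear_combination Complex.exp (-(t : ℂ)) * h3
      - Complex.exp (t : ℂ) * (C.v j k * C.v (j + 1) k)⁻¹ * h4

variable {C}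

/-- Here 𝔳 and the combinations of 𝔥 in its formula are imaginary, so a factor i cancels. The
equations stay complex because u and v do. -/
theorem Cond3.face (h : C.Cond3) (hc : C.Const3) {j k : ℤ} (hF : IsFace S T j k) :
    (C.𝔥 (j + 1) k).re = (C.𝔥 j k).re ∧
    (C.𝔳 j k).im * (C.v j k + C.v (j + 1) k) =
      C.u j k * ((C.𝔥 j k).im + (C.𝔥 (j + 1) k).im) ∧
    -((C.𝔳 j k).im * ((C.𝔥 (j + 1) k).im - (C.𝔥 j k).im : ℂ)) =
      C.u j k * C.v j k + (C.u j k * C.v j k)⁻¹ - C.v (j + 1) k * C.u j k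
        - (C.v (j + 1) k * C.u j k)⁻¹ := by
  obtain ⟨h1, h2, h3, h4, h5, h6, h7⟩ := h j k hF
  have e2 : IsEdge2 S T j k := ⟨hF.1, hF.2.2⟩
  have e2' : IsEdge2 S T (j + 1) k := ⟨hF.2.1, hF.2.2⟩
  have hre : (C.𝔥 (j + 1) k).re = (C.𝔥 j k).re := by
    obtain ⟨c, hc⟩ := hc.2
    rw [hc _ _ e2, hc _ _ e2']
  have hm : C.𝔳 j k = Complex.I * (C.𝔳 j k).im := by
    apply Complex.ext <;> simp [h5]
  have hsub : C.𝔥 (j + 1) k - C.𝔥 j k =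
      Complex.I * ((C.𝔥 (j + 1) k).im - (C.𝔥 j k).im : ℂ) := by
    apply Complex.ext <;> simp [hre]
  have hadd : -conj (C.𝔥 j k) + C.𝔥 (j + 1) k =
      Complex.I * ((C.𝔥 j k).im + (C.𝔥 (j + 1) k).im : ℂ) := by
    apply Complex.ext <;> simp [hre]
  refine ⟨hre, ck_face_equations (ne_zero_of_norm_eq_one (C.u_unit j k ⟨hF.1, hF.2.1, hF.2.2.1⟩))
    (ne_zero_of_norm_eq_one (C.v_unit j k e2)) (ne_zero_of_norm_eq_one (C.v_unit (j + 1) k e2')) h3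
    ?_ ?_ ?_⟩
  · have k1 := C.β_sq j k e2 0
    have k2 := C.β_sq (j + 1) k e2' 0
    have k3 : ∀ z : ℂ, (‖z‖ : ℂ) ^ 2 = (z.re : ℂ) ^ 2 + (z.im : ℂ) ^ 2 := fun z => by
      exact_mod_cast (Complex.sq_norm z).trans (by rw [Complex.normSq_apply]; ring)
    rw [k3] at k1 k2
    rw [C.β_opposite j k hF 0] at k1
    rw [hre] at k2
    linear_combination k2 - k1
  · intro hne
    have h8 := h6 hne
    have hne' : C.v j k + C.v (j + 1) k ≠ 0 := fun h0 => hne (eq_neg_of_add_eq_zero_left h0)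
    rw [eq_div_iff hne', hadd, hm] at h8
    apply mul_left_cancel₀ Complex.I_ne_zero
    linear_combination h8
  · intro heq
    obtain ⟨h8, h9, h10⟩ := h7 heq
    have him : (C.𝔥 (j + 1) k).im = -(C.𝔥 j k).im := by
      have := congrArg Complex.im h9
      simp at this
      linarith
    rw [eq_div_iff (sub_ne_zero.2 h10), hsub, hm] at h8
    refine ⟨?_, by rw [him]; push_cast; rfl⟩
    rw [← h8]
    linear_combination (-((C.𝔳 j k).im * ((C.𝔥 (j + 1) k).im - (C.𝔥 j k).im)) : ℂ) * Complex.I_sq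

theorem Cond3.compatible (h : C.Cond3) (hc : C.Const3) : C.Compatible := by
  intro j k hF
  obtain ⟨h1, h2, h3, h4, h5, -, -⟩ := h j k hF
  obtain ⟨hre, e1, e2⟩ := h.face hc hF
  have hm : C.𝔳 j k = Complex.I * (C.𝔳 j k).im := by
    apply Complex.ext <;> simp [h5]
  have hm' : conj (C.𝔳 j k) = -(Complex.I * (C.𝔳 j k).im) := by
    apply Complex.ext <;> simp [h5]
  have hsub : C.𝔥 (j + 1) k = C.𝔥 j k +
      Complex.I * ((C.𝔥 (j + 1) k).im - (C.𝔥 j k).im : ℂ) := by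
    apply Complex.ext <;> simp [hre]
  have hcj : conj (C.𝔥 j k) = C.𝔥 (j + 1) k -
      Complex.I * ((C.𝔥 j k).im + (C.𝔥 (j + 1) k).im : ℂ) := by
    apply Complex.ext <;> simp [hre]
  rw [← h4, ← h2, hm', hcj]
  refine ⟨by rw [← h3]; ring, ?_, ?_, ?_⟩
  · rw [← e2]
    linear_combination C.𝔳 j k * hsub
      + (Complex.I * ((C.𝔥 (j + 1) k).im - (C.𝔥 j k).im : ℂ)) * hm
      + ((C.𝔳 j k).im * ((C.𝔥 (j + 1) k).im - (C.𝔥 j k).im) : ℂ) * Complex.I_sq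
  · linear_combination (-(C.v j k)) * hm - Complex.I * e1
  · linear_combination (-(C.v (j + 1) k)) * hm - Complex.I * e1

theorem Cond3.kInvariant1 (h : C.Cond3) : KInvariant1 S T C.L := by
  intro t j k he he'
  have hF : IsFace S T j k := ⟨he.1, he.2.1, he.2.2, he'.2.2⟩
  obtain ⟨h1, h2, h3, h4, h5, -, -⟩ := h j k hF
  rw [L, L, ← h2, ← h4, C.α_opposite j k hF t]

end CKConnection

/-- The mean of two points of the circle. -/
theorem unit_mean {u v v' : ℂ} (hu : ‖u‖ = 1) (hv : ‖v‖ = 1)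
    (h : u ^ 2 = v * v') : u.re * (v.im + v'.im) = u.im * (v.re + v'.re) ∧
      u.re * (v.re - v'.re) + u.im * (v.im - v'.im) = 0 := by
  -- This is u / v = v' / u on the unit circle; its real and imaginary parts are the two claims.
  have h1 : u * conj v = conj u * v' := by
    have hu0 := ne_zero_of_norm_eq_one hu
    have hv0 := ne_zero_of_norm_eq_one hv
    rw [← inv_eq_conj_of_norm_eq_one hu, ← inv_eq_conj_of_norm_eq_one hv]
    field_simp
    exact h
  have h2 := congrArg Complex.re h1
  have h3 := congrArg Complex.im h1
  simp at h2 h3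
  constructor <;> linarith

theorem neg_one_zpow_sq (j : ℤ) : ((-1 : ℝ) ^ j) ^ 2 = 1 := by
  rw [← zpow_natCast, ← zpow_mul, mul_comm, zpow_mul]
  simp

theorem neg_one_zpow_succ (j : ℤ) : (-1 : ℝ) ^ (j + 1) = -(-1 : ℝ) ^ j := by
  rw [zpow_add_one₀ (by norm_num)]
  ring

theorem I_zpow_eq (j : ℤ) : Complex.I ^ j = (((-1 : ℝ) ^ j : ℝ) : ℂ) * conj (Complex.I ^ j) := by
  rw [map_zpow₀, Complex.conj_I]
  push_cast
  rw [← mul_zpow]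
  congr 1
  ring

theorem conj_I_zpow_eq (j : ℤ) :
    conj (Complex.I ^ j) = (((-1 : ℝ) ^ j : ℝ) : ℂ) * Complex.I ^ j := by
  have h : ((((-1 : ℝ) ^ j : ℝ) : ℂ)) ^ 2 = 1 := by exact_mod_cast neg_one_zpow_sq j
  linear_combination (-(((-1 : ℝ) ^ j : ℝ) : ℂ)) * I_zpow_eq j - conj (Complex.I ^ j) * h

/-! ### Profile and frames for K = -1. -/

namespace CKConnection

variable {S T : Set ℤ} {C : CKConnection S T}

/-- The data on the edges of the second kind in terms of the profile of a net of revolution. -/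
structure Profile3 (C : CKConnection S T) (θ κ : ℝ) (f a b : ℤ → ℝ) : Prop where
  β_eq : ∀ j k, IsEdge2 S T j k → C.β j k 0 = 2 * κ / Real.sin (θ / 2)
  re_eq : ∀ j k, IsEdge2 S T j k → (C.𝔥 j k).re = 2 * κ * Real.cot (θ / 2)
  im_eq : ∀ j k, IsEdge2 S T j k → (C.𝔥 j k).im = 2 * κ * b j
  v_re : ∀ j k, IsEdge2 S T j k → (C.v j k).re = (-1) ^ j * κ * f j
  v_im : ∀ j k, IsEdge2 S T j k → (C.v j k).im = -((-1) ^ j * κ * a j)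

theorem Profile3.const3 {θ κ : ℝ} {f a b : ℤ → ℝ} (hp : C.Profile3 θ κ f a b) : C.Const3 :=
  ⟨⟨_, hp.β_eq⟩, ⟨_, hp.re_eq⟩⟩

theorem Profile3.unit {θ κ : ℝ} {f a b : ℤ → ℝ} (hp : C.Profile3 θ κ f a b) (hθ : IsAngle θ)
    (hκ : κ ≠ 0) {j k : ℤ} (he : IsEdge2 S T j k) : a j ^ 2 + b j ^ 2 = 1 := by
  have h1 := C.β_sq_real he
  rw [hp.β_eq j k he, hp.re_eq j k he, hp.im_eq j k he, hp.v_im j k he, div_eq_mul_one_div] at h1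
  have h2 := inv_sin_sq_sub_cot_sq hθ.half.1
  apply mul_left_cancel₀ (pow_ne_zero 2 hκ)
  linear_combination -h1 / 4 + κ ^ 2 * h2 - κ ^ 2 * a j ^ 2 * neg_one_zpow_sq j

theorem Profile3.integral {θ κ : ℝ} {f a b : ℤ → ℝ} (hp : C.Profile3 θ κ f a b)
    {j k : ℤ} (he : IsEdge2 S T j k) : κ ^ 2 * (f j ^ 2 + a j ^ 2) = 1 := by
  have hv := re_sq_add_im_sq_of_norm_eq_one (C.v_unit j k he)
  rw [hp.v_re j k he, hp.v_im j k he] at hv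
  linear_combination hv - κ ^ 2 * (f j ^ 2 + a j ^ 2) * neg_one_zpow_sq j

/-- The relations of the profile along a face. -/
theorem Profile3.face {θ κ : ℝ} {f a b : ℤ → ℝ} (hp : C.Profile3 θ κ f a b) (hκ : κ ≠ 0)
    (h : C.Cond3) {j k : ℤ} (hF : IsFace S T j k) :
    (C.𝔳 j k).im * (a (j + 1) - a j) = 2 * (-1) ^ j * (C.u j k).im * (b (j + 1) + b j) ∧
    (C.𝔳 j k).im * (b (j + 1) - b j) = -(2 * (-1) ^ j * (C.u j k).im * (a (j + 1) + a j)) ∧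
    (C.u j k).re * (f (j + 1) + f j) = (C.u j k).im * (a (j + 1) + a j) ∧
    (C.u j k).re * (a (j + 1) - a j) = -((C.u j k).im * (f (j + 1) - f j)) := by
  obtain ⟨h1, h2, h3, h4, h5, -, -⟩ := h j k hF
  obtain ⟨-, e1, e2⟩ := h.face hp.const3 hF
  have he : IsEdge2 S T j k := ⟨hF.1, hF.2.2⟩
  have he' : IsEdge2 S T (j + 1) k := ⟨hF.2.1, hF.2.2⟩
  have hu := C.u_unit j k ⟨hF.1, hF.2.1, hF.2.2.1⟩
  have hv := C.v_unit j k he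
  have hv' := C.v_unit (j + 1) k he'
  obtain ⟨m1, m2⟩ := unit_mean hu hv h3
  -- The imaginary part of the first face equation and the real part of the second give the
  -- relations involving b. Those between f and a hold because u is a mean of v and v' on the
  -- circle.
  have k1 := congrArg Complex.im e1
  have k2 := congrArg Complex.re e2
  rw [inv_eq_conj_of_norm_eq_one (by rw [norm_mul, hu, hv, one_mul]),
    inv_eq_conj_of_norm_eq_one (by rw [norm_mul, hu, hv', one_mul])] at k2
  simp at k1 k2
  have s := neg_one_zpow_sq j
  rw [hp.im_eq j k he, hp.im_eq (j + 1) k he', hp.v_im j k he, hp.v_im (j + 1) k he',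
    neg_one_zpow_succ] at k1
  rw [hp.im_eq j k he, hp.im_eq (j + 1) k he', hp.v_im j k he, hp.v_im (j + 1) k he',
    hp.v_re j k he, hp.v_re (j + 1) k he', neg_one_zpow_succ] at k2
  rw [hp.v_im j k he, hp.v_im (j + 1) k he',
    hp.v_re j k he, hp.v_re (j + 1) k he', neg_one_zpow_succ] at m1 m2
  generalize (-1 : ℝ) ^ j = ε at *
  have hε : ε ≠ 0 := fun h0 => by simp [h0] at s
  have g3 : (C.u j k).re * (f (j + 1) + f j) = (C.u j k).im * (a (j + 1) + a j) := by
    apply mul_left_cancel₀ (mul_ne_zero hε hκ)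
    linear_combination m2
  refine ⟨?_, ?_, g3, ?_⟩
  · apply mul_left_cancel₀ (mul_ne_zero hε hκ)
    linear_combination k1 - 2 * κ * (C.u j k).im * (b (j + 1) + b j) * s
  · apply mul_left_cancel₀ hκ
    linear_combination -k2 / 2 - κ * ε * g3
  · apply mul_left_cancel₀ (mul_ne_zero hε hκ)
    linear_combination m1

theorem Profile3.im_ne_zero {θ κ : ℝ} {f a b : ℤ → ℝ} (hp : C.Profile3 θ κ f a b)
    (hκ : κ ≠ 0) (hC : C.Cond3) {j k : ℤ} (hF : IsFace S T j k) (hu : (C.u j k).re ≠ 0)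
    (hf : 0 < f (j + 1) * f j) : (C.u j k).im ≠ 0 := by
  obtain ⟨-, -, e3, -⟩ := hp.face hκ hC hF
  intro h0
  rw [h0, zero_mul] at e3
  have h2 : f (j + 1) = -f j := by linarith [(mul_eq_zero.1 e3).resolve_left hu]
  rw [h2] at hf
  nlinarith [sq_nonneg (f j)]

theorem Profile3.profileStep {θ κ : ℝ} {f h a b : ℤ → ℝ} (hp : C.Profile3 θ κ f a b)
    (hθ : IsAngle θ) (hκ : κ ≠ 0) (hC : C.Cond3) {j k : ℤ} (hF : IsFace S T j k)
    (hu : (C.u j k).re ≠ 0) (hf : 0 < f (j + 1) * f j)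
    (hh : b (j + 1) - b j = -(C.u j k).im / (C.u j k).re * (h (j + 1) - h j)) :
    ProfileStep (-1) f h a b j (-(C.u j k).im / (C.u j k).re) := by
  obtain ⟨e1, e2, e3, e4⟩ := hp.face hκ hC hF
  have hi := hp.im_ne_zero hκ hC hF hu hf
  have hg : 2 * (-1 : ℝ) ^ j * (C.u j k).im ≠ 0 :=
    mul_ne_zero (mul_ne_zero two_ne_zero (zpow_ne_zero _ (by norm_num))) hi
  refine ⟨div_ne_zero (neg_ne_zero.2 hi) hu, ?_, hh, ?_, ?_⟩
  · rw [div_mul_eq_mul_div, eq_div_iff hu]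
    linear_combination e4
  · rw [div_mul_eq_mul_div, div_eq_iff hu]
    linear_combination e3
  · by_contra! h0
    rw [h0.1, mul_zero] at e1
    rw [h0.2, mul_zero] at e2
    have hb := (mul_eq_zero.1 e1.symm).resolve_left hg
    have ha := (mul_eq_zero.1 (neg_eq_zero.1 e2.symm)).resolve_left hg
    have := hp.unit hθ hκ (j := j) (k := k) ⟨hF.1, hF.2.2⟩
    have ha0 : a j = 0 := by linarith [h0.1]
    have hb0 : b j = 0 := by linarith [h0.2]
    rw [ha0, hb0] at this
    norm_num at this

theorem Cond3.exists_face (hC : C.Cond3) (hT : T.OrdConnected) (hT' : T.Nontrivial) {j k : ℤ}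
    (he : IsEdge1 S T j k) :
    ∃ i, IsFace S T j i ∧ C.u j k = C.u j i ∧ C.𝔳 j k = C.𝔳 j i := by
  obtain ⟨i, hi, hi', h⟩ := mem_step hT hT' he.2.2
  have hF : IsFace S T j i := ⟨he.1, he.2.1, hi, hi'⟩
  obtain ⟨-, h2, -, h4, -⟩ := hC j i hF
  rcases h with rfl | rfl
  · exact ⟨k, hF, rfl, rfl⟩
  · exact ⟨i, hF, h2.symm, h4.symm⟩

/-- The Sym formula yields the net of revolution with the given profile. -/
theorem Profile3.rigidlyEquivalent (hS : S.OrdConnected) (hS' : S.Nontrivial)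
    (hT : T.OrdConnected) (hT' : T.Nontrivial) {θ κ : ℝ} {f h a b : ℤ → ℝ}
    (hp : C.Profile3 θ κ f a b) (hθ : IsAngle θ) (hκ : κ ≠ 0) (hC : C.Cond3)
    (hf : ∀ j ∈ S, j + 1 ∈ S → 0 < f (j + 1) * f j)
    (hstep : ∀ j ∈ S, j + 1 ∈ S → ∃ l, ProfileStep (-1) f h a b j l)
    {Φ : ℝ → ℤ → ℤ → Mat2} (hΦ : IsParallelFrameFamily S T C.L C.M Φ) :
    RigidlyEquivalent S T (revolve θ f h) (revolve θ a b) (symPoint 2 0 Φ 0)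
      (symNormal Φ 0) := by
  obtain ⟨hs, -⟩ := hθ.half
  obtain ⟨k₀, hk₀, hk₀'⟩ := exists_step hT hT'
  have hpq : ∀ j, ∃ p q : ℝ, j ∈ S → p ^ 2 + q ^ 2 = 1 ∧ a j = 2 * p * q ∧ b j = p ^ 2 - q ^ 2 := by
    intro j
    by_cases hj : j ∈ S
    · obtain ⟨p, q, h⟩ := exists_half_angle (hp.unit hθ hκ (j := j) (k := k₀) ⟨hj, hk₀, hk₀'⟩)
      exact ⟨p, q, fun _ => h⟩
    · exact ⟨0, 0, fun h => absurd h hj⟩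
  choose p q hpq using hpq
  have hε : ∀ j : ℤ, ((((-1 : ℝ) ^ j : ℝ) : ℂ)) ^ 2 = 1 := fun j => by
    exact_mod_cast neg_one_zpow_sq j
  refine rigidlyEquivalent_revolve hS hS'.nonempty hT hT'.nonempty hΦ two_ne_zero
    -- The diagonal of L is imaginary, so each step along the profile multiplies the gauge by i. As
    -- conj(i^j) = (-1)^j i^j, this absorbs the alternating sign in the dictionary.
    (P := fun j => profileFrame (Complex.I ^ j) (p j) (q j)) ?_ ?_ ?_
  · intro j hj
    obtain ⟨h1, h2, h3⟩ := hpq j hj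
    exact ⟨isQuat_profileFrame _ _ _, profileFrame_ne_zero (zpow_ne_zero _ Complex.I_ne_zero) h1,
      profileFrame_mul_imH _ h1 h2 h3⟩
  · intro j k he
    refine ⟨(C.isUnitFamily_L he).det_eq 0, ?_⟩
    have hun := C.u_unit j k he
    obtain ⟨c', hL⟩ := hasMatDeriv_ckTransport (C.𝔳 j k) hun (C.α_ne_zero j k he 0)
      (C.α_differentiable j k he 0)
    obtain ⟨l, hl⟩ := hstep j he.1 he.2.1
    obtain ⟨i, hF, hui, hmi⟩ := hC.exists_face hT hT' he
    obtain ⟨-, -, -, -, h5, -⟩ := hC j i hF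
    obtain ⟨e1, e2, e3, e4⟩ := hp.face hκ hC hF
    rw [← hmi, ← hui] at e1 e2
    rw [← hui] at e3 e4
    rw [← hmi] at h5
    have hm : C.𝔳 j k = Complex.I * (C.𝔳 j k).im := by
      apply Complex.ext <;> simp [h5]
    have hm' : conj (C.𝔳 j k) = -(Complex.I * (C.𝔳 j k).im) := by
      apply Complex.ext <;> simp [h5]
    obtain ⟨p1, p2, p3⟩ := hpq j he.1
    obtain ⟨p1', p2', p3'⟩ := hpq (j + 1) he.2.1
    have hX := half_angle_step (g := -(2 * (-1) ^ j * (C.u j k).im)) p1 p2 p3 p1' p2' p3'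
      (by rw [e1]; ring) (by rw [e2]; ring)
    have hI : Complex.I ^ (j + 1) = Complex.I * Complex.I ^ j := by
      rw [zpow_add_one₀ Complex.I_ne_zero, mul_comm]
    have hcj := conj_I_zpow_eq j
    have hε := hε j
    refine ⟨l, _, c', _, hl.ne_zero, hl.diff_a, hl.diff_b,
      profileFrame_step (c := 1 / C.α j k 0) p1' hX ?_ ?_ ?_ ?_, hL, ?_⟩
    all_goals
      simp only [L_eq, ckTransport_zero hun, hI, map_mul, Complex.conj_I, hcj, hm']
      generalize (-1 : ℝ) ^ j = ε at *
    · rw [hm]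
      simp
      ring
    · simp
      ring
    · simp
      linear_combination (-2 * Complex.I * Complex.I ^ j * (C.u j k).im * (C.α j k 0 : ℂ)⁻¹) * hε
    · simp
      ring
    -- The given l is identified through `sum_a`, using σa ≠ 0.
    · have hlg : l * (C.u j k).re = -(C.u j k).im := by
        have hσ : a (j + 1) + a j ≠ 0 := by
          intro h0
          have h3 := hl.sum_a
          rw [h0, mul_zero] at h3
          have h2 : f (j + 1) = -f j := by linarith
          have h3 := hf j he.1 he.2.1
          rw [h2] at h3
          nlinarith [sq_nonneg (f j)]
        apply mul_right_cancel₀ hσ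
        linear_combination -e3 + (C.u j k).re * hl.sum_a
      have hlg' : (l : ℂ) * (C.u j k).re = -(C.u j k).im := by
        exact_mod_cast hlg
      ext m n
      fin_cases m <;> fin_cases n <;>
        simp [pauli3]
      · linear_combination (4 * (C.α j k 0 : ℂ)⁻¹) * hlg'
          - (4 * (C.α j k 0 : ℂ)⁻¹ * (C.u j k).im) * Complex.I_sq
      · linear_combination (4 * (C.α j k 0 : ℂ)⁻¹) * hlg'
          - (4 * (C.α j k 0 : ℂ)⁻¹ * (C.u j k).im) * Complex.I_sq
  · intro j k he
    refine ⟨(C.isUnitFamily_M he).det_eq 0, ?_⟩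
    have hvn := C.v_unit j k he
    obtain ⟨c', hM⟩ := hasMatDeriv_ckTransport (C.𝔥 j k) hvn (C.β_ne_zero j k he 0)
      (C.β_differentiable j k he 0)
    obtain ⟨p1, p2, p3⟩ := hpq j he.1
    have hs' : (Real.sin (θ / 2) : ℂ) ≠ 0 := by exact_mod_cast hs
    have hκ' : (κ : ℂ) ≠ 0 := by exact_mod_cast hκ
    have hh : C.𝔥 j k = 2 * κ * (Real.cos (θ / 2) / Real.sin (θ / 2) + Complex.I * b j) := by
      rw [← Complex.re_add_im (C.𝔥 j k), hp.re_eq j k he, hp.im_eq j k he,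
        Real.cot_eq_cos_div_sin]
      push_cast
      ring
    have hcj := conj_I_zpow_eq j
    have hε := hε j
    refine ⟨c', _, mul_profileFrame_eq p1 p2 p3 ?_ ?_ ?_ ?_, hM, ?_⟩
    all_goals
      simp only [M_eq, ckTransport_zero hvn, hp.β_eq j k he, hh, hp.v_im j k he, hp.v_re j k he,
        hcj]
      generalize (-1 : ℝ) ^ j = ε at *
    · simp [-Complex.ofReal_cos, -Complex.ofReal_sin]
      field_simp
    · simp [-Complex.ofReal_cos, -Complex.ofReal_sin]
      field_simp
      linear_combination (a j : ℂ) * hε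
    · simp [-Complex.ofReal_cos, -Complex.ofReal_sin]
      field_simp
    · simp [-Complex.ofReal_cos, -Complex.ofReal_sin, Complex.conj_ofNat]
      field_simp
      ring
    · ext m n
      fin_cases m <;> fin_cases n <;>
        simp [profileFrame, pauli2, hcj, -Complex.ofReal_cos, -Complex.ofReal_sin] <;>
        field_simp <;> simp [hε]

end CKConnection

/-! ### The correspondence between connections and nets for K = -1. -/

namespace CKConnection

variable {S T : Set ℤ} {C : CKConnection S T}

theorem Cond3.isRCNet (hS : S.OrdConnected) (hS' : S.Nontrivial) (hT : T.OrdConnected)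
    (hT' : T.Nontrivial) (hC : C.Cond3) {θ κ : ℝ} (hK : KInvariant2 S T C.M)
    (hθ : IsAngle θ) (hκ : 0 < κ) (hN : C.Norm3 θ κ) {Φ : ℝ → ℤ → ℤ → Mat2}
    (hΦ : IsParallelFrameFamily S T C.L C.M Φ) :
    ∃ f h a b : ℤ → ℝ,
      IsRCNet S T (symPoint 2 0 Φ 0) (symNormal Φ 0) θ f h a b ∧
      HasConstGaussCurvature S T (symPoint 2 0 Φ 0) (symNormal Φ 0) (-1) ∧
      NegIntegral S f a b κ := by
  obtain ⟨hN1, hN2, hN3⟩ := hN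
  obtain ⟨k₀, hk₀, hk₀'⟩ := exists_step hT hT'
  have hinv : ∀ j k, IsEdge2 S T j k → C.v j k = C.v j k₀ ∧ C.𝔥 j k = C.𝔥 j k₀ := by
    intro j k he
    refine ordConnected_int_induction (ordConnected_steps hT)
      (p := fun k => C.v j k = C.v j k₀ ∧ C.𝔥 j k = C.𝔥 j k₀) ⟨hk₀, hk₀'⟩ ⟨rfl, rfl⟩ ?_ k he.2
    intro i hi hi'
    have e1 : IsEdge2 S T j i := ⟨he.1, hi⟩
    have e2 : IsEdge2 S T j (i + 1) := ⟨he.1, hi'⟩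
    obtain ⟨h1, h2⟩ := eq_of_ckTransport_eq (C.v_unit j i e1) (C.v_unit j _ e2)
      (C.β_ne_zero j i e1) (by rw [(hN1 j i e1).1, (hN1 j _ e2).1])
      (by
        rw [(hN1 j i e1).2]
        have := hθ.cot_ne_zero
        positivity) (fun t => hK t j i e1 e2)
    rw [h1, h2]
  -- The normalization makes Re v change sign at every step; the factor (-1)^j turns this into a
  -- constant sign of f.
  set f : ℤ → ℝ := fun j => (-1) ^ j * (C.v j k₀).re / κ with hfdef
  set a : ℤ → ℝ := fun j => -((-1) ^ j * (C.v j k₀).im / κ) with hadef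
  set b : ℤ → ℝ := fun j => (C.𝔥 j k₀).im / (2 * κ) with hbdef
  have hp : C.Profile3 θ κ f a b := by
    refine ⟨?_, ?_, ?_, ?_, ?_⟩ <;> intro j k he
    · exact (hN1 j k he).1
    · exact (hN1 j k he).2
    · rw [(hinv j k he).2]
      simp only [hbdef]
      field_simp
    · rw [(hinv j k he).1]
      simp only [hfdef]
      field_simp
      rw [neg_one_zpow_sq, mul_one]
    · rw [(hinv j k he).1]
      simp only [hadef]
      field_simp
      rw [neg_one_zpow_sq, mul_one]
  have he : ∀ {j}, j ∈ S → IsEdge2 S T j k₀ := fun hj => ⟨hj, hk₀, hk₀'⟩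
  have hunit : ∀ j ∈ S, a j ^ 2 + b j ^ 2 = 1 := fun j hj => hp.unit hθ hκ.ne' (he hj)
  have hf : ∀ j ∈ S, j + 1 ∈ S → 0 < f (j + 1) * f j := by
    intro j hj hj'
    have h1 := hN3 j k₀ ⟨hj, hj', hk₀, hk₀'⟩
    rw [hp.v_re j k₀ (he hj), hp.v_re _ k₀ (he hj'), neg_one_zpow_succ] at h1
    have h2 : 0 < κ ^ 2 * (f (j + 1) * f j) := by
      linear_combination h1 + κ ^ 2 * (f (j + 1) * f j) * neg_one_zpow_sq j
    exact pos_of_mul_pos_right h2 (by positivity)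
  obtain ⟨h, hh⟩ := exists_antidifference fun j =>
    (b (j + 1) - b j) / (-(C.u j k₀).im / (C.u j k₀).re)
  have hstep : ∀ j ∈ S, j + 1 ∈ S → ∃ l, ProfileStep (-1) f h a b j l := by
    intro j hj hj'
    have hF : IsFace S T j k₀ := ⟨hj, hj', hk₀, hk₀'⟩
    have hu := hN2 j k₀ ⟨hj, hj', hk₀⟩
    have hi := hp.im_ne_zero hκ.ne' hC hF hu (hf j hj hj')
    exact ⟨_, hp.profileStep hθ hκ.ne' hC hF hu (hf j hj hj')
      (by rw [hh, mul_div_cancel₀ _ (div_ne_zero (neg_ne_zero.2 hi) hu)])⟩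
  have hrig := hp.rigidlyEquivalent hS hS' hT hT' hθ hκ.ne' hC hf hstep hΦ
  have hf0 : ∀ j ∈ S, f j ≠ 0 := by
    intro j hj
    obtain ⟨i, hi, hi', h⟩ := mem_step hS hS' hj
    have h1 := hf i hi hi'
    rcases h with rfl | rfl
    · exact right_ne_zero_of_mul h1.ne'
    · exact left_ne_zero_of_mul h1.ne'
  obtain ⟨h1, h2⟩ := isRCNet_of_profile hθ (neg_ne_zero.2 one_ne_zero) hf0 (fun j hj hj' =>
    sign_eq_of_mul_pos (hf j hj hj')) hunit hstep hrig
  refine ⟨f, h, a, b, h1, h2, fun j hj => ?_⟩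
  have h3 : f j ^ 2 + a j ^ 2 = 1 / κ ^ 2 := by
    rw [eq_div_iff (by positivity), mul_comm]
    exact hp.integral (he hj)
  exact ⟨h3, by linarith [hunit j hj]⟩

/-- The connection of a profile whose net of revolution has curvature minus one. -/
theorem exists_profile3 {θ κ : ℝ} {f h a b : ℤ → ℝ} (hθ : IsAngle θ) (hκ : 0 < κ)
    (hint : ∀ j ∈ S, κ ^ 2 * (f j ^ 2 + a j ^ 2) = 1) (hunit : ∀ j ∈ S, a j ^ 2 + b j ^ 2 = 1)
    (hpos : ∀ j ∈ S, j + 1 ∈ S → 0 < f (j + 1) * f j)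
    (hstep : ∀ j ∈ S, j + 1 ∈ S → ∃ l, ProfileStep (-1) f h a b j l) :
    ∃ C : CKConnection S T, C.Cond3 ∧ C.Profile3 θ κ f a b ∧ KInvariant2 S T C.M ∧
      ∀ j k, IsEdge1 S T j k → (C.u j k).re ≠ 0 := by
  obtain ⟨hs, -⟩ := hθ.half
  set V : ℤ → ℂ := fun j => ⟨(-1) ^ j * κ * f j, -((-1) ^ j * κ * a j)⟩ with hV
  set Y : ℤ → ℝ := fun j => 2 * κ * b j with hY
  set ρ : ℝ := 2 * κ * Real.cot (θ / 2) with hρ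
  set H : ℤ → ℂ := fun j => ⟨ρ, Y j⟩ with hH
  have hsq : ∀ j, ∃ z : ℂ, z ^ 2 = V j * V (j + 1) := fun j =>
    IsAlgClosed.exists_pow_nat_eq _ (by norm_num)
  -- Either square root serves: the edge conditions involve u² and a formula for 𝔳 in terms of u.
  choose U hU using hsq
  set W : ℤ → ℂ := fun j => if V j = -V (j + 1) then
    2 * (U j * V j + (U j)⁻¹ * (V j)⁻¹) / (H (j + 1) - H j)
    else U j * (-conj (H j) + H (j + 1)) / (V j + V (j + 1)) with hW
  have hV1 : ∀ j ∈ S, ‖V j‖ = 1 := by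
    intro j hj
    have h1 : ‖V j‖ ^ 2 = 1 := by
      rw [Complex.sq_norm, Complex.normSq_apply]
      simp only [hV]
      linear_combination hint j hj + κ ^ 2 * (f j ^ 2 + a j ^ 2) * neg_one_zpow_sq j
    exact (pow_eq_one_iff_of_nonneg (norm_nonneg _) two_ne_zero).1 h1
  have hU1 : ∀ j ∈ S, j + 1 ∈ S → ‖U j‖ = 1 := by
    intro j hj hj'
    have h1 : ‖U j‖ ^ 2 = 1 := by
      rw [← norm_pow, hU, norm_mul, hV1 j hj, hV1 _ hj', one_mul]
    exact (pow_eq_one_iff_of_nonneg (norm_nonneg _) two_ne_zero).1 h1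
  have hσ : ∀ j ∈ S, j + 1 ∈ S → f (j + 1) + f j ≠ 0 ∧ a (j + 1) + a j ≠ 0 := by
    intro j hj hj'
    obtain ⟨l, hl⟩ := hstep j hj hj'
    have h1 : f (j + 1) + f j ≠ 0 := by
      intro h0
      have h7 := hpos j hj hj'
      have h8 : f (j + 1) = -f j := by linarith
      rw [h8] at h7
      nlinarith [sq_nonneg (f j)]
    refine ⟨h1, fun h0 => h1 ?_⟩
    have := hl.sum_a
    rw [h0] at this
    linarith
  have hε : ∀ j : ℤ, (-1 : ℝ) ^ j * κ ≠ 0 := fun j =>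
    mul_ne_zero (zpow_ne_zero _ (by norm_num)) hκ.ne'
  have hmean : ∀ j ∈ S, j + 1 ∈ S →
      (U j).re * (f (j + 1) + f j) = (U j).im * (a (j + 1) + a j) := by
    intro j hj hj'
    obtain ⟨-, m2⟩ := unit_mean (hU1 j hj hj') (hV1 j hj) (hU j)
    simp only [hV, neg_one_zpow_succ] at m2
    apply mul_left_cancel₀ (hε j)
    linear_combination m2
  -- Re U σf = Im U σa with both sums nonzero, so one part of U cannot vanish without the other.
  -- Then l = -Im U / Re U is finite and nonzero, and α² > 0 for all t.
  have hUU : ∀ j ∈ S, j + 1 ∈ S → (U j).re ≠ 0 ∧ (U j).im ≠ 0 := by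
    intro j hj hj'
    obtain ⟨s1, s2⟩ := hσ j hj hj'
    have h1 := hmean j hj hj'
    have h2 := re_sq_add_im_sq_of_norm_eq_one (hU1 j hj hj')
    constructor
    · intro h0
      rw [h0, zero_mul] at h1
      rw [h0, (mul_eq_zero.1 h1.symm).resolve_right s2] at h2
      norm_num at h2
    · intro h0
      rw [h0, zero_mul] at h1
      rw [h0, (mul_eq_zero.1 h1).resolve_right s1] at h2
      norm_num at h2
  have hyy : ∀ j ∈ S, j + 1 ∈ S → V j = -V (j + 1) → Y (j + 1) = -Y j ∧ Y j ≠ 0 := by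
    intro j hj hj' h1
    obtain ⟨l, hl⟩ := hstep j hj hj'
    have h2 := congrArg Complex.im h1
    simp only [hV, Complex.neg_im, neg_one_zpow_succ] at h2
    have h5 : a (j + 1) - a j = 0 := by
      apply mul_left_cancel₀ (hε j)
      linear_combination h2
    have h6 := hl.nondeg.resolve_left (not_not.2 h5)
    have h7 : a (j + 1) = a j := by linarith
    have h8 : (b (j + 1) - b j) * (b (j + 1) + b j) = 0 := by
      have := hunit _ hj'
      rw [h7] at this
      linarith [hunit j hj]
    have h9 := (mul_eq_zero.1 h8).resolve_left h6
    have h10 : b (j + 1) = -b j := by linarith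
    refine ⟨by simp only [hY, h10]; ring, ?_⟩
    intro h0
    have : b j = 0 := by simpa [hY, hκ.ne'] using h0
    exact h6 (by rw [h10, this]; simp)
  have hsub : ∀ j, H (j + 1) - H j = Complex.I * (Y (j + 1) - Y j : ℝ) := by
    intro j
    apply Complex.ext <;> simp [hH]
  have hadd : ∀ j, -conj (H j) + H (j + 1) = Complex.I * (Y j + Y (j + 1) : ℝ) := by
    intro j
    apply Complex.ext <;> simp [hH]
  have hWre : ∀ j ∈ S, j + 1 ∈ S → (W j).re = 0 := by
    intro j hj hj'
    have c1 := inv_eq_conj_of_norm_eq_one (hU1 j hj hj')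
    have c2 := inv_eq_conj_of_norm_eq_one (hV1 j hj)
    have c3 := inv_eq_conj_of_norm_eq_one (hV1 _ hj')
    -- Conjugation inverts the unit numbers U and V. The symmetric sum in the numerator,
    -- respectively U / (V + V') with U² = V V', is unchanged, while the remaining factor or divisor
    -- is imaginary.
    have hW' : conj (W j) = -W j := by
      simp only [hW]
      split_ifs with h0
      · rw [hsub]
        simp only [map_div₀, map_mul, map_add, ← c1, ← c2, map_inv₀, inv_inv, Complex.conj_I,
          Complex.conj_ofReal, Complex.conj_ofNat]
        rw [neg_mul, div_neg, add_comm]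
      · have hne : V j + V (j + 1) ≠ 0 := fun h => h0 (eq_neg_of_add_eq_zero_left h)
        have u0 := ne_zero_of_norm_eq_one (hU1 j hj hj')
        have v0 := ne_zero_of_norm_eq_one (hV1 j hj)
        have v0' := ne_zero_of_norm_eq_one (hV1 _ hj')
        rw [hadd]
        simp only [map_div₀, map_mul, map_add, ← c1, ← c2, ← c3, Complex.conj_I,
          Complex.conj_ofReal]
        have e1 : (V j)⁻¹ + (V (j + 1))⁻¹ = (V j + V (j + 1)) / (U j) ^ 2 := by
          rw [hU]
          field_simp
          ring
        rw [e1]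
        field_simp
    have := congrArg Complex.re hW'
    simp only [Complex.conj_re, Complex.neg_re] at this
    linarith
  have hpα : ∀ j ∈ S, j + 1 ∈ S → ∀ t : ℝ,
      0 < (W j).re ^ 2 + (W j).im ^ 2 + 4 * (U j).im ^ 2 - 2 + 2 * Real.cosh (2 * t) := by
    intro j hj hj' t
    have h1 := Real.one_le_cosh (2 * t)
    have h2 : 0 < (U j).im ^ 2 := pow_two_pos_of_ne_zero (hUU j hj hj').2
    nlinarith [sq_nonneg (W j).re, sq_nonneg (W j).im]
  have hβ0 : ∀ j ∈ S, ρ ^ 2 + Y j ^ 2 + 4 * (V j).im ^ 2 = (2 * κ / Real.sin (θ / 2)) ^ 2 := by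
    intro j hj
    have h1 := inv_sin_sq_sub_cot_sq hs
    rw [div_eq_mul_one_div]
    simp only [hV, hY, hρ]
    linear_combination 4 * κ ^ 2 * hunit j hj - 4 * κ ^ 2 * h1
      + 4 * κ ^ 2 * a j ^ 2 * neg_one_zpow_sq j
  have hpβ : ∀ j ∈ S, ∀ t : ℝ,
      0 < ρ ^ 2 + Y j ^ 2 + 4 * (V j).im ^ 2 - 2 + 2 * Real.cosh (2 * t) := by
    intro j hj t
    rw [hβ0 j hj]
    have h2 := Real.one_le_cosh (2 * t)
    have h3 : 0 < (2 * κ / Real.sin (θ / 2)) ^ 2 := by positivity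
    linarith
  let C : CKConnection S T :=
    { u := fun j _ => U j
      v := fun j _ => V j
      𝔳 := fun j _ => W j
      𝔥 := fun j _ => H j
      α := fun j _ t => Real.sqrt ((W j).re ^ 2 + (W j).im ^ 2 + 4 * (U j).im ^ 2 - 2
        + 2 * Real.cosh (2 * t))
      β := fun j _ t => (SignType.sign (Real.sin (θ / 2)) : ℝ) *
        Real.sqrt (ρ ^ 2 + Y j ^ 2 + 4 * (V j).im ^ 2 - 2 + 2 * Real.cosh (2 * t))
      u_unit := fun j k he => hU1 j he.1 he.2.1
      v_unit := fun j k he => hV1 j he.1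
      α_ne_zero := fun j k he t => (Real.sqrt_pos.2 (hpα j he.1 he.2.1 t)).ne'
      β_ne_zero := fun j k he t => sign_mul_ne_zero hs (hpβ j he.1 t)
      α_differentiable := fun j k he =>
        Differentiable.sqrt (by fun_prop) fun t => (hpα j he.1 he.2.1 t).ne'
      β_differentiable := fun j k he =>
        (Differentiable.sqrt (by fun_prop) fun t => (hpβ j he.1 t).ne').const_mul _
      α_sq := fun j k he t => by
        rw [ck_sq_eq (hU1 j he.1 he.2.1), ← Complex.ofReal_pow,
          Real.sq_sqrt (hpα j he.1 he.2.1 t).le]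
      β_sq := fun j k he t => by
        rw [ck_sq_eq (hV1 j he.1), ← Complex.ofReal_pow, sign_mul_sqrt_sq hs (hpβ j he.1 t)]
      α_opposite := fun j k _ t => rfl
      β_opposite := fun j k hF t => by rw [hβ0 j hF.1, hβ0 (j + 1) hF.2.1] }
  refine ⟨C, ?_, ⟨?_, fun j k he => rfl, fun j k he => rfl, fun j k he => rfl, fun j k he => rfl⟩,
    fun t j k _ _ => rfl, fun j k he => (hUU j he.1 he.2.1).1⟩
  · intro j k hF
    refine ⟨?_, rfl, hU j, rfl, hWre j hF.1 hF.2.1, fun h0 => if_neg h0,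
      fun h0 => ⟨if_pos h0, ?_, ?_⟩⟩
    · intro h0
      have h2 := congrArg Complex.re h0
      change (-1) ^ j * κ * f j = (-1) ^ (j + 1) * κ * f (j + 1) at h2
      rw [neg_one_zpow_succ] at h2
      apply (hσ j hF.1 hF.2.1).1
      apply mul_left_cancel₀ (hε j)
      linear_combination h2
    · change conj (⟨ρ, Y (j + 1)⟩ : ℂ) = ⟨ρ, Y j⟩
      rw [(hyy j hF.1 hF.2.1 h0).1]
      apply Complex.ext <;> simp
    · intro h1
      have h2 := congrArg Complex.im h1
      change Y (j + 1) = Y j at h2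
      obtain ⟨hy, hy0⟩ := hyy j hF.1 hF.2.1 h0
      apply hy0
      linarith
  · intro j k he
    refine sign_mul_sqrt_eq (by positivity) hs ?_
    rw [hβ0 j he.1]
    simp

theorem exists_connection3 (hS : S.OrdConnected) (hS' : S.Nontrivial) (hT : T.OrdConnected)
    (hT' : T.Nontrivial) {x n : ℤ → ℤ → E3} {θ : ℝ} {f h a b : ℤ → ℝ}
    (hrc : IsRCNet S T x n θ f h a b) (hcurv : HasConstGaussCurvature S T x n (-1)) :
    ∃ κ : ℝ, 0 < κ ∧ NegIntegral S f a b κ ∧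
      ∃ C : CKConnection S T, C.Cond3 ∧ C.Const3 ∧ KInvariant2 S T C.M ∧ C.Norm3 θ κ ∧
        ∃ Φ, IsParallelFrameFamily S T C.L C.M Φ ∧
          RigidlyEquivalent S T (symPoint 2 0 Φ 0) (symNormal Φ 0) x n := by
  have hθ := hrc.angle
  obtain ⟨j₀, hj₀⟩ := hS'.nonempty
  have hstep : ∀ j ∈ S, j + 1 ∈ S → ∃ l, ProfileStep (-1) f h a b j l := fun j hj hj' =>
    hrc.profileStep (neg_ne_zero.2 one_ne_zero) hcurv (exists_step hT hT') hj hj'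
  have hf : ∀ j ∈ S, j + 1 ∈ S → 0 < f (j + 1) * f j := fun j hj hj' =>
    mul_pos_of_sign_eq (hrc.f_ne_zero j hj) (hrc.f_sign j hj hj')
  -- The first integral for K = -1 is a positive sum of squares, so every such net has a parameter:
  -- κ is the inverse of its square root.
  have hconst : ∀ j ∈ S, f j ^ 2 + a j ^ 2 = f j₀ ^ 2 + a j₀ ^ 2 := by
    refine ordConnected_int_induction hS hj₀ rfl fun j hj hj' => ?_
    obtain ⟨l, hl⟩ := hstep j hj hj'
    have e : f (j + 1) ^ 2 + a (j + 1) ^ 2 = f j ^ 2 + a j ^ 2 := by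
      linear_combination (a (j + 1) + a j) * hl.diff_a + (f (j + 1) - f j) * hl.sum_a
    rw [e]
  have hc0 : 0 < f j₀ ^ 2 + a j₀ ^ 2 := by
    have := hrc.f_ne_zero j₀ hj₀
    positivity
  set κ := 1 / Real.sqrt (f j₀ ^ 2 + a j₀ ^ 2) with hκdef
  have hκ : 0 < κ := by
    have := Real.sqrt_pos.2 hc0
    positivity
  have hκ2 : 1 / κ ^ 2 = f j₀ ^ 2 + a j₀ ^ 2 := by
    rw [hκdef, div_pow, Real.sq_sqrt hc0.le, one_pow, one_div_one_div]
  have hint : ∀ j ∈ S, f j ^ 2 + a j ^ 2 = 1 / κ ^ 2 := fun j hj => by rw [hκ2, hconst j hj]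
  obtain ⟨C, hC, hp, hK, hu⟩ := exists_profile3 (T := T) hθ hκ
    (fun j hj => by
      rw [hint j hj]
      field_simp) hrc.unit hf hstep
  have hcomp := hC.compatible hp.const3
  obtain ⟨Φ, hΦ⟩ := exists_parallelFrameFamily hS hS'.nonempty
    (fun j k he => C.isUnitFamily_L he) (fun j k he => C.isUnitFamily_M he)
    (isFlat_of_compatible hcomp)
  refine ⟨κ, hκ, fun j hj => ⟨hint j hj, by linarith [hint j hj, hrc.unit j hj]⟩, C, hC, hp.const3,
    hK, ⟨fun j k he => ⟨hp.β_eq j k he, hp.re_eq j k he⟩, hu, fun j k hF => ?_⟩, Φ, hΦ,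
    (hp.rigidlyEquivalent hS hS' hT hT' hθ hκ.ne' hC hf hstep hΦ).symm.trans hrc.param⟩
  rw [hp.v_re j k ⟨hF.1, hF.2.2⟩, hp.v_re (j + 1) k ⟨hF.2.1, hF.2.2⟩, neg_one_zpow_succ]
  have h1 := mul_pos (pow_pos hκ 2) (hf j hF.1 hF.2.1)
  have h2 : (-1 : ℝ) ^ j * κ * f j * (-(-1) ^ j * κ * f (j + 1)) =
      -(κ ^ 2 * (f (j + 1) * f j)) := by
    linear_combination (-(κ ^ 2 * (f (j + 1) * f j))) * neg_one_zpow_sq j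
  rw [h2]
  linarith

end CKConnection

/-! ### The three correspondences combined. -/

theorem theorem3p1 (S T : Set ℤ) (hS : S.OrdConnected) (hS' : S.Nontrivial)
    (hT : T.OrdConnected) (hT' : T.Nontrivial) :
    -- case (1): `K ≡ 1` and `0 < κ < 1`, rotation in the `j` direction
    ((∀ C : CMCConnection S T, C.Cond1 → C.Const1 →
        (C.Compatible ∧ (∀ t, IsFlat S T (C.L t) (C.M t)) ∧ JInvariant2 S T C.M) ∧
        ∀ θ κ : ℝ, JInvariant1 S T C.L → IsAngle θ → 0 < κ → κ < 1 → C.Norm1 θ κ →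
          (∃ Φ, IsParallelFrameFamily S T C.L C.M Φ) ∧
          ∀ Φ, IsParallelFrameFamily S T C.L C.M Φ → ∃ f h a b : ℤ → ℝ,
            IsRCNet T S (fun k j => symPoint (-2) 0 Φ 0 j k) (fun k j => symNormal Φ 0 j k)
              θ f h a b ∧
            HasConstGaussCurvature S T (symPoint (-2) 0 Φ 0) (symNormal Φ 0) 1 ∧
            PosIntegral T f a b κ) ∧
      (∀ (x n : ℤ → ℤ → E3) (θ κ : ℝ) (f h a b : ℤ → ℝ),
        IsRCNet T S (fun k j => x j k) (fun k j => n j k) θ f h a b →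
        HasConstGaussCurvature S T x n 1 → PosIntegral T f a b κ → 0 < κ → κ < 1 →
        (∀ k ∈ T, k + 1 ∈ T → SignType.sign (a (k + 1)) = SignType.sign (a k)) →
        ∃ C : CMCConnection S T, C.Cond1 ∧ C.Const1 ∧ JInvariant1 S T C.L ∧ C.Norm1 θ κ ∧
          ∃ Φ, IsParallelFrameFamily S T C.L C.M Φ ∧
            RigidlyEquivalent S T (symPoint (-2) 0 Φ 0) (symNormal Φ 0) x n)) ∧
    -- case (2): `K ≡ 1` and `κ > 1`, rotation in the `k` direction
    ((∀ C : CMCConnection S T, C.Cond2 → C.Const2 →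
        (C.Compatible ∧ (∀ t, IsFlat S T (C.L t) (C.M t)) ∧ KInvariant1 S T C.L) ∧
        ∀ θ κ : ℝ, KInvariant2 S T C.M → IsAngle θ → 1 < κ → C.Norm2 θ κ →
          (∃ Φ, IsParallelFrameFamily S T C.L C.M Φ) ∧
          ∀ Φ, IsParallelFrameFamily S T C.L C.M Φ → ∃ f h a b : ℤ → ℝ,
            IsRCNet S T (symPoint (-2) 0 Φ 0) (symNormal Φ 0) θ f h a b ∧
            HasConstGaussCurvature S T (symPoint (-2) 0 Φ 0) (symNormal Φ 0) 1 ∧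
            PosIntegral S f a b κ) ∧
      (∀ (x n : ℤ → ℤ → E3) (θ κ : ℝ) (f h a b : ℤ → ℝ),
        IsRCNet S T x n θ f h a b →
        HasConstGaussCurvature S T x n 1 → PosIntegral S f a b κ → 1 < κ →
        ∃ C : CMCConnection S T, C.Cond2 ∧ C.Const2 ∧ KInvariant2 S T C.M ∧ C.Norm2 θ κ ∧
          ∃ Φ, IsParallelFrameFamily S T C.L C.M Φ ∧
            RigidlyEquivalent S T (symPoint (-2) 0 Φ 0) (symNormal Φ 0) x n)) ∧
    -- case (3): `K ≡ -1`, rotation in the `k` direction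
    ((∀ C : CKConnection S T, C.Cond3 → C.Const3 →
        (C.Compatible ∧ (∀ t, IsFlat S T (C.L t) (C.M t)) ∧ KInvariant1 S T C.L) ∧
        ∀ θ κ : ℝ, KInvariant2 S T C.M → IsAngle θ → 0 < κ → C.Norm3 θ κ →
          (∃ Φ, IsParallelFrameFamily S T C.L C.M Φ) ∧
          ∀ Φ, IsParallelFrameFamily S T C.L C.M Φ → ∃ f h a b : ℤ → ℝ,
            IsRCNet S T (symPoint 2 0 Φ 0) (symNormal Φ 0) θ f h a b ∧
            HasConstGaussCurvature S T (symPoint 2 0 Φ 0) (symNormal Φ 0) (-1) ∧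
            NegIntegral S f a b κ) ∧
      (∀ (x n : ℤ → ℤ → E3) (θ : ℝ) (f h a b : ℤ → ℝ),
        IsRCNet S T x n θ f h a b → HasConstGaussCurvature S T x n (-1) →
        ∃ κ : ℝ, 0 < κ ∧ NegIntegral S f a b κ ∧
          ∃ C : CKConnection S T, C.Cond3 ∧ C.Const3 ∧ KInvariant2 S T C.M ∧ C.Norm3 θ κ ∧
            ∃ Φ, IsParallelFrameFamily S T C.L C.M Φ ∧
              RigidlyEquivalent S T (symPoint 2 0 Φ 0) (symNormal Φ 0) x n)) := by
  refine ⟨⟨fun C hC hc => ⟨⟨hC.compatible hc, CMCConnection.isFlat_of_compatible (hC.compatible hc),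
      hC.jInvariant2⟩, fun θ κ hJ hθ hκ0 hκ hN => ⟨?_, fun Φ hΦ =>
        hC.isRCNet hS hS' hT hT' hJ hθ hκ0 hκ hN hΦ⟩⟩, ?_⟩,
    ⟨fun C hC hc => ⟨⟨hC.compatible hc, CMCConnection.isFlat_of_compatible (hC.compatible hc),
      hC.kInvariant1⟩, fun θ κ hK hθ hκ hN => ⟨?_, fun Φ hΦ =>
        hC.isRCNet hS hS' hT hT' hc hK hθ hκ hN hΦ⟩⟩, ?_⟩,
    ⟨fun C hC hc => ⟨⟨hC.compatible hc, CKConnection.isFlat_of_compatible (hC.compatible hc),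
      hC.kInvariant1⟩, fun θ κ hK hθ hκ hN => ⟨?_, fun Φ hΦ =>
        hC.isRCNet hS hS' hT hT' hK hθ hκ hN hΦ⟩⟩, ?_⟩⟩
  · exact exists_parallelFrameFamily hS hS'.nonempty (fun j k he => C.isUnitFamily_L he)
      (fun j k he => C.isUnitFamily_M he)
      (CMCConnection.isFlat_of_compatible (hC.compatible hc))
  · intro x n θ κ f h a b hrc hcurv hint hκ0 hκ hsign
    exact CMCConnection.exists_connection1 hS hS' hT hT' hrc hcurv hint hκ0 hκ hsign
  · exact exists_parallelFrameFamily hS hS'.nonempty (fun j k he => C.isUnitFamily_L he)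
      (fun j k he => C.isUnitFamily_M he)
      (CMCConnection.isFlat_of_compatible (hC.compatible hc))
  · intro x n θ κ f h a b hrc hcurv hint hκ
    exact CMCConnection.exists_connection2 hS hS' hT hT' hrc hcurv hint hκ
  · exact exists_parallelFrameFamily hS hS'.nonempty (fun j k he => C.isUnitFamily_L he)
      (fun j k he => C.isUnitFamily_M he)
      (CKConnection.isFlat_of_compatible (hC.compatible hc))
  · intro x n θ f h a b hrc hcurv
    exact CKConnection.exists_connection3 hS hS' hT hT' hrc hcurv
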